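/- A knotoid diagram in a surface $\Sigma$ is a generic smooth immersion of $[0,1]$ in $\Sigma$ (finitely many multiple points, all transverse double points, distinct from the images of $0$ and $1$, which are themselves distinct) together with over/under information at each double point. A knotoid in $\Sigma$ is an equivalence class of knotoid diagrams under the equivalence relation generated by ambient isotopy of $\Sigma$ (and orientation-preserving reparametrization of $[0,1]$) and the three Reidemeister moves performed in disks disjoint from both endpoints. The mirror $\mathrm{mir}(\kappa)$ of a knotoid $\kappa$ is obtained by exchanging over and under at every crossing of a diagram of $\kappa$, and $\kappa$ is chiral if $\kappa\neq\mathrm{mir}(\kappa)$. Let $3_1$ be the knot-type knotoid whose associated knot is the trefoil: it is presented in $\mathbb{R}^2$ by the alternating diagram with underlying curve $u\mapsto(u^3-3u,\;u^4-4u^2)$, $-2\le u\le 2$, which has three crossings, the first of them passed over first; in $S^2$ it is presented by the image of this diagram under inverse stereographic projection. Theorem. The knotoid $3_1$ is chiral, i.e. $3_1\neq\mathrm{mir}(3_1)$, both as a knotoid in $\mathbb{R}^2$ and as a knotoid in $S^2$. -/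

import Mathlib

open Set
open scoped Manifold ContDiff

noncomputable section

namespace Knotoids

/-- The Euclidean plane, which is also the model space of smooth surfaces. -/
abbrev Plane : Type := EuclideanSpace ℝ (Fin 2)

/-- The standard unit sphere in Euclidean 3-space. -/
abbrev Sphere2 : Type := Metric.sphere (0 : EuclideanSpace ℝ (Fin 3)) 1

/-- The parameter interval of a knotoid diagram. -/
abbrev I : Set ℝ := Icc 0 1

section Surface

variable {M : Type*} [TopologicalSpace M] [ChartedSpace Plane M]

/-- The velocity of a curve in a surface, expressed in the preferred chart at the point `γ t`
(so velocities at parameters `s`, `t` with `γ s = γ t` are expressed in the same chart). -/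
def velocity (γ : ℝ → M) (t : ℝ) : Plane :=
  mfderiv 𝓘(ℝ, ℝ) (𝓡 2) γ t (1 : ℝ)

variable (M) in
/-- A knotoid diagram in a surface `M`: a generic smooth immersion of the unit interval with
crossing information at each double point. The curve is given with a smooth extension to the
real line, of which only the restriction to `[0, 1]` ever matters. The multiple points are finitely
many transverse double points, different from the images of `0` (the head) and `1` (the leg),
and these two images are distinct.
The set `upper` records, for the two parameters of each double point, which of them belongs to the
over-passing strand; it has no meaning at other parameters. -/
structure Diagram where
  /-- the underlying curve -/
  γ : ℝ → M
  /-- the parameters of the over-passing strands at the double points -/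
  upper : Set ℝ
  smooth : ContMDiff 𝓘(ℝ, ℝ) (𝓡 2) ∞ γ
  immersion : ∀ t ∈ I, velocity γ t ≠ 0
  finite : {t | t ∈ I ∧ ∃ s ∈ I, s ≠ t ∧ γ s = γ t}.Finite
  endpoints : ∀ s ∈ I, ∀ t ∈ I, s ≠ t → γ s = γ t → s ∈ Ioo (0 : ℝ) 1
  no_triple : ∀ s ∈ I, ∀ t ∈ I, ∀ r ∈ I, γ s = γ t → γ s = γ r → s = t ∨ s = r ∨ t = r
  transverse : ∀ s ∈ I, ∀ t ∈ I, s ≠ t → γ s = γ t →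
    LinearIndependent ℝ ![velocity γ s, velocity γ t]
  crossing : ∀ s ∈ I, ∀ t ∈ I, s ≠ t → γ s = γ t → (s ∈ upper ↔ t ∉ upper)

/-- The mirror image of a diagram: over- and under-passing strands are exchanged at every
crossing. -/
def Diagram.mirror (D : Diagram M) : Diagram M where
  γ := D.γ
  upper := D.upperᶜ
  smooth := D.smooth
  immersion := D.immersion
  finite := D.finite
  endpoints := D.endpoints
  no_triple := D.no_triple
  transverse := D.transverse
  crossing s hs t ht h h' := by
    have := D.crossing s hs t ht h h'
    simp only [mem_compl_iff, not_not]
    tauto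

/-- `D'` is obtained from `D` by an ambient isotopy of the surface, up to an orientation preserving
reparametrization `φ` of the unit interval. -/
def Isotopic (D D' : Diagram M) : Prop :=
  ∃ (F : ℝ → Diffeomorph (𝓡 2) (𝓡 2) M M ∞) (φ : ℝ → ℝ),
    ContMDiff (𝓘(ℝ, ℝ).prod (𝓡 2)) (𝓡 2) ∞ (fun p : ℝ × M => F p.1 p.2) ∧
    (∀ p, F 0 p = p) ∧
    ContDiff ℝ ∞ φ ∧ (∀ t ∈ I, 0 < deriv φ t) ∧ φ 0 = 0 ∧ φ 1 = 1 ∧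
    (∀ t ∈ I, D'.γ t = F 1 (D.γ (φ t))) ∧
    ∀ s ∈ I, ∀ t ∈ I, s ≠ t → D'.γ s = D'.γ t → (s ∈ D'.upper ↔ φ s ∈ D.upper)

/-- A smooth embedding of the plane as an open subset of the surface. The image of the closed unit
disk is the supporting disk of a Reidemeister move. -/
def IsDiskChart (ψ : Plane → M) : Prop :=
  IsLocalDiffeomorph (𝓡 2) (𝓡 2) ∞ ψ ∧ Function.Injective ψ

/-- The diagram runs in the closed supporting disk exactly at the parameters in `C`,
and in the open supporting disk exactly at the parameters in `U`. -/
def Diagram.MeetsDisk (D : Diagram M) (ψ : Plane → M) (C U : Set ℝ) : Prop :=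
  {t | t ∈ I ∧ D.γ t ∈ ψ '' Metric.closedBall 0 1} = C ∧
  {t | t ∈ I ∧ D.γ t ∈ ψ '' Metric.ball 0 1} = U

/-- The horizontal coordinate axis, seen through a disk chart. Inside the supporting disk the two
axes are diameters crossing at the center. -/
def xAxis (ψ : Plane → M) : Set M := ψ '' {p | p 1 = 0}

/-- The vertical coordinate axis, seen through a disk chart. -/
def yAxis (ψ : Plane → M) : Set M := ψ '' {p | p 0 = 0}

/-- The diagrams agree, with their crossing information, except along the strand with parameters
in `(c, d)`. -/
def AgreeOff (D D' : Diagram M) (c d : ℝ) : Prop :=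
  (∀ t ∈ I \ Ioo c d, D.γ t = D'.γ t) ∧
  ∀ s ∈ I \ Ioo c d, ∀ t ∈ I \ Ioo c d, s ≠ t → D.γ s = D.γ t → (s ∈ D.upper ↔ s ∈ D'.upper)

/-- First Reidemeister move: in a disk that meets the diagrams in a single strand, a strand
without crossings is replaced by a strand with exactly one self-crossing. -/
def Reidemeister1 (D D' : Diagram M) : Prop :=
  ∃ (ψ : Plane → M) (c d : ℝ), IsDiskChart ψ ∧ 0 < c ∧ c < d ∧ d < 1 ∧
    D.MeetsDisk ψ (Icc c d) (Ioo c d) ∧ D'.MeetsDisk ψ (Icc c d) (Ioo c d) ∧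
    AgreeOff D D' c d ∧
    InjOn D.γ (Icc c d) ∧
    ∃ s t : ℝ, s < t ∧ ∀ x ∈ Icc c d, ∀ y ∈ Icc c d, x < y →
      (D'.γ x = D'.γ y ↔ x = s ∧ y = t)

/-- Second Reidemeister move: the disk meets the diagrams in two strands. One strand is a diameter
in both diagrams. The other one is a simple arc disjoint from it in the first diagram, and in the
second diagram a simple arc crossing it exactly twice, over both times or under both times. -/
def Reidemeister2 (D D' : Diagram M) : Prop :=
  ∃ (ψ : Plane → M) (a b c d : ℝ), IsDiskChart ψ ∧
    0 < a ∧ a < b ∧ b < 1 ∧ 0 < c ∧ c < d ∧ d < 1 ∧ Disjoint (Icc a b) (Icc c d) ∧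
    D.MeetsDisk ψ (Icc a b ∪ Icc c d) (Ioo a b ∪ Ioo c d) ∧
    D'.MeetsDisk ψ (Icc a b ∪ Icc c d) (Ioo a b ∪ Ioo c d) ∧
    AgreeOff D D' c d ∧
    (∀ t ∈ Icc a b, D.γ t ∈ xAxis ψ) ∧
    InjOn D.γ (Icc c d) ∧ InjOn D'.γ (Icc c d) ∧
    (∀ t ∈ Icc c d, D.γ t ∉ xAxis ψ) ∧
    ∃ s₁ ∈ Ioo c d, ∃ s₂ ∈ Ioo c d, s₁ ≠ s₂ ∧
      (∀ t ∈ Icc c d, D'.γ t ∈ xAxis ψ ↔ t = s₁ ∨ t = s₂) ∧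
      (s₁ ∈ D'.upper ↔ s₂ ∈ D'.upper)

/-- Third Reidemeister move: the disk meets the diagrams in three strands. Two of them are the
horizontal and the vertical diameter in both diagrams. The third one is a simple arc that crosses
each diameter exactly once, passing over both or under both; it crosses the horizontal diameter
first in one diagram and the vertical diameter first in the other one, which means that it
is pushed across the crossing of the two diameters. (One of the three strands of a
Reidemeister move of the third kind is always the top one, and one may take it as the moving
strand.) -/
def Reidemeister3 (D D' : Diagram M) : Prop :=
  ∃ (ψ : Plane → M) (a b a' b' c d : ℝ), IsDiskChart ψ ∧
    0 < a ∧ a < b ∧ b < 1 ∧ 0 < a' ∧ a' < b' ∧ b' < 1 ∧ 0 < c ∧ c < d ∧ d < 1 ∧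
    Disjoint (Icc a b) (Icc a' b') ∧ Disjoint (Icc a b) (Icc c d) ∧
    Disjoint (Icc a' b') (Icc c d) ∧
    D.MeetsDisk ψ (Icc a b ∪ Icc a' b' ∪ Icc c d) (Ioo a b ∪ Ioo a' b' ∪ Ioo c d) ∧
    D'.MeetsDisk ψ (Icc a b ∪ Icc a' b' ∪ Icc c d) (Ioo a b ∪ Ioo a' b' ∪ Ioo c d) ∧
    AgreeOff D D' c d ∧
    (∀ t ∈ Icc a b, D.γ t ∈ xAxis ψ) ∧ (∀ t ∈ Icc a' b', D.γ t ∈ yAxis ψ) ∧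
    InjOn D.γ (Icc c d) ∧ InjOn D'.γ (Icc c d) ∧
    ∃ s₁ ∈ Ioo c d, ∃ s₂ ∈ Ioo c d, ∃ s₁' ∈ Ioo c d, ∃ s₂' ∈ Ioo c d,
      s₁ < s₂ ∧ s₂' < s₁' ∧
      (∀ t ∈ Icc c d, (D.γ t ∈ xAxis ψ ↔ t = s₁) ∧ (D.γ t ∈ yAxis ψ ↔ t = s₂)) ∧
      (∀ t ∈ Icc c d, (D'.γ t ∈ xAxis ψ ↔ t = s₁') ∧ (D'.γ t ∈ yAxis ψ ↔ t = s₂')) ∧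
      (s₁ ∈ D.upper ↔ s₂ ∈ D.upper) ∧ (s₁ ∈ D.upper ↔ s₁' ∈ D'.upper) ∧
      (s₁ ∈ D.upper ↔ s₂' ∈ D'.upper)

/-- A single isotopy or Reidemeister move. -/
def Move (D D' : Diagram M) : Prop :=
  Isotopic D D' ∨ Reidemeister1 D D' ∨ Reidemeister2 D D' ∨ Reidemeister3 D D'

variable (M) in
/-- Equivalence of knotoid diagrams: the equivalence relation generated by isotopy and
Reidemeister moves away from the endpoints. -/
def diagramSetoid : Setoid (Diagram M) := Relation.EqvGen.setoid Move

variable (M) in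
/-- A knotoid in the surface `M` is an equivalence class of knotoid diagrams. -/
def Knotoid : Type _ := Quotient (diagramSetoid M)

/-- The knotoid presented by a diagram. -/
def Diagram.knotoid (D : Diagram M) : Knotoid M := Quotient.mk (diagramSetoid M) D

theorem AgreeOff.mirror {D D' : Diagram M} {c d : ℝ} (h : AgreeOff D D' c d) :
    AgreeOff D.mirror D'.mirror c d :=
  ⟨h.1, fun s hs t ht hst hγ => not_congr (h.2 s hs t ht hst hγ)⟩

theorem Move.mirror {D D' : Diagram M} (h : Move D D') : Move D.mirror D'.mirror := by
  rcases h with h | h | h | h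
  · obtain ⟨F, φ, h1, h2, h3, h4, h5, h6, h7, h8⟩ := h
    exact Or.inl ⟨F, φ, h1, h2, h3, h4, h5, h6, h7,
      fun s hs t ht hst hγ => not_congr (h8 s hs t ht hst hγ)⟩
  · obtain ⟨ψ, c, d, h1, h2, h3, h4, h5, h6, h7, h8⟩ := h
    exact Or.inr (Or.inl ⟨ψ, c, d, h1, h2, h3, h4, h5, h6, h7.mirror, h8⟩)
  · obtain ⟨ψ, a, b, c, d, h1, h2, h3, h4, h5, h6, h7, h8, h9, h10, h11, h12, h13, h14, h15,
      s₁, hs₁, s₂, hs₂, k1, k2, k3⟩ := h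
    exact Or.inr (Or.inr (Or.inl ⟨ψ, a, b, c, d, h1, h2, h3, h4, h5, h6, h7, h8, h9, h10,
      h11.mirror, h12, h13, h14, h15, s₁, hs₁, s₂, hs₂, k1, k2, not_congr k3⟩))
  · obtain ⟨ψ, a, b, a', b', c, d, h1, h2, h3, h4, h5, h6, h7, h8, h9, h10, h11, h12, h13, h14,
      h15, h16, h17, h18, h19, h20, s₁, hs₁, s₂, hs₂, s₁', hs₁', s₂', hs₂',
      k1, k2, k3, k4, k5, k6, k7⟩ := h
    exact Or.inr (Or.inr (Or.inr ⟨ψ, a, b, a', b', c, d, h1, h2, h3, h4, h5, h6, h7, h8, h9, h10,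
      h11, h12, h13, h14, h15, h16.mirror, h17, h18, h19, h20, s₁, hs₁, s₂, hs₂, s₁', hs₁',
      s₂', hs₂', k1, k2, k3, k4, not_congr k5, not_congr k6, not_congr k7⟩))

/-- The mirror image of a knotoid. -/
def Knotoid.mirror : Knotoid M → Knotoid M :=
  Quotient.map Diagram.mirror fun D D' h => by
    change Relation.EqvGen Move D D' at h
    change Relation.EqvGen Move D.mirror D'.mirror
    induction h with
    | rel x y h => exact .rel _ _ h.mirror
    | refl x => exact .refl _
    | symm x y _ ih => exact .symm _ _ ih
    | trans x y z _ _ ih ih' => exact .trans _ _ _ ih ih'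

/-- A knotoid is chiral if it differs from its mirror image. -/
def Knotoid.IsChiral (κ : Knotoid M) : Prop := κ ≠ κ.mirror

theorem velocity_comp {γ : ℝ → Plane} {σ : Plane → M} (hγ : ContMDiff 𝓘(ℝ, ℝ) (𝓡 2) ∞ γ)
    (hσ : ContMDiff (𝓡 2) (𝓡 2) ∞ σ) (t : ℝ) :
    velocity (σ ∘ γ) t = mfderiv (𝓡 2) (𝓡 2) σ (γ t) (velocity γ t) := by
  unfold velocity
  rw [mfderiv_comp t (hσ.mdifferentiableAt (by simp)) (hγ.mdifferentiableAt (by simp))]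
  rfl

/-- The image of a planar diagram under an injective smooth immersion of the plane into a
surface. -/
def Diagram.map (D : Diagram Plane) (σ : Plane → M) (hσ : ContMDiff (𝓡 2) (𝓡 2) ∞ σ)
    (inj : Function.Injective σ)
    (imm : ∀ p, Function.Injective (mfderiv (𝓡 2) (𝓡 2) σ p)) : Diagram M where
  γ := σ ∘ D.γ
  upper := D.upper
  smooth := hσ.comp D.smooth
  immersion t ht h := by
    rw [velocity_comp D.smooth hσ t] at h
    exact D.immersion t ht (imm _ (h.trans (map_zero _).symm))
  finite := by simpa [inj.eq_iff] using D.finite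
  endpoints s hs t ht h h' := D.endpoints s hs t ht h (inj h')
  no_triple s hs t ht r hr h h' := D.no_triple s hs t ht r hr (inj h) (inj h')
  transverse s hs t ht h h' := by
    have h0 : D.γ s = D.γ t := inj h'
    rw [velocity_comp D.smooth hσ s, velocity_comp D.smooth hσ t, ← h0]
    refine LinearIndependent.pair_iff.2 fun x y hxy =>
      LinearIndependent.pair_iff.1 (D.transverse s hs t ht h h0) x y (imm (D.γ s) ?_)
    refine Eq.trans ?_ (hxy.trans (map_zero (mfderiv (𝓡 2) (𝓡 2) σ (D.γ s))).symm)
    refine (map_add (mfderiv (𝓡 2) (𝓡 2) σ (D.γ s)) _ _).trans ?_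
    exact congrArg₂ (· + ·) (map_smul (mfderiv (𝓡 2) (𝓡 2) σ (D.γ s)) x (velocity D.γ s))
      (map_smul (mfderiv (𝓡 2) (𝓡 2) σ (D.γ s)) y (velocity D.γ t))
  crossing s hs t ht h h' := D.crossing s hs t ht h (inj h')

end Surface

section Trefoil

/-- Parameter change from `[0, 1]` to `[-2, 2]`. -/
def param (t : ℝ) : ℝ := 4 * t - 2

/-- The plane curve `u ↦ (u³ - 3u, u⁴ - 4u²)`, `-2 ≤ u ≤ 2`, with `u = 4t - 2`: a trefoil
projection opened at its outer arc. The endpoints `(-2, 0)` and `(2, 0)` lie in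
the unbounded region. With `a = (√6 + √2) / 2` and `b = (√6 - √2) / 2` there are three crossings:
`(0, -3)` for `u = ±√3`, `(√2, -1)` for `u = -b, a` and `(-√2, -1)` for `u = -a, b`. -/
def trefoilCurve (t : ℝ) : Plane :=
  !₂[param t ^ 3 - 3 * param t, param t ^ 4 - 4 * param t ^ 2]

def crossA : ℝ := (√6 + √2) / 2

def crossB : ℝ := (√6 - √2) / 2

/-- The over-passing strands of the trefoil diagram. In the order of the curve the crossings are
visited at `u = -a, -√3, -b, b, √3, a`, alternatingly over and under, starting over. All three
crossings are negative. -/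
def trefoilUpper : Set ℝ := {t | param t = -crossA ∨ param t = -crossB ∨ param t = √3}

theorem sqrt_three_sq : √3 ^ 2 = (3 : ℝ) := Real.sq_sqrt (by norm_num)

theorem sqrt_two_sq : √2 ^ 2 = (2 : ℝ) := Real.sq_sqrt (by norm_num)

theorem cross_facts : crossA - crossB = √2 ∧ crossA * crossB = 1 ∧ 0 < crossB ∧
    crossB < √3 ∧ √3 < crossA ∧ crossA < 2 := by
  have h6 : √6 ^ 2 = (6 : ℝ) := Real.sq_sqrt (by norm_num)
  have h2 := sqrt_two_sq
  have h3 := sqrt_three_sq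
  have p6 : 0 ≤ √(6 : ℝ) := Real.sqrt_nonneg _
  have p2 : 0 ≤ √(2 : ℝ) := Real.sqrt_nonneg _
  have p3 : 0 ≤ √(3 : ℝ) := Real.sqrt_nonneg _
  have l6 : 2.44 < √(6 : ℝ) := by nlinarith
  have u6 : √(6 : ℝ) < 2.46 := by nlinarith
  have l2 : 1.41 < √(2 : ℝ) := by nlinarith
  have u2 : √(2 : ℝ) < 1.42 := by nlinarith
  have l3 : 1.73 < √(3 : ℝ) := by nlinarith
  have u3 : √(3 : ℝ) < 1.74 := by nlinarith
  unfold crossA crossB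
  refine ⟨by ring, by nlinarith, ?_, ?_, ?_, ?_⟩ <;> linarith

/-- The pairs of parameters of double points. -/
def IsCrossPair (u v : ℝ) : Prop :=
  (u = √3 ∧ v = -√3) ∨ (u = -√3 ∧ v = √3) ∨ (u = crossA ∧ v = -crossB) ∨
  (u = -crossB ∧ v = crossA) ∨ (u = -crossA ∧ v = crossB) ∨ (u = crossB ∧ v = -crossA)

theorem trefoil_double {u v : ℝ} (h : u ≠ v) (hx : u ^ 3 - 3 * u = v ^ 3 - 3 * v)
    (hy : u ^ 4 - 4 * u ^ 2 = v ^ 4 - 4 * v ^ 2) : IsCrossPair u v := by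
  obtain ⟨hab, hab1, -⟩ := cross_facts
  have h0 : u - v ≠ 0 := sub_ne_zero.2 h
  have e1 : u ^ 2 + u * v + v ^ 2 = 3 := by
    have : (u - v) * (u ^ 2 + u * v + v ^ 2 - 3) = 0 := by linear_combination hx
    rcases mul_eq_zero.1 this with h' | h'
    · exact absurd h' h0
    · linarith
  have e2 : (u + v) * (u ^ 2 + v ^ 2 - 4) = 0 := by
    have : (u - v) * ((u + v) * (u ^ 2 + v ^ 2 - 4)) = 0 := by linear_combination hy
    exact (mul_eq_zero.1 this).resolve_left h0
  rcases mul_eq_zero.1 e2 with e | e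
  · have hv : v = -u := by linarith
    have : (u - √3) * (u + √3) = 0 := by
      subst hv
      have := sqrt_three_sq
      linear_combination e1 - this
    rcases mul_eq_zero.1 this with h' | h'
    · exact Or.inl ⟨by linarith, by linarith⟩
    · exact Or.inr (Or.inl ⟨by linarith, by linarith⟩)
  · have huv : u * v = -1 := by linarith
    have : (u + v - √2) * (u + v + √2) = 0 := by
      have := sqrt_two_sq
      linear_combination e + 2 * huv - this
    rcases mul_eq_zero.1 this with h' | h'
    · have hv : v = √2 - u := by linarith
      have : (u - crossA) * (u + crossB) = 0 := by
        subst hv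
        rw [← hab] at huv
        linear_combination -huv - hab1
      rcases mul_eq_zero.1 this with h' | h'
      · exact Or.inr (Or.inr (Or.inl ⟨by linarith, by linarith⟩))
      · exact Or.inr (Or.inr (Or.inr (Or.inl ⟨by linarith, by linarith⟩)))
    · have hv : v = -√2 - u := by linarith
      have : (u + crossA) * (u - crossB) = 0 := by
        subst hv
        rw [← hab] at huv
        linear_combination -huv - hab1
      rcases mul_eq_zero.1 this with h' | h'
      · exact Or.inr (Or.inr (Or.inr (Or.inr (Or.inl ⟨by linarith, by linarith⟩))))
      · exact Or.inr (Or.inr (Or.inr (Or.inr (Or.inr ⟨by linarith, by linarith⟩))))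

theorem trefoil_det {u v : ℝ} (h : IsCrossPair u v) :
    (3 * u ^ 2 - 3) * (v ^ 3 - 2 * v) - (3 * v ^ 2 - 3) * (u ^ 3 - 2 * u) ≠ 0 := by
  obtain ⟨hab, hab1, h1, h2, h3, -⟩ := cross_facts
  have e3 := sqrt_three_sq
  have e2 : crossA ^ 2 + crossB ^ 2 = 4 := by
    have := sqrt_two_sq
    rw [← hab] at this
    linear_combination this + 2 * hab1
  have key : (3 * crossA ^ 2 - 3) * (crossB ^ 3 - 2 * crossB) +
      (3 * crossB ^ 2 - 3) * (crossA ^ 3 - 2 * crossA) = -6 * (crossA + crossB) := by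
    linear_combination (-3 * (crossA + crossB)) * e2 +
      3 * crossA * crossB * (crossA + crossB) * hab1
  have key3 : (3 * √3 ^ 2 - 3) * (√3 ^ 3 - 2 * √3) = 6 * √3 := by
    have : √3 ^ 3 = 3 * √3 := by rw [pow_succ, e3]
    rw [this, e3]
    ring
  rcases h with h | h | h | h | h | h <;> rw [h.1, h.2] <;> intro h0 <;>
    simp only [neg_sq, Odd.neg_pow (by decide : Odd 3)] at h0 <;> nlinarith

theorem trefoilCurve_double {s t : ℝ} (h : s ≠ t) (h' : trefoilCurve s = trefoilCurve t) :
    IsCrossPair (param s) (param t) := by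
  have hx := congrArg (fun p : Plane => p 0) h'
  have hy := congrArg (fun p : Plane => p 1) h'
  simp only [trefoilCurve, PiLp.toLp_apply, Matrix.cons_val_zero, Matrix.cons_val_one] at hx hy
  exact trefoil_double (fun e => h (by unfold param at e; linarith)) hx hy

theorem hasDerivAt_trefoilCurve (t : ℝ) : HasDerivAt trefoilCurve
    !₂[4 * (3 * param t ^ 2 - 3), 4 * (4 * param t ^ 3 - 8 * param t)] t := by
  have hp : HasDerivAt param 4 t := by
    unfold param
    simpa using ((hasDerivAt_id t).const_mul 4).sub_const 2
  rw [hasDerivAt_iff_hasFDerivAt, ← hasFDerivWithinAt_univ, hasFDerivWithinAt_euclidean]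
  intro i
  fin_cases i
  · have h : HasDerivAt (fun t => param t ^ 3 - 3 * param t) (4 * (3 * param t ^ 2 - 3)) t :=
      ((hp.fun_pow 3).sub (hp.const_mul 3)).congr_deriv (by push_cast; ring)
    exact h.hasFDerivAt.hasFDerivWithinAt.congr_fderiv (by ext; simp)
  · have h : HasDerivAt (fun t => param t ^ 4 - 4 * param t ^ 2)
        (4 * (4 * param t ^ 3 - 8 * param t)) t :=
      ((hp.fun_pow 4).sub ((hp.fun_pow 2).const_mul 4)).congr_deriv (by push_cast; ring)
    exact h.hasFDerivAt.hasFDerivWithinAt.congr_fderiv (by ext; simp)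

theorem velocity_trefoilCurve (t : ℝ) : velocity trefoilCurve t =
    !₂[4 * (3 * param t ^ 2 - 3), 4 * (4 * param t ^ 3 - 8 * param t)] := by
  unfold velocity
  rw [mfderiv_eq_fderiv]
  exact (hasDerivAt_trefoilCurve t).deriv

/-- A diagram of the knot-type knotoid `3_1` in the plane. -/
def trefoilPlane : Diagram Plane where
  γ := trefoilCurve
  upper := trefoilUpper
  smooth := by
    rw [contMDiff_iff_contDiff, contDiff_euclidean]
    intro i
    have hp : ContDiff ℝ ∞ param := by unfold param; fun_prop
    fin_cases i
    · change ContDiff ℝ ∞ fun t => param t ^ 3 - 3 * param t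
      fun_prop
    · change ContDiff ℝ ∞ fun t => param t ^ 4 - 4 * param t ^ 2
      fun_prop
  immersion t _ h := by
    rw [velocity_trefoilCurve] at h
    have hx := congrArg (fun p : Plane => p 0) h
    have hy := congrArg (fun p : Plane => p 1) h
    simp at hx hy
    have h1 : param t ^ 2 = 1 := by linarith
    have h2 : param t * (4 * param t ^ 2 - 8) = 0 := by linear_combination hy
    rw [h1] at h2
    have h3 : param t = 0 := by linarith
    rw [h3] at h1
    norm_num at h1
  finite := by
    have hinj : InjOn param (param ⁻¹' {√3, -√3, crossA, -crossA, crossB, -crossB}) :=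
      fun x _ y _ h => by unfold param at h; linarith
    refine ((Set.toFinite ({√3, -√3, crossA, -crossA, crossB, -crossB} : Set ℝ)).preimage
      hinj).subset ?_
    rintro t ⟨-, s, -, hst, h⟩
    have := trefoilCurve_double hst h
    unfold IsCrossPair at this
    simp only [mem_preimage, mem_insert_iff, mem_singleton_iff]
    tauto
  endpoints s _ t _ h h' := by
    obtain ⟨-, -, h1, h2, h3, h4⟩ := cross_facts
    have h5 : -2 < param s ∧ param s < 2 := by
      rcases trefoilCurve_double h h' with h | h | h | h | h | h <;>
        constructor <;> linarith [h.1]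
    unfold param at h5
    exact ⟨by linarith [h5.1], by linarith [h5.2]⟩
  no_triple s _ t _ r _ h h' := by
    by_contra! hne
    obtain ⟨-, -, h1, h2, h3, h4⟩ := cross_facts
    have k : param t ≠ param r := fun e => hne.2.2 (by unfold param at e; linarith)
    rcases trefoilCurve_double hne.1 h with p | p | p | p | p | p <;>
    rcases trefoilCurve_double hne.2.1 h' with q | q | q | q | q | q <;>
    first
    | exact k (p.2.trans q.2.symm)
    | linarith [p.1, q.1]
  transverse s _ t _ h h' := by
    obtain ⟨ab, ab1, h1, h2, h3, h4⟩ := cross_facts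
    have e3 := sqrt_three_sq
    rw [velocity_trefoilCurve, velocity_trefoilCurve, LinearIndependent.pair_iff]
    intro x y hxy
    have hx := congrArg (fun p : Plane => p 0) hxy
    have hy := congrArg (fun p : Plane => p 1) hxy
    simp at hx hy
    have hdet : (3 * param s ^ 2 - 3) * (param t ^ 3 - 2 * param t) -
        (3 * param t ^ 2 - 3) * (param s ^ 3 - 2 * param s) ≠ 0 :=
      trefoil_det (trefoilCurve_double h h')
    constructor
    · refine (mul_eq_zero.1 (?_ : x * _ = 0)).resolve_right hdet
      linear_combination (1 / 4) * (param t ^ 3 - 2 * param t) * hx -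
        (1 / 16) * (3 * param t ^ 2 - 3) * hy
    · refine (mul_eq_zero.1 (?_ : y * _ = 0)).resolve_right hdet
      linear_combination (1 / 16) * (3 * param s ^ 2 - 3) * hy -
        (1 / 4) * (param s ^ 3 - 2 * param s) * hx
  crossing s _ t _ h h' := by
    obtain ⟨-, -, h1, h2, h3, h4⟩ := cross_facts
    unfold trefoilUpper
    simp only [mem_ofPred_eq]
    rcases trefoilCurve_double h h' with p | p | p | p | p | p <;> rw [p.1, p.2] <;>
    constructor <;> intro k <;> first
    | (rcases k with k | k | k <;> linarith)
    | (rintro (k' | k' | k') <;> rcases k with k | k | k <;> linarith)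
    | (simp; done)
    | (exfalso; apply k; simp)

/-- The inverse of the stereographic projection from the north pole, with values in 3-space. -/
def stereoAux (p : Plane) : EuclideanSpace ℝ (Fin 3) :=
  !₂[2 * p 0 / (p 0 ^ 2 + p 1 ^ 2 + 1), 2 * p 1 / (p 0 ^ 2 + p 1 ^ 2 + 1),
    (p 0 ^ 2 + p 1 ^ 2 - 1) / (p 0 ^ 2 + p 1 ^ 2 + 1)]

theorem stereoAux_mem (p : Plane) : stereoAux p ∈ Metric.sphere (0 : EuclideanSpace ℝ (Fin 3)) 1 := by
  have h : p 0 ^ 2 + p 1 ^ 2 + 1 ≠ 0 := by positivity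
  rw [mem_sphere_zero_iff_norm, EuclideanSpace.norm_eq, Real.sqrt_eq_one, Fin.sum_univ_three]
  simp only [stereoAux, Real.norm_eq_abs, sq_abs, PiLp.toLp_apply, Matrix.cons_val_zero,
    Matrix.cons_val_one, Matrix.cons_val]
  field_simp
  ring

/-- The inverse of the stereographic projection from the north pole, as a map from the plane to
the sphere. -/
def stereo (p : Plane) : Sphere2 := ⟨stereoAux p, stereoAux_mem p⟩

/-- The stereographic projection from the north pole. -/
def stereoProj (q : EuclideanSpace ℝ (Fin 3)) : Plane := !₂[q 0 / (1 - q 2), q 1 / (1 - q 2)]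

theorem one_sub_stereoAux (p : Plane) : 1 - stereoAux p 2 = 2 / (p 0 ^ 2 + p 1 ^ 2 + 1) := by
  have h : p 0 ^ 2 + p 1 ^ 2 + 1 ≠ 0 := by positivity
  simp only [stereoAux, PiLp.toLp_apply, Matrix.cons_val]
  field_simp
  ring

theorem stereoProj_stereoAux (p : Plane) : stereoProj (stereoAux p) = p := by
  have h : p 0 ^ 2 + p 1 ^ 2 + 1 ≠ 0 := by positivity
  ext i
  fin_cases i
  · change stereoAux p 0 / (1 - stereoAux p 2) = p 0
    rw [one_sub_stereoAux]
    simp only [stereoAux, PiLp.toLp_apply, Matrix.cons_val_zero]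
    field_simp
  · change stereoAux p 1 / (1 - stereoAux p 2) = p 1
    rw [one_sub_stereoAux]
    simp only [stereoAux, PiLp.toLp_apply, Matrix.cons_val_one, Matrix.cons_val_zero]
    field_simp

theorem stereo_injective : Function.Injective stereo := fun p q h => by
  have h' : stereoAux p = stereoAux q := congrArg Subtype.val h
  rw [← stereoProj_stereoAux p, h', stereoProj_stereoAux]

theorem contDiff_stereoAux : ContDiff ℝ ∞ stereoAux := by
  have h : ∀ p : Plane, p 0 ^ 2 + p 1 ^ 2 + 1 ≠ 0 := fun p => by positivity
  have h0 : ContDiff ℝ ∞ fun p : Plane => p 0 := by fun_prop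
  have h1 : ContDiff ℝ ∞ fun p : Plane => p 1 := by fun_prop
  have hd : ContDiff ℝ ∞ fun p : Plane => p 0 ^ 2 + p 1 ^ 2 + 1 := by fun_prop
  rw [contDiff_euclidean]
  intro i
  fin_cases i
  · exact (contDiff_const.mul h0).div hd h
  · exact (contDiff_const.mul h1).div hd h
  · exact (((h0.pow 2).add (h1.pow 2)).sub contDiff_const).div hd h

theorem contMDiff_stereo : ContMDiff (𝓡 2) (𝓡 2) ∞ stereo := by
  have : Fact (Module.finrank ℝ (EuclideanSpace ℝ (Fin 3)) = 2 + 1) :=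
    ⟨finrank_euclideanSpace_fin⟩
  exact contDiff_stereoAux.contMDiff.codRestrict_sphere stereoAux_mem

theorem fderiv_stereoAux_injective (p : Plane) : Function.Injective (fderiv ℝ stereoAux p) := by
  have h : 1 - stereoAux p 2 ≠ 0 := by
    rw [one_sub_stereoAux]
    positivity
  have hproj : DifferentiableAt ℝ stereoProj (stereoAux p) := by
    rw [differentiableAt_euclidean]
    intro i
    have k : ∀ i, DifferentiableAt ℝ (fun q : EuclideanSpace ℝ (Fin 3) => q i) (stereoAux p) :=
      fun i => by fun_prop
    have hk : DifferentiableAt ℝ (fun q : EuclideanSpace ℝ (Fin 3) => 1 - q 2) (stereoAux p) :=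
      (differentiableAt_const 1).fun_sub (k 2)
    fin_cases i
    · exact (k 0).fun_mul (hk.fun_inv h)
    · exact (k 1).fun_mul (hk.fun_inv h)
  have hs : DifferentiableAt ℝ stereoAux p := contDiff_stereoAux.differentiable (by simp) p
  have hc : stereoProj ∘ stereoAux = id := funext stereoProj_stereoAux
  have key := fderiv_comp p hproj hs
  rw [hc, fderiv_id] at key
  intro v w hvw
  have hv := congrArg (fun L : Plane →L[ℝ] Plane => L v) key
  have hw := congrArg (fun L : Plane →L[ℝ] Plane => L w) key
  simp only [ContinuousLinearMap.comp_apply, ContinuousLinearMap.id_apply] at hv hw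
  rw [hv, hw, hvw]

theorem mfderiv_stereo_injective (p : Plane) :
    Function.Injective (mfderiv (𝓡 2) (𝓡 2) stereo p) := by
  have : Fact (Module.finrank ℝ (EuclideanSpace ℝ (Fin 3)) = 2 + 1) :=
    ⟨finrank_euclideanSpace_fin⟩
  have hc : (Subtype.val : Sphere2 → EuclideanSpace ℝ (Fin 3)) ∘ stereo = stereoAux := rfl
  have key := mfderiv_comp (I' := 𝓡 2) (I'' := 𝓘(ℝ, EuclideanSpace ℝ (Fin 3)))
    (g := (Subtype.val : Sphere2 → EuclideanSpace ℝ (Fin 3))) p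
    ((contMDiff_coe_sphere (m := ∞)).mdifferentiableAt (by simp))
    (contMDiff_stereo.mdifferentiableAt (by simp))
  rw [hc, mfderiv_eq_fderiv] at key
  have hinj := fderiv_stereoAux_injective p
  intro v w hvw
  apply hinj
  rw [key]
  change mfderiv _ _ _ _ (mfderiv _ _ _ _ v) = mfderiv _ _ _ _ (mfderiv _ _ _ _ w)
  rw [hvw]

/-- The diagram of the knot-type knotoid `3_1` in the sphere. -/
def trefoilSphere : Diagram Sphere2 :=
  trefoilPlane.map stereo contMDiff_stereo stereo_injective mfderiv_stereo_injective

end Trefoil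

end Knotoids

end

noncomputable section

namespace Knotoids

section

open Filter Topology
open scoped Quandles

/-! ### Quandle colorings of an abstract crossing relation on the parameter line. -/

section Coloring

variable {Q : Type*} [Quandle Q]

/-! A quandle coloring assigns a color to every arc of a diagram. At an undercrossing the color
changes by the action of the color of the over-strand, or by the inverse action, according to the
sign of the crossing. Reidemeister moves take place away from the endpoints and can be compensated
by recoloring inside their disk. Hence the set of pairs (initial color, final color) is a knotoid
invariant (`hasColoring_iff_of_knotoid_eq`), and it suffices that this set differs for the trefoil
and its mirror image.

The quandle comes from a Heisenberg group ℤ² × ℤ and an automorphism of order six that fixes the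
center and acts on ℤ² with characteristic polynomial t² - t + 1, the Alexander polynomial of the
trefoil. Modulo the center, both the trefoil and its mirror image have a coloring starting at 0 for
every (a, b) in ℤ², and it returns to 0 at the end. The central coordinate, however, ends at 2N or
at -2N with N = a² + ab + b², depending only on the common sign of the crossings. Since N ≥ 0 and
N(1, 0) = 1, the trefoil reaches 2 or -2 according to its sign (`Heisenberg.exists_trefoil`), and
its mirror image does not reach the same value (`Heisenberg.not_mirror_trefoil`).

A coloring is a function on the real line that is constant just before each parameter of (0, 1], so
its value at an undercrossing is the incoming color and `Step` describes the outgoing one. A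
Reidemeister move concerns at most three strands, each with at most two color changes; along them
the coloring is replaced by step functions (`IsColoring.of_recoloring`), and what remains is a
finite system of quandle equations (`AgreeOutside.hasColoring_kink`,
`AgreeOutside.hasColoring_bigon`, `TriangleEqs.move`). The signs in this system follow from
determinants of velocities in the disk chart (`IsAxisStrand.sgn_eq`).

Plane and sphere are treated together, as surfaces immersed in 3-space with a transverse vector
field. The trefoil is shown to be chiral for every injective immersion of the plane into such a
surface (`trefoil_isChiral`). -/

/-- The action of `y` on `x`, or its inverse, according to a sign. -/
def act (b : Bool) (y x : Q) : Q := cond b (y ◃ x) (y ◃⁻¹ x)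

theorem act_self (b : Bool) (x : Q) : act b x x = x := by
  cases b
  · exact Quandle.fix_inv
  · exact Quandle.fix

theorem act_not_act (b : Bool) (y x : Q) : act (!b) y (act b y x) = x := by
  cases b
  · exact Rack.right_inv y x
  · exact Rack.left_inv y x

theorem act_act_not (b : Bool) (y x : Q) : act b y (act (!b) y x) = x := by
  simpa using act_not_act (!b) y x

theorem act_true_false (y x : Q) : act true y (act false y x) = x := act_act_not true y x

theorem act_false_true (y x : Q) : act false y (act true y x) = x := act_act_not false y x

theorem act_injective (b : Bool) (y : Q) : Function.Injective (act b y) :=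
  Function.LeftInverse.injective (act_not_act b y)

/-- Acting by `x` is an automorphism of the quandle, and so is its inverse; automorphisms respect
both actions. All four combinations of signs are needed for the third Reidemeister move. -/
theorem act_distrib (b b' : Bool) (x y w : Q) :
    act b x (act b' y w) = act b' (act b x y) (act b x w) := by
  have key : ∀ w, act b x (act true y w) = act true (act b x y) (act b x w) := by
    intro w
    cases b
    · apply act_injective true x
      rw [act_true_false]
      have h : act true x (act true (act false x y) (act false x w)) =
        act true (act true x (act false x y)) (act true x (act false x w)) := Shelf.self_distrib
      rw [h, act_true_false, act_true_false]
    · exact Shelf.self_distrib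
  cases b'
  · apply act_injective true (act b x y)
    rw [act_true_false, ← key, act_true_false]
  · exact key w

/-- In the crossing relation `X`, the parameter `t` does not belong to an under-passing strand. -/
def Free (X : ℝ → ℝ → Bool → Prop) (t : ℝ) : Prop := ∀ s b, ¬ X t s b

/-- The color `q` may follow the color `f t` at the parameter `t`. Here `X t s b` says that at `t`
the curve passes under the strand with parameter `s` at a crossing of sign `b`. -/
def Step (X : ℝ → ℝ → Bool → Prop) (f : ℝ → Q) (t : ℝ) (q : Q) : Prop :=
  (∀ s b, X t s b → q = act b (f s) (f t)) ∧ (Free X t → q = f t)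

/-- Quandle colorings of the arcs of a diagram with crossing relation `X`. -/
structure IsColoring (X : ℝ → ℝ → Bool → Prop) (f : ℝ → Q) : Prop where
  left : ∀ t ∈ Ioc (0 : ℝ) 1, ∀ᶠ x in 𝓝[<] t, f x = f t
  right : ∀ t ∈ Ico (0 : ℝ) 1, ∀ᶠ x in 𝓝[>] t, Step X f t (f x)

/-- Some coloring has color `x` at the start and color `y` at the end. -/
def HasColoring (X : ℝ → ℝ → Bool → Prop) (x y : Q) : Prop :=
  ∃ f : ℝ → Q, IsColoring X f ∧ f 0 = x ∧ f 1 = y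

theorem step_iff_of_free {X : ℝ → ℝ → Bool → Prop} {f : ℝ → Q} {t : ℝ} {q : Q} (h : Free X t) :
    Step X f t q ↔ q = f t :=
  ⟨fun k => k.2 h, fun k => ⟨fun s b hs => (h s b hs).elim, fun _ => k⟩⟩

theorem step_iff_of_unique {X : ℝ → ℝ → Bool → Prop} {f : ℝ → Q} {t s : ℝ} {b : Bool} {q : Q}
    (h : X t s b) (huniq : ∀ s' b', X t s' b' → s' = s ∧ b' = b) :
    Step X f t q ↔ q = act b (f s) (f t) := by
  refine ⟨fun k => k.1 s b h, fun k => ⟨fun s' b' h' => ?_, fun k' => (k' s b h).elim⟩⟩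
  obtain ⟨rfl, rfl⟩ := huniq s' b' h'
  exact k

/-- For the discrete topology on `Q` the coloring is continuous on an interval without
undercrossings, hence constant there. The value at `q` is included even if `q` is an undercrossing,
because colors are constant from the left. -/
theorem IsColoring.eq_of_free {X : ℝ → ℝ → Bool → Prop} {f : ℝ → Q} (hf : IsColoring X f)
    {p q : ℝ} (hp : 0 ≤ p) (hq : q ≤ 1) (h : ∀ t ∈ Ioo p q, Free X t) {x : ℝ} (hx : x ∈ Ioc p q) :
    f x = f q := by
  rcases hx.2.eq_or_lt with rfl | hxq
  · rfl
  let : TopologicalSpace Q := ⊥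
  have : DiscreteTopology Q := ⟨rfl⟩
  have hc : ContinuousOn f (Ioo p q) := by
    intro t ht
    refine ContinuousAt.continuousWithinAt ?_
    rw [ContinuousAt, nhds_discrete Q, tendsto_pure, ← nhdsLT_sup_nhdsGE, eventually_sup]
    refine ⟨hf.left t ⟨by linarith [ht.1], by linarith [ht.2]⟩, ?_⟩
    rw [← Ioi_insert, nhdsWithin_insert, eventually_sup]
    refine ⟨by simp, ?_⟩
    filter_upwards [hf.right t ⟨by linarith [ht.1], by linarith [ht.2]⟩] with y hy
    exact hy.2 (h t ht)
  obtain ⟨y, hy, hy'⟩ := ((hf.left q ⟨by linarith [hx.1], hq⟩).and (Ioo_mem_nhdsLT hxq)).exists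
  rw [← hy]
  exact isPreconnected_Ioo.constant hc ⟨hx.1, hxq⟩ ⟨hx.1.trans hy'.1, hy'.2⟩

theorem IsColoring.step {X : ℝ → ℝ → Bool → Prop} {f : ℝ → Q} (hf : IsColoring X f)
    {p q : ℝ} (hp : 0 ≤ p) (hpq : p < q) (hq : q ≤ 1) (h : ∀ t ∈ Ioo p q, Free X t) :
    Step X f p (f q) := by
  obtain ⟨y, hy, hy'⟩ :=
    ((hf.right p ⟨hp, hpq.trans_le hq⟩).and (Ioo_mem_nhdsGT hpq)).exists
  rwa [hf.eq_of_free hp hq h ⟨hy'.1, hy'.2.le⟩] at hy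

/-! ### Strands with two marked parameters, and recoloring along them. -/

/-- A parameter interval `[c, d]` with two marked interior parameters. -/
structure Strand where
  c : ℝ
  p : ℝ
  q : ℝ
  d : ℝ
  c_pos : 0 < c
  hcp : c < p
  hpq : p < q
  hqd : q < d
  d_lt : d < 1

namespace Strand

/-- The parameter interval of a strand. -/
def set (S : Strand) : Set ℝ := Icc S.c S.d

theorem d_mem (S : Strand) : S.d ∈ S.set :=
  ⟨by linarith [S.hcp, S.hpq, S.hqd], le_rfl⟩

/-- Undercrossings on the strand occur only at the two marked parameters. -/
def Marks (S : Strand) (X : ℝ → ℝ → Bool → Prop) : Prop :=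
  ∀ t ∈ S.set, ¬ Free X t → t = S.p ∨ t = S.q

theorem Marks.free {S : Strand} {X : ℝ → ℝ → Bool → Prop} (h : S.Marks X) {t : ℝ}
    (ht : t ∈ S.set) (hp : t ≠ S.p) (hq : t ≠ S.q) : Free X t := by
  by_contra k
  exact (h t ht k).elim hp hq

/-- The colors on a strand are determined by the color at the start, between the marked parameters
and at the end. -/
theorem Marks.read {S : Strand} {X : ℝ → ℝ → Bool → Prop} (h : S.Marks X) {f : ℝ → Q}
    (hf : IsColoring X f) :
    f S.p = f S.c ∧ Step X f S.p (f S.q) ∧ Step X f S.q (f S.d) := by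
  have h1 := S.c_pos
  have h2 := S.hcp
  have h3 := S.hpq
  have h4 := S.hqd
  have h5 := S.d_lt
  have fr : ∀ t ∈ S.set, t ≠ S.p → t ≠ S.q → Free X t := fun t ht hp hq => h.free ht hp hq
  refine ⟨?_, hf.step (by linarith) h3 (by linarith) fun t ht =>
    fr t ⟨by linarith [ht.1], by linarith [ht.2]⟩ ht.1.ne' ht.2.ne,
    hf.step (by linarith) h4 (by linarith) fun t ht =>
    fr t ⟨by linarith [ht.1], by linarith [ht.2]⟩ (h3.trans ht.1).ne' ht.1.ne'⟩
  refine (step_iff_of_free (fr _ ⟨le_rfl, by linarith⟩ h2.ne (by linarith))).1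
    (hf.step h1.le h2 (by linarith) fun t ht =>
    fr t ⟨by linarith [ht.1], by linarith [ht.2]⟩ ht.2.ne (ht.2.trans h3).ne)

/-- The step function on a strand with given values. -/
def stepFun {Q : Type*} (S : Strand) (x m y : Q) (t : ℝ) : Q :=
  if t ≤ S.p then x else if t ≤ S.q then m else y

end Strand

/-- Replace a coloring along a family of strands by step functions. -/
theorem exists_recoloring {Q ι : Type*} (S : ι → Strand)
    (disj : Pairwise fun i j => Disjoint (S i).set (S j).set) (f : ℝ → Q) (m : ι → Q) :
    ∃ f' : ℝ → Q, (∀ t, (∀ i, t ∉ (S i).set) → f' t = f t) ∧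
      ∀ i, ∀ t ∈ (S i).set, f' t = (S i).stepFun (f (S i).c) (m i) (f (S i).d) t := by
  classical
  refine ⟨fun t => if h : ∃ i, t ∈ (S i).set then
    (S h.choose).stepFun (f (S h.choose).c) (m h.choose) (f (S h.choose).d) t else f t,
    fun t ht => dif_neg (by simpa using ht), fun i t ht => ?_⟩
  have h : ∃ i, t ∈ (S i).set := ⟨i, ht⟩
  have hi : h.choose = i := by
    by_contra k
    exact (disj k).le_bot ⟨h.choose_spec, ht⟩
  simp only [dif_pos h, hi]

/-- Gluing: away from the closed strands `f'` agrees locally with the coloring `f`, and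
undercrossings there have their over-strand outside as well, so their equations are untouched. On a
strand only the equations at the two marked parameters have to be checked. -/
theorem IsColoring.of_recoloring {ι : Type*} [Finite ι] {X X' : ℝ → ℝ → Bool → Prop} {f f' : ℝ → Q}
    (hf : IsColoring X f) {S : ι → Strand}
    (disj : Pairwise fun i j => Disjoint (S i).set (S j).set)
    (out : ∀ t, (∀ i, t ∉ (S i).set) → ∀ s b, X' t s b → X t s b ∧ ∀ i, s ∉ (S i).set)
    (out' : ∀ t, (∀ i, t ∉ (S i).set) → Free X' t → Free X t)
    (hX : ∀ i, Free X (S i).d) (hX' : ∀ i, (S i).Marks X') {m : ι → Q}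
    (h1 : ∀ t, (∀ i, t ∉ (S i).set) → f' t = f t)
    (h2 : ∀ i, ∀ t ∈ (S i).set, f' t = (S i).stepFun (f (S i).c) (m i) (f (S i).d) t)
    (h3 : ∀ i, Step X' f' (S i).p (m i) ∧ Step X' f' (S i).q (f (S i).d)) :
    IsColoring X' f' := by
  have closed : ∀ i, IsClosed (S i).set := fun i => isClosed_Icc
  have near : ∀ t, (∀ i, t ∉ (S i).set) → ∀ᶠ x in 𝓝 t, ∀ i, x ∉ (S i).set := by
    intro t ht
    rw [eventually_all]
    exact fun i => (closed i).isOpen_compl.mem_nhds (ht i)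
  have near' : ∀ i, ∀ t ∈ (S i).set, ∀ᶠ x in 𝓝 t, ∀ j, j ≠ i → x ∉ (S j).set := by
    intro i t ht
    rw [eventually_all]
    intro j
    by_cases hj : j = i
    · simp [hj]
    · filter_upwards [(closed j).isOpen_compl.mem_nhds
        fun k => (disj hj).le_bot ⟨k, ht⟩] with x hx _ using hx
  have v1 : ∀ i, ∀ t, (S i).c ≤ t → t ≤ (S i).p → f' t = f (S i).c := fun i t k k' => by
    rw [h2 i t ⟨k, by linarith [(S i).hpq, (S i).hqd]⟩, Strand.stepFun, if_pos k']
  have v2 : ∀ i, ∀ t, (S i).p < t → t ≤ (S i).q → f' t = m i := fun i t k k' => by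
    rw [h2 i t ⟨by linarith [(S i).hcp], by linarith [(S i).hqd]⟩, Strand.stepFun,
      if_neg (by linarith), if_pos k']
  have v3 : ∀ i, ∀ t, (S i).q < t → t ≤ (S i).d → f' t = f (S i).d := fun i t k k' => by
    rw [h2 i t ⟨by linarith [(S i).hcp, (S i).hpq], k'⟩, Strand.stepFun,
      if_neg (by linarith [(S i).hpq]), if_neg (by linarith)]
  constructor
  · intro t ht
    by_cases hK : ∀ i, t ∉ (S i).set
    · filter_upwards [hf.left t ht, (near t hK).filter_mono nhdsWithin_le_nhds] with x hx hxK
      rw [h1 x hxK, h1 t hK, hx]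
    · push Not at hK
      obtain ⟨i, hi⟩ := hK
      rcases hi.1.eq_or_lt with e | e
      · filter_upwards [hf.left t ht, (near' i t hi).filter_mono nhdsWithin_le_nhds,
          self_mem_nhdsWithin] with x hx hxK hxt
        rw [h1 x, v1 i t hi.1 (by linarith [(S i).hcp]), hx, e]
        intro j hj
        by_cases hji : j = i
        · subst hji
          have : x < t := hxt
          linarith [hj.1]
        · exact hxK j hji hj
      · rcases le_or_gt t (S i).p with k | k
        · filter_upwards [Ioo_mem_nhdsLT e] with x hx
          rw [v1 i x hx.1.le (by linarith [hx.2]), v1 i t e.le k]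
        · rcases le_or_gt t (S i).q with k' | k'
          · filter_upwards [Ioo_mem_nhdsLT k] with x hx
            rw [v2 i x hx.1 (by linarith [hx.2]), v2 i t k k']
          · filter_upwards [Ioo_mem_nhdsLT k'] with x hx
            rw [v3 i x hx.1 (by linarith [hx.2, hi.2]), v3 i t k' hi.2]
  · intro t ht
    by_cases hK : ∀ i, t ∉ (S i).set
    · filter_upwards [hf.right t ht, (near t hK).filter_mono nhdsWithin_le_nhds] with x hx hxK
      rw [h1 x hxK]
      refine ⟨fun s b hs => ?_, fun hfree => ?_⟩
      · obtain ⟨k, k'⟩ := out t hK s b hs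
        rw [h1 t hK, h1 s k', hx.1 s b k]
      · rw [h1 t hK, hx.2 (out' t hK hfree)]
    · push Not at hK
      obtain ⟨i, hi⟩ := hK
      have fr : t ≠ (S i).p → t ≠ (S i).q → Free X' t := fun k k' => (hX' i).free hi k k'
      rcases lt_trichotomy t (S i).p with k | k | k
      · filter_upwards [Ioo_mem_nhdsGT k] with x hx
        rw [step_iff_of_free (fr k.ne (k.trans (S i).hpq).ne),
          v1 i x (by linarith [hx.1, hi.1]) hx.2.le, v1 i t hi.1 k.le]
      · filter_upwards [Ioo_mem_nhdsGT (k.trans_lt (S i).hpq)] with x hx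
        rw [v2 i x (k ▸ hx.1) hx.2.le, k]
        exact (h3 i).1
      · rcases lt_trichotomy t (S i).q with k' | k' | k'
        · filter_upwards [Ioo_mem_nhdsGT k'] with x hx
          rw [step_iff_of_free (fr k.ne' k'.ne), v2 i x (k.trans hx.1) hx.2.le, v2 i t k k'.le]
        · filter_upwards [Ioo_mem_nhdsGT (k'.trans_lt (S i).hqd)] with x hx
          rw [v3 i x (k' ▸ hx.1) hx.2.le, k']
          exact (h3 i).2
        -- At the end of a strand the old coloring takes over again; it does not jump there because
        -- the end is free for `X`.
        · rcases hi.2.eq_or_lt with e | e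
          · filter_upwards [hf.right t ht, (near' i t hi).filter_mono nhdsWithin_le_nhds,
              self_mem_nhdsWithin] with x hx hxK hxt
            rw [step_iff_of_free (fr k.ne' k'.ne'), v3 i t k' hi.2, h1 x, hx.2 (e ▸ hX i), e]
            intro j hj
            by_cases hji : j = i
            · subst hji
              have : t < x := hxt
              linarith [hj.2]
            · exact hxK j hji hj
          · filter_upwards [Ioo_mem_nhdsGT e] with x hx
            rw [step_iff_of_free (fr k.ne' k'.ne'), v3 i x (k'.trans hx.1) hx.2.le,
              v3 i t k' e.le]

/-- Colorings are transported by increasing reparametrizations. -/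
theorem IsColoring.comp_orderIso {X X' : ℝ → ℝ → Bool → Prop} {f : ℝ → Q} (hf : IsColoring X f)
    (e : ℝ ≃o ℝ) (h0 : e 0 = 0) (h1 : e 1 = 1) (h : ∀ t s b, X' t s b ↔ X (e t) (e s) b) :
    IsColoring X' (f ∘ e) := by
  have hc : Continuous e := e.continuous
  constructor
  · intro t ht
    have ht' : e t ∈ Ioc (0 : ℝ) 1 := ⟨h0 ▸ e.lt_iff_lt.2 ht.1, h1 ▸ e.le_iff_le.2 ht.2⟩
    have : Tendsto e (𝓝[<] t) (𝓝[<] (e t)) :=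
      tendsto_nhdsWithin_of_tendsto_nhds_of_eventually_within _
        (hc.tendsto t |>.mono_left nhdsWithin_le_nhds)
        (eventually_mem_nhdsWithin.mono fun x hx => e.lt_iff_lt.2 hx)
    exact this.eventually (hf.left _ ht')
  · intro t ht
    have ht' : e t ∈ Ico (0 : ℝ) 1 := ⟨h0 ▸ e.le_iff_le.2 ht.1, h1 ▸ e.lt_iff_lt.2 ht.2⟩
    have : Tendsto e (𝓝[>] t) (𝓝[>] (e t)) :=
      tendsto_nhdsWithin_of_tendsto_nhds_of_eventually_within _
        (hc.tendsto t |>.mono_left nhdsWithin_le_nhds)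
        (eventually_mem_nhdsWithin.mono fun x hx => e.lt_iff_lt.2 hx)
    filter_upwards [this.eventually (hf.right _ ht')] with x hx
    refine ⟨fun s b hs => hx.1 _ _ ((h _ _ _).1 hs), fun hfree => hx.2 fun s b hs => ?_⟩
    exact hfree (e.symm s) b ((h _ _ _).2 (by simpa using hs))

theorem HasColoring.comp_orderIso {X X' : ℝ → ℝ → Bool → Prop} (e : ℝ ≃o ℝ) (h0 : e 0 = 0)
    (h1 : e 1 = 1) (h : ∀ t s b, X' t s b ↔ X (e t) (e s) b) {x y : Q} :
    HasColoring X x y ↔ HasColoring X' x y := by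
  constructor
  · rintro ⟨f, hf, rfl, rfl⟩
    exact ⟨f ∘ e, hf.comp_orderIso e h0 h1 h, by simp [h0], by simp [h1]⟩
  · rintro ⟨f, hf, rfl, rfl⟩
    have k0 : e.symm 0 = 0 := by rw [e.symm_apply_eq, h0]
    have k1 : e.symm 1 = 1 := by rw [e.symm_apply_eq, h1]
    exact ⟨f ∘ e.symm, hf.comp_orderIso e.symm k0 k1 fun t s b => by simp [h],
      by simp [k0], by simp [k1]⟩

end Coloring

end

section

open Filter Topology

/-! ### Curves seen in a disk chart. -/

section Chart

variable {M : Type*} [TopologicalSpace M] [ChartedSpace Plane M]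

namespace IsDiskChart

variable {ψ : Plane → M}

theorem contMDiff (h : IsDiskChart ψ) : ContMDiff (𝓡 2) (𝓡 2) ∞ ψ := h.1.contMDiff

theorem mfderiv_injective (h : IsDiskChart ψ) (p : Plane) :
    Function.Injective (mfderiv (𝓡 2) (𝓡 2) ψ p) := by
  rw [← (h.1 p).mfderivToContinuousLinearEquiv_coe (by simp)]
  exact ((h.1 p).mfderivToContinuousLinearEquiv (by simp)).injective

end IsDiskChart

/-- A curve seen through a disk chart; meaningful where it runs in the image of the chart. -/
def chartCurve {M : Type*} (ψ : Plane → M) (γ : ℝ → M) (t : ℝ) : Plane := Function.invFun ψ (γ t)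

section chartCurve

variable {ψ : Plane → M} {γ : ℝ → M} {t : ℝ}

theorem chart_chartCurve {M : Type*} {ψ : Plane → M} {γ : ℝ → M} {t : ℝ} (ht : γ t ∈ range ψ) :
    ψ (chartCurve ψ γ t) = γ t :=
  Function.invFun_eq ht

theorem chartCurve_eq_iff (h : IsDiskChart ψ) (ht : γ t ∈ range ψ) {p : Plane} :
    chartCurve ψ γ t = p ↔ γ t = ψ p := by
  rw [← h.2.eq_iff, chart_chartCurve ht]

theorem eventually_chart_chartCurve (h : IsDiskChart ψ) (hγ : Continuous γ) (ht : γ t ∈ range ψ) :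
    γ =ᶠ[𝓝 t] ψ ∘ chartCurve ψ γ := by
  filter_upwards [(h.1.isOpen_range.preimage hγ).mem_nhds ht] with x hx
  exact (chart_chartCurve hx).symm

/-- The set-theoretic inverse of `ψ` agrees near `γ t` with the smooth local inverse, because `ψ` is
injective. -/
theorem contDiffAt_chartCurve (h : IsDiskChart ψ) (hγ : ContMDiff 𝓘(ℝ, ℝ) (𝓡 2) ∞ γ)
    (ht : γ t ∈ range ψ) : ContDiffAt ℝ ∞ (chartCurve ψ γ) t := by
  obtain ⟨p, hp⟩ := ht
  obtain ⟨Φ, hΦ, hΦ'⟩ := h.1 p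
  have ht : γ t ∈ Φ.target := by
    rw [← hp, hΦ' hΦ]
    exact Φ.map_source' hΦ
  have hev : chartCurve ψ γ =ᶠ[𝓝 t] Φ.invFun ∘ γ := by
    filter_upwards [(Φ.open_target.preimage hγ.continuous).mem_nhds ht] with x hx
    have e : γ x = ψ (Φ.invFun (γ x)) := by
      rw [hΦ' (Φ.map_target' hx)]
      exact (Φ.right_inv' hx).symm
    exact (chartCurve_eq_iff h ⟨_, e.symm⟩).2 e
  have := (Φ.contMDiffOn_invFun.contMDiffAt (Φ.open_target.mem_nhds ht)).comp t hγ.contMDiffAt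
  exact this.contDiffAt.congr_of_eventuallyEq hev

end chartCurve

end Chart

/-! ### Orientation by triple products, and the form whose sign is the sign of a crossing. -/

/-- Euclidean 3-space. -/
abbrev Space3 : Type := EuclideanSpace ℝ (Fin 3)

/-- The triple product in 3-space. -/
def det3 (u v w : Space3) : ℝ :=
  u 0 * (v 1 * w 2 - v 2 * w 1) - u 1 * (v 0 * w 2 - v 2 * w 0) + u 2 * (v 0 * w 1 - v 1 * w 0)

/-- The determinant of two plane vectors. -/
def det2 (v w : Plane) : ℝ := v 0 * w 1 - v 1 * w 0

theorem det3_swap (u v w : Space3) : det3 u w v = -det3 u v w := by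
  unfold det3; ring

theorem det3_smul_smul (u v w : Space3) (a b : ℝ) :
    det3 u (a • v) (b • w) = a * b * det3 u v w := by
  simp only [det3, PiLp.smul_apply, smul_eq_mul]; ring

theorem continuous_det3 {X : Type*} [TopologicalSpace X] {u v w : X → Space3} (hu : Continuous u)
    (hv : Continuous v) (hw : Continuous w) : Continuous fun x => det3 (u x) (v x) (w x) := by
  unfold det3
  fun_prop

theorem plane_eq (v : Plane) :
    v = v 0 • EuclideanSpace.single 0 1 + v 1 • EuclideanSpace.single 1 1 := by
  ext i
  fin_cases i <;> simp

theorem det3_map (u : Space3) (L : Plane →L[ℝ] Space3) (v w : Plane) :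
    det3 u (L v) (L w) = det2 v w *
      det3 u (L (EuclideanSpace.single 0 1)) (L (EuclideanSpace.single 1 1)) := by
  rw [plane_eq v, plane_eq w]
  simp only [map_add, map_smul]
  simp [det3, det2]
  ring

/-- A surface with an immersion into 3-space and a continuous transverse vector field along it. -/
class OrientedSurface (M : Type*) [TopologicalSpace M] [ChartedSpace Plane M] where
  emb : M → Space3
  normal : M → Space3
  contMDiff_emb : ContMDiff (𝓡 2) 𝓘(ℝ, Space3) ∞ emb
  continuous_normal : Continuous normal
  det_ne_zero : ∀ (p : M) (v w : Plane), LinearIndependent ℝ ![v, w] →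
    det3 (normal p) (mfderiv (𝓡 2) 𝓘(ℝ, Space3) emb p v) (mfderiv (𝓡 2) 𝓘(ℝ, Space3) emb p w) ≠ 0

open OrientedSurface

variable {M : Type*} [TopologicalSpace M] [ChartedSpace Plane M] [OrientedSurface M]

/-- The position, relative to the orientation, of the velocities of a curve at two parameters of a
double point. -/
def crossForm (γ : ℝ → M) (s t : ℝ) : ℝ :=
  det3 (normal (γ s)) (deriv (emb ∘ γ) s) (deriv (emb ∘ γ) t)

theorem crossForm_swap {γ : ℝ → M} {s t : ℝ} (h : γ s = γ t) :
    crossForm γ t s = -crossForm γ s t := by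
  rw [crossForm, crossForm, h, det3_swap]

theorem crossForm_congr {γ γ' : ℝ → M} {s t : ℝ} (hs : γ =ᶠ[𝓝 s] γ') (ht : γ =ᶠ[𝓝 t] γ') :
    crossForm γ s t = crossForm γ' s t := by
  have h : ∀ {u}, γ =ᶠ[𝓝 u] γ' → deriv (emb ∘ γ) u = deriv (emb ∘ γ') u := fun hu =>
    Filter.EventuallyEq.deriv_eq (hu.fun_comp emb)
  rw [crossForm, crossForm, h hs, h ht, hs.eq_of_nhds]

theorem deriv_emb_comp {γ : ℝ → M} (hγ : ContMDiff 𝓘(ℝ, ℝ) (𝓡 2) ∞ γ) (t : ℝ) :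
    deriv (emb ∘ γ) t = mfderiv (𝓡 2) 𝓘(ℝ, Space3) emb (γ t) (velocity γ t) := by
  have h := mfderiv_comp (I'' := 𝓘(ℝ, Space3)) t
    (contMDiff_emb.mdifferentiableAt (by simp) (x := γ t))
    (hγ.mdifferentiableAt (by simp))
  rw [mfderiv_eq_fderiv] at h
  rw [← fderiv_apply_one_eq_deriv, h]
  rfl

theorem crossForm_ne_zero (D : Diagram M) {s t : ℝ} (hs : s ∈ I) (ht : t ∈ I) (hst : s ≠ t)
    (h : D.γ s = D.γ t) : crossForm D.γ s t ≠ 0 := by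
  have := det_ne_zero (D.γ s) _ _ (D.transverse s hs t ht hst h)
  rw [crossForm, deriv_emb_comp D.smooth, deriv_emb_comp D.smooth, ← h]
  exact this

/-- The orientation of a map from the plane to a surface. -/
def orientation (σ : Plane → M) (p : Plane) : ℝ :=
  det3 (normal (σ p)) (fderiv ℝ (emb ∘ σ) p (EuclideanSpace.single 0 1))
    (fderiv ℝ (emb ∘ σ) p (EuclideanSpace.single 1 1))

theorem contDiff_emb_comp {σ : Plane → M} (hσ : ContMDiff (𝓡 2) (𝓡 2) ∞ σ) :
    ContDiff ℝ ∞ (emb ∘ σ) :=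
  (contMDiff_emb.comp hσ).contDiff

theorem linearIndependent_map {E : Type*} [NormedAddCommGroup E] [NormedSpace ℝ E]
    {L : Plane →L[ℝ] E} (hL : Function.Injective L) {v w : Plane}
    (h : LinearIndependent ℝ ![v, w]) : LinearIndependent ℝ ![L v, L w] := by
  rw [LinearIndependent.pair_iff] at h ⊢
  exact fun x y hxy => h x y (hL (by simpa using hxy))

theorem linearIndependent_single :
    LinearIndependent ℝ ![(EuclideanSpace.single 0 1 : Plane), EuclideanSpace.single 1 1] := by
  rw [LinearIndependent.pair_iff]
  intro x y h
  have h0 := congrArg (fun p : Plane => p 0) h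
  have h1 := congrArg (fun p : Plane => p 1) h
  simp at h0 h1
  exact ⟨h0, h1⟩

theorem orientation_ne_zero {σ : Plane → M} (hσ : ContMDiff (𝓡 2) (𝓡 2) ∞ σ)
    (imm : ∀ p, Function.Injective (mfderiv (𝓡 2) (𝓡 2) σ p)) (p : Plane) :
    orientation σ p ≠ 0 := by
  have h := mfderiv_comp (I'' := 𝓘(ℝ, Space3)) p
    (contMDiff_emb.mdifferentiableAt (by simp) (x := σ p)) (hσ.mdifferentiableAt (by simp))
  rw [mfderiv_eq_fderiv] at h
  rw [orientation, h]
  exact det_ne_zero (σ p) _ _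
    (linearIndependent_map (E := Plane) (L := (mfderiv (𝓡 2) (𝓡 2) σ p : Plane →L[ℝ] Plane)) (imm p)
      linearIndependent_single)

theorem continuous_orientation {σ : Plane → M} (hσ : ContMDiff (𝓡 2) (𝓡 2) ∞ σ) :
    Continuous (orientation σ) := by
  have h := (contDiff_emb_comp hσ).continuous_fderiv (by simp)
  exact continuous_det3 (continuous_normal.comp hσ.continuous) (h.clm_apply continuous_const)
    (h.clm_apply continuous_const)

/-- By the intermediate value theorem a nowhere vanishing function on a connected space has constant
sign. Stating this as a positive product avoids case distinctions. It serves for orientations of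
charts and along isotopies. -/
theorem pos_or_neg_of_ne_zero {X : Type*} [TopologicalSpace X] [PreconnectedSpace X] {g : X → ℝ}
    (hg : Continuous g) (h : ∀ x, g x ≠ 0) (x y : X) : 0 < g x * g y := by
  by_contra k
  obtain ⟨z, hz⟩ : (0 : ℝ) ∈ range g := by
    rcases lt_or_gt_of_ne (h x) with hx | hx <;> rcases lt_or_gt_of_ne (h y) with hy | hy
    · exact (k (mul_pos_of_neg_of_neg hx hy)).elim
    · exact mem_range_of_exists_le_of_exists_ge hg ⟨x, hx.le⟩ ⟨y, hy.le⟩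
    · exact mem_range_of_exists_le_of_exists_ge hg ⟨y, hy.le⟩ ⟨x, hx.le⟩
    · exact (k (mul_pos hx hy)).elim
  exact h z hz

/-- The plane is connected. Hence all crossings in one disk can be compared by determinants in the
chart, whether or not the chart preserves orientation. -/
theorem orientation_mul_pos {σ : Plane → M} (hσ : ContMDiff (𝓡 2) (𝓡 2) ∞ σ)
    (imm : ∀ p, Function.Injective (mfderiv (𝓡 2) (𝓡 2) σ p)) (p q : Plane) :
    0 < orientation σ p * orientation σ q :=
  pos_or_neg_of_ne_zero (continuous_orientation hσ) (orientation_ne_zero hσ imm) p q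

theorem crossForm_eq {σ : Plane → M} (hσ : ContMDiff (𝓡 2) (𝓡 2) ∞ σ) {γ : ℝ → M}
    {α : ℝ → Plane} {s t : ℝ} (hs : γ =ᶠ[𝓝 s] σ ∘ α) (ht : γ =ᶠ[𝓝 t] σ ∘ α)
    (hs' : DifferentiableAt ℝ α s) (ht' : DifferentiableAt ℝ α t) (h : α s = α t) :
    crossForm γ s t = det2 (deriv α s) (deriv α t) * orientation σ (α s) := by
  have key : ∀ {u}, γ =ᶠ[𝓝 u] σ ∘ α → DifferentiableAt ℝ α u →
      deriv (emb ∘ γ) u = fderiv ℝ (emb ∘ σ) (α u) (deriv α u) := by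
    intro u hu hu'
    rw [(hu.fun_comp emb).deriv_eq]
    exact fderiv_comp_deriv u ((contDiff_emb_comp hσ).differentiable (by simp) _) hu'
  rw [crossForm, key hs hs', key ht ht', ← h, det3_map, hs.eq_of_nhds]
  rfl

end

section

open Filter Topology OrientedSurface

/-! ### The crossing relation of a diagram and its invariance under isotopy. -/

section CrossingRelation

theorem Diagram.mem_Ioo {M : Type*} [TopologicalSpace M] [ChartedSpace Plane M] (D : Diagram M)
    {t s : ℝ} (ht : t ∈ I) (hs : s ∈ I) (hts : t ≠ s)
    (h : D.γ t = D.γ s) : t ∈ Ioo (0 : ℝ) 1 ∧ s ∈ Ioo (0 : ℝ) 1 :=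
  ⟨D.endpoints t ht s hs hts h, D.endpoints s hs t ht hts.symm h.symm⟩

variable {M : Type*} [TopologicalSpace M] [ChartedSpace Plane M] [OrientedSurface M]

/-- The sign of the crossing at the parameters `t` and `s`, where `t` is under-passing. -/
def Diagram.sgn (D : Diagram M) (t s : ℝ) : Bool := decide (0 < crossForm D.γ t s)

/-- At the parameter `t` the diagram passes under the strand with parameter `s`, with sign `b`. -/
def Diagram.Crossing (D : Diagram M) (t s : ℝ) (b : Bool) : Prop :=
  t ∈ I ∧ s ∈ I ∧ t ≠ s ∧ D.γ t = D.γ s ∧ t ∉ D.upper ∧ b = D.sgn t s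

variable {Q : Type*} [Quandle Q]

theorem Diagram.sgn_swap (D : Diagram M) {t s : ℝ} (ht : t ∈ I) (hs : s ∈ I) (hts : t ≠ s)
    (h : D.γ t = D.γ s) : D.sgn s t = !D.sgn t s := by
  have h0 := crossForm_ne_zero D ht hs hts h
  unfold Diagram.sgn
  rw [crossForm_swap h, ← decide_not, decide_eq_decide, not_lt, Left.neg_pos_iff]
  exact ⟨le_of_lt, fun k => lt_of_le_of_ne k h0⟩

theorem Diagram.free_of_upper (D : Diagram M) {t : ℝ} (h : t ∈ D.upper) : Free D.Crossing t :=
  fun _ _ k => k.2.2.2.2.1 h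

theorem Diagram.step_over (D : Diagram M) {f : ℝ → Q} {t : ℝ} {q : Q} (h : t ∈ D.upper) :
    Step D.Crossing f t q ↔ q = f t :=
  step_iff_of_free (D.free_of_upper h)

theorem Diagram.step_under (D : Diagram M) {f : ℝ → Q} {t s : ℝ} {q : Q} (ht : t ∈ I) (hs : s ∈ I)
    (hts : t ≠ s) (h : D.γ t = D.γ s) (hu : t ∉ D.upper) :
    Step D.Crossing f t q ↔ q = act (D.sgn t s) (f s) (f t) := by
  refine step_iff_of_unique ⟨ht, hs, hts, h, hu, rfl⟩ fun s' b' h' => ?_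
  obtain rfl : s' = s := by
    rcases D.no_triple t ht s hs s' h'.2.1 h h'.2.2.2.1 with k | k | k
    · exact (hts k).elim
    · exact (h'.2.2.1 k).elim
    · exact k.symm
  exact ⟨rfl, h'.2.2.2.2.2⟩

/-- Outside `I` nothing is known about `φ`, so it is replaced there by the identity; transport of
colorings needs an order isomorphism of the whole line. -/
theorem exists_orderIso {φ : ℝ → ℝ} (hφ : ContDiff ℝ ∞ φ) (h : ∀ t ∈ I, 0 < deriv φ t)
    (h0 : φ 0 = 0) (h1 : φ 1 = 1) : ∃ e : ℝ ≃o ℝ, (∀ t, e t ∈ I ↔ t ∈ I) ∧ ∀ t ∈ I, e t = φ t := by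
  have mono : StrictMonoOn φ I := strictMonoOn_of_deriv_pos (convex_Icc 0 1)
    hφ.continuous.continuousOn fun x hx => h x (interior_subset hx)
  have maps : ∀ t ∈ I, φ t ∈ I := fun t ht =>
    ⟨h0 ▸ mono.monotoneOn ⟨le_rfl, zero_le_one⟩ ht ht.1,
      h1 ▸ mono.monotoneOn ht ⟨zero_le_one, le_rfl⟩ ht.2⟩
  classical
  let g : ℝ → ℝ := fun t => if t ∈ I then φ t else t
  have g1 : ∀ t ∈ I, g t = φ t := fun t ht => if_pos ht
  have g2 : ∀ t, t ∉ I → g t = t := fun t ht => if_neg ht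
  have gmem : ∀ t, g t ∈ I ↔ t ∈ I := fun t => by
    by_cases ht : t ∈ I
    · rw [g1 t ht]
      exact iff_of_true (maps t ht) ht
    · rw [g2 t ht]
  have gmono : StrictMono g := by
    intro x y hxy
    by_cases hx : x ∈ I <;> by_cases hy : y ∈ I
    · rw [g1 x hx, g1 y hy]
      exact mono hx hy hxy
    · rw [g1 x hx, g2 y hy]
      have : 1 < y := by
        by_contra! k
        exact hy ⟨hx.1.trans hxy.le, k⟩
      exact (maps x hx).2.trans_lt this
    · rw [g2 x hx, g1 y hy]
      have : x < 0 := by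
        by_contra! k
        exact hx ⟨k, hxy.le.trans hy.2⟩
      exact this.trans_le (maps y hy).1
    · rwa [g2 x hx, g2 y hy]
  have gsurj : Function.Surjective g := by
    intro y
    by_cases hy : y ∈ I
    · obtain ⟨x, hx, hxy⟩ := intermediate_value_Icc (zero_le_one (α := ℝ))
        hφ.continuous.continuousOn (f := φ) (by rwa [h0, h1])
      exact ⟨x, by rw [g1 x hx, hxy]⟩
    · exact ⟨y, g2 y hy⟩
  exact ⟨gmono.orderIsoOfSurjective g gsurj, gmem, g1⟩

theorem velocity_comp_diffeomorph {γ : ℝ → M} (hγ : ContMDiff 𝓘(ℝ, ℝ) (𝓡 2) ∞ γ)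
    (Φ : Diffeomorph (𝓡 2) (𝓡 2) M M ∞) (t : ℝ) :
    deriv (emb ∘ Φ ∘ γ) t = mfderiv (𝓡 2) 𝓘(ℝ, Space3) emb (Φ (γ t))
      (mfderiv (𝓡 2) (𝓡 2) Φ (γ t) (velocity γ t)) := by
  rw [deriv_emb_comp (Φ.contMDiff.comp hγ)]
  unfold velocity
  rw [mfderiv_comp t (Φ.contMDiff.mdifferentiableAt (by simp)) (hγ.mdifferentiableAt (by simp))]
  rfl

theorem crossForm_comp_ne_zero (D : Diagram M) (Φ : Diffeomorph (𝓡 2) (𝓡 2) M M ∞) {s t : ℝ}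
    (hs : s ∈ I) (ht : t ∈ I) (hst : s ≠ t) (h : D.γ s = D.γ t) :
    crossForm (Φ ∘ D.γ) s t ≠ 0 := by
  rw [crossForm, velocity_comp_diffeomorph D.smooth, velocity_comp_diffeomorph D.smooth, ← h]
  refine det_ne_zero (Φ (D.γ s)) _ _ (linearIndependent_map (E := Plane)
    (L := (mfderiv (𝓡 2) (𝓡 2) Φ (D.γ s) : Plane →L[ℝ] Plane)) ?_ (D.transverse s hs t ht hst h))
  change Function.Injective (mfderiv (𝓡 2) (𝓡 2) Φ (D.γ s))
  rw [← Φ.mfderivToContinuousLinearEquiv_coe (by simp)]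
  exact (Φ.mfderivToContinuousLinearEquiv (by simp) _).injective

/-- Every stage of the isotopy is a diffeomorphism and keeps the two velocities independent. The
form is therefore a continuous nonvanishing function of the isotopy parameter, and its sign is the
same at 0 and at 1. Smoothness of `F` in both variables is what makes the velocities continuous in
that parameter. -/
theorem crossForm_isotopy_pos (D : Diagram M) {F : ℝ → Diffeomorph (𝓡 2) (𝓡 2) M M ∞}
    (hF : ContMDiff (𝓘(ℝ, ℝ).prod (𝓡 2)) (𝓡 2) ∞ (fun p : ℝ × M => F p.1 p.2))
    (hF0 : ∀ p, F 0 p = p) {s t : ℝ}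
    (hs : s ∈ I) (ht : t ∈ I) (hst : s ≠ t) (h : D.γ s = D.γ t) :
    0 < crossForm (F 1 ∘ D.γ) s t * crossForm D.γ s t := by
  have e : (F 0 ∘ D.γ) = D.γ := funext fun t => hF0 _
  have hsm : ContMDiff 𝓘(ℝ, ℝ × ℝ) (𝓡 2) ∞ (fun p : ℝ × ℝ => F p.1 (D.γ p.2)) :=
    hF.comp (contDiff_fst.contMDiff.prodMk (D.smooth.comp contDiff_snd.contMDiff))
  let H : ℝ × ℝ → Space3 := fun p => emb (F p.1 (D.γ p.2))
  have hH : ContDiff ℝ ∞ H := (contMDiff_emb.comp hsm).contDiff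
  have hd : ∀ u v, deriv (emb ∘ F u ∘ D.γ) v = fderiv ℝ H (u, v) (0, 1) := by
    intro u v
    have h1 : HasDerivAt (fun v : ℝ => (u, v)) ((0 : ℝ), (1 : ℝ)) v :=
      (hasDerivAt_const v u).prodMk (hasDerivAt_id v)
    exact ((hH.differentiable (by simp) (u, v)).hasFDerivAt.comp_hasDerivAt v h1).deriv
  have hcont : ∀ v, Continuous fun u => deriv (emb ∘ F u ∘ D.γ) v := by
    intro v
    simp only [hd]
    exact ((hH.continuous_fderiv (by simp)).comp (by fun_prop : Continuous fun u : ℝ => (u, v))).clm_apply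
      continuous_const
  have hn : Continuous fun u => normal (F u (D.γ s)) :=
    continuous_normal.comp (hsm.continuous.comp (by fun_prop : Continuous fun u : ℝ => (u, s)))
  have := pos_or_neg_of_ne_zero (g := fun u => crossForm (F u ∘ D.γ) s t)
    (continuous_det3 hn (hcont s) (hcont t))
    (fun u => crossForm_comp_ne_zero D (F u) hs ht hst h) 1 0
  rwa [e] at this

theorem crossForm_comp_param {γ : ℝ → M} (hγ : ContMDiff 𝓘(ℝ, ℝ) (𝓡 2) ∞ γ) {φ : ℝ → ℝ}
    (hφ : Differentiable ℝ φ) (s t : ℝ) :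
    crossForm (γ ∘ φ) s t = deriv φ s * deriv φ t * crossForm γ (φ s) (φ t) := by
  have key : ∀ u, deriv (emb ∘ γ ∘ φ) u = deriv φ u • deriv (emb ∘ γ) (φ u) := fun u =>
    deriv.scomp u ((contMDiff_emb.comp hγ).contDiff.differentiable (by simp) _) (hφ u)
  rw [crossForm, key, key, det3_smul_smul]
  rfl

theorem Isotopic.hasColoring_iff {D D' : Diagram M} (h : Isotopic D D') {x y : Q} :
    HasColoring D.Crossing x y ↔ HasColoring D'.Crossing x y := by
  obtain ⟨F, φ, hF, hF0, hφ, hφ', h0, h1, hγ, hup⟩ := h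
  obtain ⟨e, he, heφ⟩ := exists_orderIso hφ hφ' h0 h1
  refine HasColoring.comp_orderIso e (by rw [heφ 0 ⟨le_rfl, zero_le_one⟩, h0])
    (by rw [heφ 1 ⟨zero_le_one, le_rfl⟩, h1]) fun t s b => ?_
  by_cases ht : t ∈ I
  swap
  · exact iff_of_false (fun k => ht k.1) (fun k => ht ((he t).1 k.1))
  by_cases hs : s ∈ I
  swap
  · exact iff_of_false (fun k => hs k.2.1) (fun k => hs ((he s).1 k.2.1))
  have het := (he t).2 ht
  have hes := (he s).2 hs
  have hγ' : D'.γ t = D'.γ s ↔ D.γ (e t) = D.γ (e s) := by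
    rw [hγ t ht, hγ s hs, heφ t ht, heφ s hs]
    exact (F 1).injective.eq_iff
  by_cases hts : t = s
  · exact iff_of_false (fun k => k.2.2.1 hts) (fun k => k.2.2.1 (hts ▸ rfl))
  by_cases hD : D'.γ t = D'.γ s
  swap
  · exact iff_of_false (fun k => hD k.2.2.2.1) (fun k => hD (hγ'.2 k.2.2.2.1))
  have hets : e t ≠ e s := fun k => hts (e.injective k)
  have near : ∀ u ∈ Ioo (0 : ℝ) 1, D'.γ =ᶠ[𝓝 u] (F 1 ∘ D.γ) ∘ φ := fun u hu => by
    filter_upwards [Icc_mem_nhds hu.1 hu.2] with v hv using hγ v hv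
  obtain ⟨ht0, hs0⟩ := D'.mem_Ioo ht hs hts hD
  have hsgn : D'.sgn t s = D.sgn (e t) (e s) := by
    have hpos := crossForm_isotopy_pos D hF hF0 het hes hets (hγ'.1 hD)
    have hform := crossForm_congr (near t ht0) (near s hs0)
    rw [crossForm_comp_param ((F 1).contMDiff.comp D.smooth) (hφ.differentiable (by simp)),
      ← heφ t ht, ← heφ s hs] at hform
    unfold Diagram.sgn
    rw [decide_eq_decide, hform, mul_pos_iff_of_pos_left (mul_pos (hφ' t ht) (hφ' s hs))]
    exact ⟨fun k => pos_of_mul_pos_right hpos k.le, fun k => pos_of_mul_pos_left hpos k.le⟩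
  have hup' : t ∈ D'.upper ↔ e t ∈ D.upper := by
    rw [hup t ht s hs hts hD, heφ t ht]
  unfold Diagram.Crossing
  rw [hsgn, hup', hγ']
  tauto

end CrossingRelation

end

section

open Filter Topology OrientedSurface

/-! ### The quandle equations of the third Reidemeister move. -/

section Triangle

variable {Q : Type*} [Quandle Q]

/-- The coloring equations along a strand that meets two crossings, where the flag `w` tells which
of the two color changes `g`, `h` happens first. -/
def TwoSteps (w : Bool) (g h : Q → Q) (x m y : Q) : Prop :=
  m = cond w (g x) (h x) ∧ y = cond w (h m) (g m)

/-- The coloring equations of three strands that cross pairwise. The flags `u`, `v`, `w` tell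
whether the second strand meets the third one before the first one, whether the first strand meets
the second one before the third one, and whether the third strand meets the first one before the
second one. The flags `U` and `V` tell whether the third strand is over the two others, and whether
the first one is over the second one; the other Booleans are signs. -/
def TriangleEqs (e s₁ s₂ u v w U V : Bool) (x₀ x₁ x₂ y₀ y₁ y₂ z₀ z₁ z₂ : Q) : Prop :=
  TwoSteps v (cond V id (act e (cond u y₁ y₀))) (cond U (act s₁ (cond w z₀ z₁)) id) x₀ x₁ x₂ ∧
  TwoSteps u (cond U (act s₂ (cond w z₁ z₀)) id) (cond V (act (!e) (cond v x₀ x₁)) id) y₀ y₁ y₂ ∧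
  TwoSteps w (cond U id (act (!s₁) (cond v x₁ x₀))) (cond U id (act (!s₂) (cond u y₀ y₁))) z₀ z₁ z₂

/-- The move reverses the order of the two crossings on each strand and keeps the signs. The two
signs with the third strand are not free: the geometry forces them to be `e != u` and `e == v`.
Either system determines its middle and end colors from the initial ones, and in each of the 32
cases the end colors agree by distributivity, with cancellation of opposite actions. -/
theorem TriangleEqs.move {e u v U V : Bool} {x₀ x₁ x₂ y₀ y₁ y₂ z₀ z₁ z₂ : Q}
    (h : TriangleEqs e (e != u) (e == v) u v true U V x₀ x₁ x₂ y₀ y₁ y₂ z₀ z₁ z₂) :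
    ∃ x y z, TriangleEqs e (e != u) (e == v) (!u) (!v) false U V x₀ x x₂ y₀ y y₂ z₀ z z₂ := by
  cases e <;> cases u <;> cases v <;> cases U <;> cases V <;>
  simp only [TriangleEqs, TwoSteps, cond_true, cond_false, id, Bool.not_true, Bool.not_false,
    bne_self_eq_false, beq_self_eq_true, Bool.bne_true, Bool.bne_false, beq_true, beq_false] at h ⊢ <;>
  obtain ⟨⟨rfl, rfl⟩, ⟨rfl, rfl⟩, ⟨rfl, rfl⟩⟩ := h <;>
  refine ⟨_, _, _, ⟨rfl, ?_⟩, ⟨rfl, ?_⟩, ⟨rfl, ?_⟩⟩ <;>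
  first
  | rfl
  | simp only [← act_distrib]
  | simp only [← act_distrib, act_false_true]
  | rw [act_distrib]; simp only [act_true_false, act_false_true]
  | symm; rw [act_distrib]; simp only [act_true_false, act_false_true]

end Triangle

/-! ### Transfer of colorings between diagrams that agree outside a disk. -/

section Transfer

variable {M : Type*} [TopologicalSpace M] [ChartedSpace Plane M]

/-- Two diagrams run in the set `B` exactly along the given strands, and agree elsewhere. -/
structure AgreeOutside {ι : Type*} (D D' : Diagram M) (S : ι → Set ℝ) (B : Set M) : Prop where
  closed : ∀ i, IsClosed (S i)
  meets : ∀ t ∈ I, D.γ t ∈ B ↔ ∃ i, t ∈ S i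
  meets' : ∀ t ∈ I, D'.γ t ∈ B ↔ ∃ i, t ∈ S i
  agree : ∀ t ∈ I, (∀ i, t ∉ S i) → D.γ t = D'.γ t
  upper : ∀ s ∈ I, ∀ t ∈ I, (∀ i, s ∉ S i) → (∀ i, t ∉ S i) → s ≠ t → D.γ s = D.γ t →
    (s ∈ D.upper ↔ s ∈ D'.upper)

variable {ι : Type*} {D D' : Diagram M} {S : ι → Set ℝ} {B : Set M}

theorem AgreeOutside.symm (h : AgreeOutside D D' S B) : AgreeOutside D' D S B where
  closed := h.closed
  meets := h.meets'
  meets' := h.meets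
  agree t ht k := (h.agree t ht k).symm
  upper s hs t ht k k' hst e :=
    (h.upper s hs t ht k k' hst (by rw [h.agree s hs k, h.agree t ht k', e])).symm

theorem AgreeOutside.partner (h : AgreeOutside D D' S B) {t s : ℝ} (ht : t ∈ I) (hs : s ∈ I)
    (hts : D.γ t = D.γ s) : (∃ i, t ∈ S i) ↔ ∃ i, s ∈ S i := by
  rw [← h.meets t ht, ← h.meets s hs, hts]

theorem AgreeOutside.eventuallyEq [Finite ι] (h : AgreeOutside D D' S B) {t : ℝ}
    (ht : t ∈ Ioo (0 : ℝ) 1) (k : ∀ i, t ∉ S i) : D.γ =ᶠ[𝓝 t] D'.γ := by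
  have : ∀ᶠ x in 𝓝 t, ∀ i, x ∉ S i := by
    rw [eventually_all]
    exact fun i => (h.closed i).isOpen_compl.mem_nhds (k i)
  filter_upwards [this, Icc_mem_nhds ht.1 ht.2] with x hx hx' using h.agree x hx' hx

variable [OrientedSurface M]

/-- Lying in `B` is a property of the double point, so both of its parameters are on the strands or
neither is. In the second case the diagrams agree near both parameters, which gives the same sign.
-/
theorem AgreeOutside.crossing [Finite ι] (h : AgreeOutside D D' S B) {t s : ℝ} {b : Bool}
    (k : ∀ i, t ∉ S i) (hX : D.Crossing t s b) : D'.Crossing t s b ∧ ∀ i, s ∉ S i := by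
  obtain ⟨ht, hs, hts, hγ, hup, hb⟩ := hX
  have k' : ∀ i, s ∉ S i := by
    simpa using mt (h.partner ht hs hγ).2 (by simpa using k)
  obtain ⟨ht0, hs0⟩ := D.mem_Ioo ht hs hts hγ
  refine ⟨⟨ht, hs, hts, ?_, ?_, ?_⟩, k'⟩
  · rw [← h.agree t ht k, ← h.agree s hs k', hγ]
  · rwa [← h.upper t ht s hs k k' hts hγ]
  · rw [hb, Diagram.sgn, Diagram.sgn,
      crossForm_congr (h.eventuallyEq ht0 k) (h.eventuallyEq hs0 k')]

variable {Q : Type*} [Quandle Q]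

/-- The initial and final color of each strand are kept, and a color `m i` between the marks has to
be found. The quantification over `f'` expresses that the equations involve only colors at marked
parameters. -/
theorem AgreeOutside.hasColoring [Finite ι] {S : ι → Strand}
    (h : AgreeOutside D D' (fun i => (S i).set) B)
    (disj : Pairwise fun i j => Disjoint (S i).set (S j).set)
    (hX : ∀ i, Free D.Crossing (S i).d) (hX' : ∀ i, (S i).Marks D'.Crossing)
    (hm : ∀ f : ℝ → Q, IsColoring D.Crossing f → ∃ m : ι → Q, ∀ f' : ℝ → Q,
      (∀ i, f' (S i).p = f (S i).c ∧ f' (S i).q = m i) →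
      ∀ i, Step D'.Crossing f' (S i).p (m i) ∧ Step D'.Crossing f' (S i).q (f (S i).d))
    {x y : Q} (hc : HasColoring D.Crossing x y) : HasColoring D'.Crossing x y := by
  obtain ⟨f, hf, rfl, rfl⟩ := hc
  obtain ⟨m, hm⟩ := hm f hf
  obtain ⟨f', h1, h2⟩ := exists_recoloring S disj f m
  refine ⟨f', hf.of_recoloring disj (fun t k s b => h.symm.crossing k)
    (fun t k hfree s b hs => hfree s b (h.crossing k hs).1) hX hX' h1 h2 (hm f' fun i => ?_),
    h1 0 fun i k => by linarith [k.1, (S i).c_pos], h1 1 fun i k => by linarith [k.2, (S i).d_lt]⟩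
  have k1 := (S i).hcp
  have k2 := (S i).hpq
  have k3 := (S i).hqd
  rw [h2 i _ ⟨k1.le, by linarith⟩, h2 i _ ⟨by linarith, k3.le⟩, Strand.stepFun, Strand.stepFun,
    if_pos le_rfl, if_neg (by linarith), if_pos le_rfl]
  exact ⟨rfl, rfl⟩

end Transfer

end

section

open Filter Topology OrientedSurface

/-! ### Signs and zeros of real functions along a strand. -/

section Real

theorem mul_pos_of_forall_ne_zero {h : ℝ → ℝ} {s : Set ℝ} (hs : IsPreconnected s)
    (hc : ContinuousOn h s) (h0 : ∀ t ∈ s, h t ≠ 0) {x y : ℝ} (hx : x ∈ s) (hy : y ∈ s) :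
    0 < h x * h y := by
  have := isPreconnected_iff_preconnectedSpace.1 hs
  exact pos_or_neg_of_ne_zero (g := s.domRestrict h) hc.domRestrict (fun t => h0 t t.2) ⟨x, hx⟩ ⟨y, hy⟩

theorem eventually_slope_mul_pos {h : ℝ → ℝ} {h' s : ℝ} (hd : HasDerivAt h h' s) (h0 : h' ≠ 0)
    (hs : h s = 0) : ∀ᶠ y in 𝓝[≠] s, 0 < h y * h' * (y - s) := by
  have h1 : Tendsto (fun y => slope h s y * h') (𝓝[≠] s) (𝓝 (h' * h')) :=
    (hasDerivAt_iff_tendsto_slope.1 hd).mul_const h'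
  filter_upwards [h1.eventually (lt_mem_nhds (mul_self_pos.2 h0)), self_mem_nhdsWithin] with y hy hys
  have hne : y - s ≠ 0 := sub_ne_zero.2 hys
  rw [slope_def_field, hs, sub_zero] at hy
  have : h y * h' * (y - s) = h y / (y - s) * h' * (y - s) ^ 2 := by field_simp
  rw [this]
  positivity

/-- Up to its first zero the function keeps the sign it has at `c`, so it arrives at the zero moving
away from that sign. -/
theorem mul_deriv_neg_of_first_zero {h : ℝ → ℝ} {h' c s : ℝ} (hcs : c < s)
    (hc : ContinuousOn h (Ico c s)) (hne : ∀ t ∈ Ico c s, h t ≠ 0) (hs : h s = 0)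
    (hd : HasDerivAt h h' s) (h0 : h' ≠ 0) : h c * h' < 0 := by
  have h1 : ∀ᶠ y in 𝓝[<] s, 0 < h y * h' * (y - s) :=
    (eventually_slope_mul_pos hd h0 hs).filter_mono (nhdsWithin_mono _ fun y hy => ne_of_lt hy)
  obtain ⟨y, hy, hy'⟩ := (h1.and (Ioo_mem_nhdsLT hcs)).exists
  have h2 := mul_pos_of_forall_ne_zero isPreconnected_Ico hc hne ⟨le_rfl, hcs⟩ ⟨hy'.1.le, hy'.2⟩
  have h3 : h y * h' < 0 := by
    by_contra! k
    nlinarith [hy'.2]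
  by_contra! k
  nlinarith [mul_pos_of_neg_of_neg h3 h3, mul_nonneg h2.le k, mul_self_pos.2 h0,
    mul_neg_of_pos_of_neg h2 h3, mul_pos h2 (mul_self_pos.2 h0)]

theorem mul_deriv_pos_of_last_zero {h : ℝ → ℝ} {h' s d : ℝ} (hsd : s < d)
    (hc : ContinuousOn h (Ioc s d)) (hne : ∀ t ∈ Ioc s d, h t ≠ 0) (hs : h s = 0)
    (hd : HasDerivAt h h' s) (h0 : h' ≠ 0) : 0 < h d * h' := by
  have h1 : ∀ᶠ y in 𝓝[>] s, 0 < h y * h' * (y - s) :=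
    (eventually_slope_mul_pos hd h0 hs).filter_mono (nhdsWithin_mono _ fun y hy => ne_of_gt hy)
  obtain ⟨y, hy, hy'⟩ := (h1.and (Ioo_mem_nhdsGT hsd)).exists
  have h2 := mul_pos_of_forall_ne_zero isPreconnected_Ioc hc hne ⟨hsd, le_rfl⟩ ⟨hy'.1, hy'.2.le⟩
  have h3 : 0 < h y * h' := pos_of_mul_pos_left hy (by linarith [hy'.1])
  by_contra! k
  nlinarith [mul_pos h2 (mul_self_pos.2 h0)]

/-- A function with nonvanishing derivative is strictly monotone. -/
structure IsMonotoneStrand (g : ℝ → ℝ) (a b : ℝ) : Prop where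
  deriv_mul_pos : ∀ t ∈ Ioo a b, ∀ o ∈ Ioo a b, 0 < deriv g t * deriv g o
  sub_mul_pos : ∀ t ∈ Icc a b, ∀ s ∈ Icc a b, ∀ o ∈ Ioo a b, s < t → 0 < (g t - g s) * deriv g o

/-- Derivatives have the Darboux property, so a nonvanishing one has constant sign; the mean value
theorem does the rest. The direction of the strand is encoded by the derivative at an auxiliary
point `o`. -/
theorem isMonotoneStrand {g : ℝ → ℝ} {a b : ℝ} (hc : ContinuousOn g (Icc a b))
    (hd : ∀ t ∈ Ioo a b, DifferentiableAt ℝ g t) (h0 : ∀ t ∈ Ioo a b, deriv g t ≠ 0) :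
    IsMonotoneStrand g a b := by
  have h1 : ∀ t ∈ Ioo a b, ∀ o ∈ Ioo a b, 0 < deriv g t * deriv g o := by
    intro t ht o ho
    rcases hasDerivWithinAt_forall_lt_or_forall_gt_of_forall_ne (convex_Ioo a b)
      (fun x hx => (hd x hx).hasDerivAt.hasDerivWithinAt) h0 with k | k
    · exact mul_pos_of_neg_of_neg (k t ht) (k o ho)
    · exact mul_pos (k t ht) (k o ho)
  refine ⟨h1, fun t ht s hs o ho hst => ?_⟩
  obtain ⟨x, hx, hx'⟩ := exists_deriv_eq_slope g hst
    (hc.mono (Icc_subset_Icc hs.1 ht.2))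
    fun x hx => (hd x ⟨hs.1.trans_lt hx.1, hx.2.trans_le ht.2⟩).differentiableWithinAt
  have k := h1 x ⟨hs.1.trans_lt hx.1, hx.2.trans_le ht.2⟩ o ho
  have hts : 0 < t - s := sub_pos.2 hst
  rw [eq_div_iff hts.ne'] at hx'
  rw [← hx']
  nlinarith [mul_pos k hts]

theorem IsMonotoneStrand.injOn {g : ℝ → ℝ} {a b : ℝ} (hab : a < b) (h : IsMonotoneStrand g a b) :
    InjOn g (Icc a b) := by
  obtain ⟨o, ho⟩ := nonempty_Ioo.2 hab
  intro t ht s hs hts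
  by_contra hne
  rcases lt_or_gt_of_ne hne with k | k
  · simpa [hts] using h.sub_mul_pos s hs t ht o ho k
  · simpa [hts] using h.sub_mul_pos t ht s hs o ho k

/-- This reads off the order of two crossings on a diameter, one of them at the center, from the
sign of a coordinate. -/
theorem IsMonotoneStrand.mul_deriv_pos_iff {g : ℝ → ℝ} {a b : ℝ} (h : IsMonotoneStrand g a b)
    {t o : ℝ} (ht : t ∈ Icc a b) (ho : o ∈ Ioo a b) (h0 : g o = 0) :
    0 < g t * deriv g o ↔ o < t := by
  have ho' := Ioo_subset_Icc_self ho
  constructor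
  · intro k
    by_contra! hto
    rcases hto.eq_or_lt with rfl | hto
    · simp [h0] at k
    · have := h.sub_mul_pos o ho' t ht o ho hto
      rw [h0, zero_sub] at this
      nlinarith
  · intro hot
    have := h.sub_mul_pos t ht o ho' o ho hot
    rwa [h0, sub_zero] at this

/-- Injectivity makes the two end values distinct, so they are 1 and -1 in some order, and the
intermediate value theorem applies. -/
theorem IsMonotoneStrand.exists_eq {g : ℝ → ℝ} {a b : ℝ} (hab : a < b) (h : IsMonotoneStrand g a b)
    (hc : ContinuousOn g (Icc a b)) (ha : |g a| = 1) (hb : |g b| = 1) {v : ℝ} (hv : |v| < 1) :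
    ∃ t ∈ Ioo a b, g t = v := by
  obtain ⟨hv1, hv2⟩ := abs_lt.1 hv
  have hne : g a ≠ g b := fun k =>
    hab.ne (h.injOn hab (left_mem_Icc.2 hab.le) (right_mem_Icc.2 hab.le) k)
  rcases eq_or_eq_neg_of_abs_eq ha with ha | ha <;> rcases eq_or_eq_neg_of_abs_eq hb with hb | hb
  · exact (hne (ha.trans hb.symm)).elim
  · exact intermediate_value_Ioo' hab.le hc ⟨by linarith, by linarith⟩
  · exact intermediate_value_Ioo hab.le hc ⟨by linarith, by linarith⟩
  · exact (hne (ha.trans hb.symm)).elim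

end Real

/-! ### Strands running along an axis of a disk chart. -/

section ChartStrand

theorem deriv_apply_of_differentiableAt {α : ℝ → Plane} {t : ℝ} (h : DifferentiableAt ℝ α t)
    (i : Fin 2) : HasDerivAt (fun t => α t i) (deriv α t i) t := by
  have := (EuclideanSpace.proj (𝕜 := ℝ) i : Plane →L[ℝ] ℝ).hasFDerivAt.comp_hasDerivAt t h.hasDerivAt
  exact this

theorem abs_apply_le_norm (p : Plane) (i : Fin 2) : |p i| ≤ ‖p‖ := by
  simpa using PiLp.norm_apply_le p i

theorem plane_ext {p q : Plane} {i j : Fin 2} (hij : i ≠ j) (hi : p i = q i) (hj : p j = q j) :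
    p = q := by
  ext k
  have : k = i ∨ k = j := by omega
  rcases this with rfl | rfl <;> assumption

theorem abs_eq_norm {p : Plane} {i j : Fin 2} (hij : i ≠ j) (hj : p j = 0) : |p i| = ‖p‖ := by
  have : ‖p‖ ^ 2 = p i ^ 2 := by
    rw [EuclideanSpace.real_norm_sq_eq, Fin.sum_univ_two]
    have : (i = 0 ∧ j = 1) ∨ (i = 1 ∧ j = 0) := by omega
    rcases this with ⟨rfl, rfl⟩ | ⟨rfl, rfl⟩ <;> simp [hj]
  rw [← abs_of_nonneg (norm_nonneg p), ← sq_eq_sq_iff_abs_eq_abs, this]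

variable {M : Type*} [TopologicalSpace M] [ChartedSpace Plane M]

theorem deriv_chartCurve_ne_zero (D : Diagram M) {ψ : Plane → M} (hψ : IsDiskChart ψ) {t : ℝ}
    (ht : t ∈ I) (hr : D.γ t ∈ range ψ) : deriv (chartCurve ψ D.γ) t ≠ 0 := by
  intro h
  apply D.immersion t ht
  have hα : DifferentiableAt ℝ (chartCurve ψ D.γ) t :=
    (contDiffAt_chartCurve hψ D.smooth hr).differentiableAt (by simp)
  unfold velocity
  have e := (eventually_chart_chartCurve hψ D.smooth.continuous hr).mfderiv_eq
    (I := 𝓘(ℝ, ℝ)) (I' := 𝓡 2)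
  rw [mfderiv_comp (I' := 𝓡 2) t (hψ.contMDiff.mdifferentiableAt (by simp)) hα.mdifferentiableAt] at e
  have e' : mfderiv 𝓘(ℝ, ℝ) (𝓡 2) (chartCurve ψ D.γ) t (1 : ℝ) = (0 : Plane) := by
    rw [mfderiv_eq_fderiv]
    exact h
  have e2 := congrArg (fun L : ℝ →L[ℝ] Plane => L 1) e
  refine e2.trans ?_
  change mfderiv (𝓡 2) (𝓡 2) ψ _ (mfderiv 𝓘(ℝ, ℝ) (𝓡 2) (chartCurve ψ D.γ) t (1 : ℝ)) = _
  rw [e']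
  exact map_zero (mfderiv (𝓡 2) (𝓡 2) ψ (chartCurve ψ D.γ t))

/-- What is known about a strand running along the `i`-th axis of a disk chart. -/
structure IsAxisStrand {M : Type*} (ψ : Plane → M) (γ : ℝ → M) (i j : Fin 2) (a b : ℝ) : Prop where
  ne : i ≠ j
  mono : IsMonotoneStrand (fun t => chartCurve ψ γ t i) a b
  mem_range : ∀ t ∈ Icc a b, γ t ∈ range ψ
  apply_eq_zero : ∀ t ∈ Icc a b, chartCurve ψ γ t j = 0
  deriv_eq_zero : ∀ t ∈ Ioo a b, deriv (chartCurve ψ γ) t j = 0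
  exists_eq : ∀ v : ℝ, |v| < 1 → ∃ t ∈ Ioo a b, chartCurve ψ γ t i = v

/-- On the axis the `j`-th coordinate and its derivative vanish, so immersivity makes the derivative
of the `i`-th coordinate nonzero. The strand is thus monotone, and as its ends lie on the unit
circle it sweeps the whole diameter exactly once. -/
theorem isAxisStrand (D : Diagram M) {ψ : Plane → M} (hψ : IsDiskChart ψ) {i j : Fin 2}
    (hij : i ≠ j) {a b : ℝ} (ha : 0 < a) (hab : a < b) (hb : b < 1)
    (hr : ∀ t ∈ Icc a b, D.γ t ∈ range ψ) (hj : ∀ t ∈ Icc a b, chartCurve ψ D.γ t j = 0)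
    (na : ‖chartCurve ψ D.γ a‖ = 1) (nb : ‖chartCurve ψ D.γ b‖ = 1) :
    IsAxisStrand ψ D.γ i j a b := by
  have hdiff : ∀ t ∈ Icc a b, DifferentiableAt ℝ (chartCurve ψ D.γ) t := fun t ht =>
    (contDiffAt_chartCurve hψ D.smooth (hr t ht)).differentiableAt (by simp)
  have hd : ∀ (k : Fin 2), ∀ t ∈ Icc a b,
      HasDerivAt (fun t => chartCurve ψ D.γ t k) (deriv (chartCurve ψ D.γ) t k) t := fun k t ht =>
    deriv_apply_of_differentiableAt (hdiff t ht) k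
  have hj' : ∀ t ∈ Ioo a b, deriv (chartCurve ψ D.γ) t j = 0 := by
    intro t ht
    have h1 := hd j t (Ioo_subset_Icc_self ht)
    have h2 : (fun t => chartCurve ψ D.γ t j) =ᶠ[𝓝 t] fun _ => 0 := by
      filter_upwards [Icc_mem_nhds ht.1 ht.2] with x hx using hj x hx
    rw [← h1.deriv, h2.deriv_eq, deriv_const]
  have hc : ContinuousOn (fun t => chartCurve ψ D.γ t i) (Icc a b) := fun t ht =>
    (hd i t ht).continuousAt.continuousWithinAt
  have mono : IsMonotoneStrand (fun t => chartCurve ψ D.γ t i) a b := by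
    refine isMonotoneStrand hc
      (fun t ht => (hd i t (Ioo_subset_Icc_self ht)).differentiableAt) fun t ht k => ?_
    rw [(hd i t (Ioo_subset_Icc_self ht)).deriv] at k
    exact deriv_chartCurve_ne_zero D hψ ⟨by linarith [ht.1], by linarith [ht.2]⟩
      (hr t (Ioo_subset_Icc_self ht)) (plane_ext hij k (hj' t ht))
  refine ⟨hij, mono, hr, hj, hj', fun v hv => mono.exists_eq hab hc ?_ ?_ hv⟩
  · rw [abs_eq_norm hij (hj a ⟨le_rfl, hab.le⟩), na]
  · rw [abs_eq_norm hij (hj b ⟨hab.le, le_rfl⟩), nb]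

theorem hasDerivAt_chartCurve_apply {ψ : Plane → M} {γ : ℝ → M} (hψ : IsDiskChart ψ)
    (hγ : ContMDiff 𝓘(ℝ, ℝ) (𝓡 2) ∞ γ) {t : ℝ} (ht : γ t ∈ Set.range ψ) (k : Fin 2) :
    HasDerivAt (fun t => chartCurve ψ γ t k) (deriv (chartCurve ψ γ) t k) t :=
  deriv_apply_of_differentiableAt
    ((contDiffAt_chartCurve hψ hγ ht).differentiableAt (by simp)) k

end ChartStrand

namespace IsAxisStrand

variable {M : Type*} {ψ : Plane → M} {γ : ℝ → M} {i j : Fin 2} {a b : ℝ}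

theorem injOn (h : IsAxisStrand ψ γ i j a b) (hab : a < b) : InjOn γ (Icc a b) :=
  fun t ht s hs hts => h.mono.injOn hab ht hs (by simp only [chartCurve, hts])

/-- A point of the open disk on the axis belongs to the strand. -/
theorem exists_meet (h : IsAxisStrand ψ γ i j a b) {γ' : ℝ → M} {s : ℝ}
    (hs : γ' s ∈ Set.range ψ) (hn : ‖chartCurve ψ γ' s‖ < 1) (hj : chartCurve ψ γ' s j = 0) :
    ∃ r ∈ Ioo a b, γ r = γ' s := by
  obtain ⟨r, hr, hri⟩ := h.exists_eq _ ((abs_apply_le_norm _ i).trans_lt hn)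
  refine ⟨r, hr, ?_⟩
  rw [← chart_chartCurve (h.mem_range r (Ioo_subset_Icc_self hr)), ← chart_chartCurve hs,
    plane_ext h.ne hri (by rw [hj, h.apply_eq_zero r (Ioo_subset_Icc_self hr)])]

end IsAxisStrand

end

section

open Filter Topology OrientedSurface

/-! ### Double points and the color changes at their two parameters. -/

section Double

variable {M : Type*} [TopologicalSpace M] [ChartedSpace Plane M]

/-- The parameters `t` and `s` are those of a double point. -/
structure Diagram.IsDouble (D : Diagram M) (t s : ℝ) : Prop where
  left_mem : t ∈ I
  right_mem : s ∈ I
  ne : t ≠ s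
  eq : D.γ t = D.γ s

theorem Diagram.IsDouble.symm {D : Diagram M} {t s : ℝ} (h : D.IsDouble t s) : D.IsDouble s t :=
  ⟨h.right_mem, h.left_mem, h.ne.symm, h.eq.symm⟩

theorem Diagram.IsDouble.upper_iff {D : Diagram M} {t s : ℝ} (h : D.IsDouble t s) {V : Bool}
    (hV : V = true ↔ t ∈ D.upper) : (!V) = true ↔ s ∈ D.upper := by
  have := D.crossing t h.left_mem s h.right_mem h.ne h.eq
  cases V <;> simp_all

variable [OrientedSurface M]

theorem Diagram.exists_isDouble {D : Diagram M} {t : ℝ} (h : ¬ Free D.Crossing t) :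
    ∃ s, D.IsDouble t s := by
  unfold Free at h
  push Not at h
  obtain ⟨s, b, h1, h2, h3, h4, -⟩ := h
  exact ⟨s, h1, h2, h3, h4⟩

theorem Diagram.IsDouble.sgn_swap {D : Diagram M} {t s : ℝ} (h : D.IsDouble t s) :
    D.sgn s t = !D.sgn t s :=
  D.sgn_swap h.left_mem h.right_mem h.ne h.eq

variable {Q : Type*} [Quandle Q]

theorem Diagram.IsDouble.step_iff {D : Diagram M} {t s : ℝ} (h : D.IsDouble t s) {V b : Bool}
    (hV : V = true ↔ t ∈ D.upper) (hb : D.sgn t s = b) {f : ℝ → Q} {q : Q} :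
    Step D.Crossing f t q ↔ q = cond V id (act b (f s)) (f t) := by
  cases V with
  | true => exact D.step_over (hV.1 rfl)
  | false =>
    rw [D.step_under h.left_mem h.right_mem h.ne h.eq fun k => by simpa using hV.2 k, hb]
    rfl

theorem Diagram.IsDouble.step_iff' {D : Diagram M} {t s : ℝ} (h : D.IsDouble t s) {V b : Bool}
    (hV : V = true ↔ t ∈ D.upper) (hb : D.sgn t s = b) {f : ℝ → Q} {q : Q} :
    Step D.Crossing f s q ↔ q = cond V (act (!b) (f t)) id (f s) := by
  rw [h.symm.step_iff (h.upper_iff hV) (b := !b) (by rw [h.sgn_swap, hb])]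
  cases V <;> rfl

end Double

/-! ### Recoloring for a kink, a bigon and a triangle. -/

section Local

variable {M : Type*} [TopologicalSpace M] [ChartedSpace Plane M] [OrientedSurface M]
  {Q : Type*} [Quandle Q] {D D' : Diagram M} {B : Set M}

/-- Undoing a change in which no color changes along the strands. -/
theorem AgreeOutside.hasColoring_of_free {ι : Type*} [Finite ι] {S : ι → Strand}
    (h : AgreeOutside D D' (fun i => (S i).set) B)
    (disj : Pairwise fun i j => Disjoint (S i).set (S j).set)
    (hX : ∀ i, Free D.Crossing (S i).d) (hX' : ∀ i, ∀ t ∈ (S i).set, Free D'.Crossing t)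
    (hf : ∀ f : ℝ → Q, IsColoring D.Crossing f → ∀ i, f (S i).d = f (S i).c)
    {x y : Q} (hc : HasColoring D.Crossing x y) : HasColoring D'.Crossing x y := by
  refine h.hasColoring disj hX (fun i t ht k => (k (hX' i t ht)).elim)
    (fun f hcol => ⟨fun i => f (S i).c, fun f' hf' i => ?_⟩) hc
  have k1 := (S i).hcp
  have k2 := (S i).hpq
  have k3 := (S i).hqd
  rw [step_iff_of_free (hX' i _ ⟨k1.le, by linarith⟩),
    step_iff_of_free (hX' i _ ⟨by linarith, k3.le⟩), (hf' i).1, (hf' i).2, hf f hcol i]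
  exact ⟨rfl, rfl⟩

theorem Strand.eq_of_free {S : Strand} (h : ∀ t ∈ S.set, Free D.Crossing t) {f : ℝ → Q}
    (hf : IsColoring D.Crossing f) : f S.d = f S.c := by
  have k1 := S.hcp
  have k2 := S.hpq
  have k3 := S.hqd
  obtain ⟨h1, h2, h3⟩ := Strand.Marks.read (S := S) (fun t ht k => (k (h t ht)).elim) hf
  rw [step_iff_of_free (h _ ⟨k1.le, by linarith⟩)] at h2
  rw [step_iff_of_free (h _ ⟨by linarith, k3.le⟩)] at h3
  rw [h3, h2, h1]

/-- Colorings are unchanged if a kink is introduced along a strand without crossings. -/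
theorem AgreeOutside.hasColoring_kink {S : Strand}
    (h : AgreeOutside D D' (fun _ : Unit => S.set) B)
    (hD : ∀ t ∈ S.set, Free D.Crossing t) (hM : S.Marks D'.Crossing) (hd : Free D'.Crossing S.d)
    (hpq : D'.IsDouble S.p S.q) {x y : Q} :
    HasColoring D.Crossing x y ↔ HasColoring D'.Crossing x y := by
  classical
  have hV : decide (S.p ∈ D'.upper) = true ↔ S.p ∈ D'.upper := decide_eq_true_iff
  constructor
  · refine h.hasColoring (S := fun _ => S) (fun i j hij => (hij rfl).elim) (fun _ => hD _ S.d_mem)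
      (fun _ => hM) fun f hf => ⟨fun _ => f S.c, fun f' hf' i => ?_⟩
    obtain ⟨k1, k2⟩ := hf' i
    rw [hpq.step_iff hV rfl, hpq.step_iff' hV rfl, k1, k2, Strand.eq_of_free hD hf]
    cases decide (S.p ∈ D'.upper) <;> simp [act_self]
  · refine h.symm.hasColoring_of_free (S := fun _ => S) (fun i j hij => (hij rfl).elim)
      (fun _ => hd) (fun _ => hD) fun f hf _ => ?_
    obtain ⟨h1, h2, h3⟩ := hM.read hf
    rw [hpq.step_iff hV rfl] at h2
    rw [hpq.step_iff' hV rfl] at h3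
    revert h2 h3
    cases decide (S.p ∈ D'.upper)
    · intro h2 h3
      rw [h3, ← h1]
      -- Here the over-strand of the kink is the outgoing arc, so the outgoing color is the incoming
      -- one acted on by the outgoing color itself. Idempotence and injectivity make both equal.
      exact (act_injective _ (f S.q) (h2.symm.trans (act_self _ _).symm)).symm
    · intro h2 h3
      have h2 : f S.q = f S.p := h2
      rw [h3, h2, ← h1]
      exact act_self _ _

/-- Colorings are unchanged if a strand is pushed over or under another one. -/
theorem AgreeOutside.hasColoring_bigon {SX SZ : Strand} {r₁ r₂ : ℝ}
    (h : AgreeOutside D D' (fun i => (![SX, SZ] i).set) B)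
    (disj : Disjoint SX.set SZ.set)
    (hX : ∀ t ∈ SX.set, Free D.Crossing t) (hZ : ∀ t ∈ SZ.set, Free D.Crossing t)
    (hMX : SX.Marks D'.Crossing) (hMZ : SZ.Marks D'.Crossing)
    (hdX : Free D'.Crossing SX.d) (hdZ : Free D'.Crossing SZ.d)
    (hr : (SX.p = r₁ ∧ SX.q = r₂) ∨ (SX.p = r₂ ∧ SX.q = r₁))
    (h1 : D'.IsDouble SZ.p r₁) (h2 : D'.IsDouble SZ.q r₂)
    (hsgn : D'.sgn SZ.q r₂ = !D'.sgn SZ.p r₁) (hup : SZ.p ∈ D'.upper ↔ SZ.q ∈ D'.upper) {x y : Q} :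
    HasColoring D.Crossing x y ↔ HasColoring D'.Crossing x y := by
  classical
  obtain ⟨U, hU⟩ : ∃ U : Bool, U = true ↔ SZ.p ∈ D'.upper := ⟨_, decide_eq_true_iff⟩
  have hU' : U = true ↔ SZ.q ∈ D'.upper := hU.trans hup
  have hdisj : Pairwise fun i j => Disjoint (![SX, SZ] i).set (![SX, SZ] j).set := by
    intro i j hij
    fin_cases i <;> fin_cases j
    · exact (hij rfl).elim
    · exact disj
    · exact disj.symm
    · exact (hij rfl).elim
  obtain ⟨b, hb⟩ : ∃ b, D'.sgn SZ.p r₁ = b := ⟨_, rfl⟩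
  rw [hb] at hsgn
  have e1 := fun (f : ℝ → Q) q => h1.step_iff hU hb (f := f) (q := q)
  have e1' := fun (f : ℝ → Q) q => h1.step_iff' hU hb (f := f) (q := q)
  have e2 := fun (f : ℝ → Q) q => h2.step_iff hU' hsgn (f := f) (q := q)
  have e2' := fun (f : ℝ → Q) q => h2.step_iff' hU' hsgn (f := f) (q := q)
  constructor
  · refine h.hasColoring hdisj
      (Fin.forall_fin_two.2 ⟨hX _ SX.d_mem, hZ _ SZ.d_mem⟩)
      (Fin.forall_fin_two.2 ⟨hMX, hMZ⟩) fun f hf => ?_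
    have fX := Strand.eq_of_free hX hf
    have fZ := Strand.eq_of_free hZ hf
    -- The two strands are either parallel or antiparallel.
    rcases hr with ⟨k1, k2⟩ | ⟨k1, k2⟩
    · refine ⟨![cond U (act (!b) (f SZ.c)) id (f SX.c), cond U id (act b (f SX.c)) (f SZ.c)],
        fun f' hf' => ?_⟩
      rw [Fin.forall_fin_two] at hf' ⊢
      obtain ⟨⟨a1, a2⟩, ⟨a3, a4⟩⟩ := hf'
      change f' SX.p = f SX.c at a1
      change f' SX.q = _ at a2
      change f' SZ.p = f SZ.c at a3
      change f' SZ.q = _ at a4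
      change (Step _ _ SX.p _ ∧ Step _ _ SX.q (f SX.d)) ∧
        (Step _ _ SZ.p _ ∧ Step _ _ SZ.q (f SZ.d))
      rw [k1] at a1
      rw [k2] at a2
      rw [k1, k2, e1, e1', e2, e2', a1, a2, a3, a4, fX, fZ]
      cases U <;> simp [act_act_not, act_not_act]
    -- In the antiparallel case `SX` first meets the second crossing of `SZ`, which has the opposite
    -- sign; hence `b` in place of `!b`.
    · refine ⟨![cond U (act b (f SZ.c)) id (f SX.c), cond U id (act b (f SX.c)) (f SZ.c)],
        fun f' hf' => ?_⟩
      rw [Fin.forall_fin_two] at hf' ⊢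
      obtain ⟨⟨a1, a2⟩, ⟨a3, a4⟩⟩ := hf'
      change f' SX.p = f SX.c at a1
      change f' SX.q = _ at a2
      change f' SZ.p = f SZ.c at a3
      change f' SZ.q = _ at a4
      change (Step _ _ SX.p _ ∧ Step _ _ SX.q (f SX.d)) ∧
        (Step _ _ SZ.p _ ∧ Step _ _ SZ.q (f SZ.d))
      rw [k1] at a1
      rw [k2] at a2
      rw [k1, k2, e1, e1', e2, e2', a1, a2, a3, a4, fX, fZ]
      cases U <;> simp [act_not_act]
  · refine h.symm.hasColoring_of_free hdisj (Fin.forall_fin_two.2 ⟨hdX, hdZ⟩)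
      (Fin.forall_fin_two.2 ⟨hX, hZ⟩) fun f hf => ?_
    obtain ⟨x1, x2, x3⟩ := hMX.read hf
    obtain ⟨z1, z2, z3⟩ := hMZ.read hf
    rw [Fin.forall_fin_two]
    change f SX.d = f SX.c ∧ f SZ.d = f SZ.c
    rw [e1] at z2
    rw [e2] at z3
    rcases hr with ⟨k1, k2⟩ | ⟨k1, k2⟩
    · rw [k1, k2, e1'] at x2
      rw [k2, e2'] at x3
      rw [k1] at x1
      cases U <;> simp_all [act_act_not, act_not_act]
    · rw [k1, k2, e2'] at x2
      rw [k2, e1'] at x3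
      rw [k1] at x1
      cases U <;> simp_all [act_not_act]

/-- Three strands of a diagram that cross pairwise, in the order and with the signs given by the
Booleans as in `TriangleEqs`. -/
structure IsTriangle (D : Diagram M) (SX SY SZ : Strand) (o o' r₁ r₂ s₁ s₂ : ℝ)
    (e b₁ b₂ u v w U V : Bool) : Prop where
  px : SX.p = cond v o r₁
  qx : SX.q = cond v r₁ o
  py : SY.p = cond u r₂ o'
  qy : SY.q = cond u o' r₂
  pz : SZ.p = cond w s₁ s₂
  qz : SZ.q = cond w s₂ s₁
  dbl : D.IsDouble o o'
  dbl₁ : D.IsDouble r₁ s₁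
  dbl₂ : D.IsDouble r₂ s₂
  sgn : D.sgn o o' = e
  sgn₁ : D.sgn r₁ s₁ = b₁
  sgn₂ : D.sgn r₂ s₂ = b₂
  upper : V = true ↔ o ∈ D.upper
  upper₁ : (!U) = true ↔ r₁ ∈ D.upper
  upper₂ : (!U) = true ↔ r₂ ∈ D.upper
  marksX : SX.Marks D.Crossing
  marksY : SY.Marks D.Crossing
  marksZ : SZ.Marks D.Crossing

variable {SX SY SZ SX' SY' SZ' : Strand} {o o' r₁ r₂ s₁ s₂ r₁' r₂' s₁' s₂' : ℝ}
  {e b₁ b₂ u v w U V : Bool}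

theorem IsTriangle.steps_iff (h : IsTriangle D SX SY SZ o o' r₁ r₂ s₁ s₂ e b₁ b₂ u v w U V)
    {f : ℝ → Q} {x₂ y₂ z₂ : Q} :
    ((Step D.Crossing f SX.p (f SX.q) ∧ Step D.Crossing f SX.q x₂) ∧
      (Step D.Crossing f SY.p (f SY.q) ∧ Step D.Crossing f SY.q y₂) ∧
      (Step D.Crossing f SZ.p (f SZ.q) ∧ Step D.Crossing f SZ.q z₂)) ↔
    TriangleEqs e b₁ b₂ u v w U V (f SX.p) (f SX.q) x₂ (f SY.p) (f SY.q) y₂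
      (f SZ.p) (f SZ.q) z₂ := by
  have eo := fun q => h.dbl.step_iff h.upper h.sgn (f := f) (q := q)
  have eo' := fun q => h.dbl.step_iff' h.upper h.sgn (f := f) (q := q)
  have e1 := fun q => h.dbl₁.step_iff h.upper₁ h.sgn₁ (f := f) (q := q)
  have e1' := fun q => h.dbl₁.step_iff' h.upper₁ h.sgn₁ (f := f) (q := q)
  have e2 := fun q => h.dbl₂.step_iff h.upper₂ h.sgn₂ (f := f) (q := q)
  have e2' := fun q => h.dbl₂.step_iff' h.upper₂ h.sgn₂ (f := f) (q := q)
  rw [h.px, h.qx, h.py, h.qy, h.pz, h.qz]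
  unfold TriangleEqs TwoSteps
  cases u <;> cases v <;> cases w <;>
    simp only [cond_true, cond_false, eo, eo', e1, e1', e2, e2'] <;> cases U <;> rfl

/-- By `IsTriangle.steps_iff` the coloring equations on both sides are instances of `TriangleEqs`,
and `TriangleEqs.move` supplies the new middle colors for unchanged end colors. Only the direction
from `w = true` to `w = false` is treated; exchanging the first two strands gives the other one. -/
theorem AgreeOutside.hasColoring_triangle
    (h : AgreeOutside D D' (fun i => (![SX', SY', SZ'] i).set) B)
    (hxy : Disjoint SX'.set SY'.set) (hxz : Disjoint SX'.set SZ'.set)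
    (hyz : Disjoint SY'.set SZ'.set)
    (hX : SX.c = SX'.c ∧ SX.d = SX'.d) (hY : SY.c = SY'.c ∧ SY.d = SY'.d)
    (hZ : SZ.c = SZ'.c ∧ SZ.d = SZ'.d)
    (k : IsTriangle D SX SY SZ o o' r₁ r₂ s₁ s₂ e (e != u) (e == v) u v true U V)
    (k' : IsTriangle D' SX' SY' SZ' o o' r₁' r₂' s₁' s₂' e (e != u) (e == v) (!u) (!v) false U V)
    {x y : Q} (hc : HasColoring D.Crossing x y) : HasColoring D'.Crossing x y := by
  have hend : ∀ {S : Strand}, S.Marks D.Crossing → Free D.Crossing S.d := fun {S} hS =>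
    hS.free S.d_mem (by linarith [S.hpq, S.hqd]) S.hqd.ne'
  have hdisj : Pairwise fun i j =>
      Disjoint (![SX', SY', SZ'] i).set (![SX', SY', SZ'] j).set := by
    intro i j hij
    fin_cases i <;> fin_cases j
    all_goals first | exact (hij rfl).elim | assumption | exact Disjoint.symm (by assumption)
  refine h.hasColoring hdisj ?_ ?_ (fun f hf => ?_) hc
  · simp only [Fin.forall_fin_succ]
    exact ⟨hX.2 ▸ hend k.marksX, hY.2 ▸ hend k.marksY, hZ.2 ▸ hend k.marksZ, fun i => i.elim0⟩
  · simp only [Fin.forall_fin_succ]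
    exact ⟨k'.marksX, k'.marksY, k'.marksZ, fun i => i.elim0⟩
  · obtain ⟨x1, x2, x3⟩ := k.marksX.read hf
    obtain ⟨y1, y2, y3⟩ := k.marksY.read hf
    obtain ⟨z1, z2, z3⟩ := k.marksZ.read hf
    have eqs := k.steps_iff.1 ⟨⟨x2, x3⟩, ⟨y2, y3⟩, ⟨z2, z3⟩⟩
    obtain ⟨mx, my, mz, eqs⟩ := eqs.move
    rw [x1, y1, z1, hX.1, hX.2, hY.1, hY.2, hZ.1, hZ.2] at eqs
    refine ⟨![mx, my, mz], fun f' hf' => ?_⟩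
    have hx : f' SX'.p = f SX'.c ∧ f' SX'.q = mx := hf' 0
    have hy : f' SY'.p = f SY'.c ∧ f' SY'.q = my := hf' 1
    have hz : f' SZ'.p = f SZ'.c ∧ f' SZ'.q = mz := hf' 2
    rw [← hx.1, ← hx.2, ← hy.1, ← hy.2, ← hz.1, ← hz.2] at eqs
    obtain ⟨kx, ky, kz⟩ := k'.steps_iff.2 eqs
    rw [hx.2] at kx
    rw [hy.2] at ky
    rw [hz.2] at kz
    simp only [Fin.forall_fin_succ]
    exact ⟨kx, ky, kz, fun i => i.elim0⟩

end Local

end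

section

open Filter Topology OrientedSurface

/-! ### Diagrams in the supporting disk, and the first Reidemeister move. -/

section Disk

variable {M : Type*} [TopologicalSpace M] [ChartedSpace Plane M] {D D' : Diagram M}
  {ψ : Plane → M} {C U : Set ℝ}

namespace Diagram.MeetsDisk

theorem mem_iff (h : D.MeetsDisk ψ C U) {t : ℝ} (ht : t ∈ I) :
    D.γ t ∈ ψ '' Metric.closedBall 0 1 ↔ t ∈ C := by
  rw [← h.1]
  exact ⟨fun k => ⟨ht, k⟩, fun k => k.2⟩

theorem mem_I (h : D.MeetsDisk ψ C U) {t : ℝ} (ht : t ∈ C) : t ∈ I := by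
  rw [← h.1] at ht
  exact ht.1

theorem mem_range (h : D.MeetsDisk ψ C U) {t : ℝ} (ht : t ∈ C) : D.γ t ∈ range ψ :=
  image_subset_range _ _ ((h.mem_iff (h.mem_I ht)).2 ht)

theorem norm_lt (h : D.MeetsDisk ψ C U) (hψ : IsDiskChart ψ) {t : ℝ} (ht : t ∈ U) :
    ‖chartCurve ψ D.γ t‖ < 1 := by
  rw [← h.2] at ht
  obtain ⟨-, p, hp, hpt⟩ := ht
  rw [(chartCurve_eq_iff hψ ⟨p, hpt⟩).2 hpt.symm]
  simpa using hp

theorem norm_eq (h : D.MeetsDisk ψ C U) (hψ : IsDiskChart ψ) {t : ℝ} (ht : t ∈ C) (ht' : t ∉ U) :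
    ‖chartCurve ψ D.γ t‖ = 1 := by
  have hI := h.mem_I ht
  obtain ⟨p, hp, hpt⟩ := (h.mem_iff hI).2 ht
  rw [(chartCurve_eq_iff hψ ⟨p, hpt⟩).2 hpt.symm]
  refine le_antisymm (by simpa using hp) (not_lt.1 fun k => ht' ?_)
  rw [← h.2]
  exact ⟨hI, p, by simpa using k, hpt⟩

theorem partner (h : D.MeetsDisk ψ C U) {t s : ℝ} (hts : D.IsDouble t s) (ht : t ∈ C) : s ∈ C := by
  rw [← h.mem_iff hts.right_mem, ← hts.eq, h.mem_iff hts.left_mem]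
  exact ht

theorem agreeOutside (h : D.MeetsDisk ψ C U) (h' : D'.MeetsDisk ψ C U) {c d : ℝ}
    (hoff : AgreeOff D D' c d) {ι : Type*} {S : ι → Set ℝ} (closed : ∀ i, IsClosed (S i))
    (hC : ∀ t, t ∈ C ↔ ∃ i, t ∈ S i) {i : ι} (hi : Ioo c d ⊆ S i) :
    AgreeOutside D D' S (ψ '' Metric.closedBall 0 1) where
  closed := closed
  meets t ht := (h.mem_iff ht).trans (hC t)
  meets' t ht := (h'.mem_iff ht).trans (hC t)
  agree t ht k := hoff.1 t ⟨ht, fun k' => k i (hi k')⟩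
  upper s hs t ht k k' hst e :=
    hoff.2 s ⟨hs, fun l => k i (hi l)⟩ t ⟨ht, fun l => k' i (hi l)⟩ hst e

end Diagram.MeetsDisk

theorem AgreeOff.symm {c d : ℝ} (h : AgreeOff D D' c d) : AgreeOff D' D c d :=
  ⟨fun t ht => (h.1 t ht).symm, fun s hs t ht hst e =>
    (h.2 s hs t ht hst (by rw [h.1 s hs, h.1 t ht, e])).symm⟩

theorem mem_xAxis_iff (hψ : IsDiskChart ψ) {γ : ℝ → M} {t : ℝ} (ht : γ t ∈ range ψ) :
    γ t ∈ xAxis ψ ↔ chartCurve ψ γ t 1 = 0 := by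
  constructor
  · rintro ⟨p, hp, hpt⟩
    rw [(chartCurve_eq_iff hψ ht).2 hpt.symm]
    exact hp
  · exact fun h => ⟨_, h, chart_chartCurve ht⟩

theorem mem_yAxis_iff (hψ : IsDiskChart ψ) {γ : ℝ → M} {t : ℝ} (ht : γ t ∈ range ψ) :
    γ t ∈ yAxis ψ ↔ chartCurve ψ γ t 0 = 0 := by
  constructor
  · rintro ⟨p, hp, hpt⟩
    rw [(chartCurve_eq_iff hψ ht).2 hpt.symm]
    exact hp
  · exact fun h => ⟨_, h, chart_chartCurve ht⟩

theorem continuousOn_chartCurve_apply (hψ : IsDiskChart ψ) {T : Set ℝ}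
    (hT : ∀ t ∈ T, D.γ t ∈ range ψ) (k : Fin 2) :
    ContinuousOn (fun t => chartCurve ψ D.γ t k) T := fun t ht =>
  (hasDerivAt_chartCurve_apply hψ D.smooth (hT t ht) k).continuousAt.continuousWithinAt

theorem Reidemeister1.hasColoring_iff [OrientedSurface M] {Q : Type*} [Quandle Q]
    (h : Reidemeister1 D D') {x y : Q} :
    HasColoring D.Crossing x y ↔ HasColoring D'.Crossing x y := by
  obtain ⟨ψ, c, d, hψ, hc, hcd, hd, hm, hm', hoff, hinj, s, t, hst, hx⟩ := h
  have hag : AgreeOutside D D' (fun _ : Unit => Icc c d) (ψ '' Metric.closedBall 0 1) :=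
    hm.agreeOutside hm' hoff (fun _ => isClosed_Icc) (fun t => by simp) (i := ())
      Ioo_subset_Icc_self
  have hD : ∀ t ∈ Icc c d, Free D.Crossing t := by
    intro t ht
    by_contra k
    obtain ⟨u, hu⟩ := D.exists_isDouble k
    exact hu.ne (hinj ht (hm.partner hu ht) hu.eq)
  have hD' : ∀ u ∈ Icc c d, ∀ v, D'.IsDouble u v → u = s ∧ v = t ∨ u = t ∧ v = s := by
    intro u hu v huv
    rcases lt_or_gt_of_ne huv.ne with k | k
    · exact Or.inl ((hx u hu v (hm'.partner huv hu) k).1 huv.eq)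
    · exact Or.inr ((hx v (hm'.partner huv hu) u hu k).1 huv.eq.symm).symm
  have hcI : c ∈ Icc c d := ⟨le_rfl, hcd.le⟩
  have hdI : d ∈ Icc c d := ⟨hcd.le, le_rfl⟩
  -- `Reidemeister1` does not require `s` and `t` to lie in `[c, d]`. If one of them does not, the
  -- new strand has no crossing either and nothing changes.
  by_cases hmem : s ∈ Icc c d ∧ t ∈ Icc c d
  · obtain ⟨hs, ht⟩ := hmem
    have hγ : D'.γ s = D'.γ t := (hx s hs t ht hst).2 ⟨rfl, rfl⟩
    have nc := hm'.norm_eq hψ hcI left_notMem_Ioo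
    have nd := hm'.norm_eq hψ hdI right_notMem_Ioo
    -- The start of the strand lies on the boundary circle, so it could coincide only with the other
    -- end; but then the ends would also coincide in `D`, where the strand is simple.
    have hsc : c ≠ s := by
      rintro rfl
      rcases ht.2.eq_or_lt with rfl | k
      · refine hcd.ne (hinj hcI hdI ?_)
        rw [hoff.1 c ⟨hm.mem_I hcI, left_notMem_Ioo⟩, hoff.1 t ⟨hm.mem_I hdI, right_notMem_Ioo⟩, hγ]
      · have := hm'.norm_lt hψ (t := t) ⟨hst, k⟩
        rw [chartCurve, ← hγ] at this
        exact this.ne nc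
    have htd : t ≠ d := by
      rintro rfl
      have := hm'.norm_lt hψ (t := s) ⟨lt_of_le_of_ne hs.1 hsc, hst⟩
      rw [chartCurve, hγ] at this
      exact this.ne nd
    let S : Strand := ⟨c, s, t, d, hc, lt_of_le_of_ne hs.1 hsc, hst, lt_of_le_of_ne ht.2 htd, hd⟩
    have hM : S.Marks D'.Crossing := by
      intro u hu k
      obtain ⟨v, huv⟩ := D'.exists_isDouble k
      exact (hD' u hu v huv).imp And.left And.left
    exact hag.hasColoring_kink (S := S) hD hM (hM.free S.d_mem (hst.trans S.hqd).ne' S.hqd.ne')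
      ⟨hm'.mem_I hs, hm'.mem_I ht, hst.ne, hγ⟩
  · have hfree : ∀ u ∈ Icc c d, Free D'.Crossing u := by
      intro u hu
      by_contra k
      obtain ⟨v, huv⟩ := D'.exists_isDouble k
      have hv := hm'.partner huv hu
      rcases hD' u hu v huv with ⟨rfl, rfl⟩ | ⟨rfl, rfl⟩
      · exact hmem ⟨hu, hv⟩
      · exact hmem ⟨hv, hu⟩
    let S : Strand := ⟨c, c + (d - c) / 3, d - (d - c) / 3, d, hc, by linarith, by linarith,
      by linarith, hd⟩
    constructor
    · exact hag.hasColoring_of_free (S := fun _ => S) (fun i j hij => (hij rfl).elim)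
        (fun _ => hD _ S.d_mem) (fun _ => hfree) fun f hf _ => Strand.eq_of_free (S := S) hD hf
    · exact hag.symm.hasColoring_of_free (S := fun _ => S) (fun i j hij => (hij rfl).elim)
        (fun _ => hfree _ S.d_mem) (fun _ => hD) fun f hf _ => Strand.eq_of_free (S := S) hfree hf

end Disk

/-! ### Signs of crossings with an axis strand. -/

section Signs

variable {M : Type*} [TopologicalSpace M] [ChartedSpace Plane M] [OrientedSurface M]
  {D D' : Diagram M} {ψ : Plane → M} {i j : Fin 2} {a b c s r o o' : ℝ}

/-- The sign of the `i`-th axis followed by the other one, as a basis of the plane. -/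
def axisSign (i : Fin 2) : ℝ := if i = 0 then 1 else -1

theorem axisSign_mul_self (i : Fin 2) : axisSign i * axisSign i = 1 := by
  unfold axisSign
  split_ifs <;> norm_num

theorem det2_eq (hij : i ≠ j) (v w : Plane) : det2 v w = axisSign i * (v i * w j - v j * w i) := by
  have : (i = 0 ∧ j = 1) ∨ (i = 1 ∧ j = 0) := by omega
  rcases this with ⟨rfl, rfl⟩ | ⟨rfl, rfl⟩ <;> simp [det2, axisSign]

theorem Diagram.IsDouble.crossForm_eq {t s : ℝ} (h : D.IsDouble t s) (hψ : IsDiskChart ψ)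
    (ht : D.γ t ∈ range ψ) : crossForm D.γ t s =
      det2 (deriv (chartCurve ψ D.γ) t) (deriv (chartCurve ψ D.γ) s) *
        orientation ψ (chartCurve ψ D.γ t) := by
  have hs : D.γ s ∈ range ψ := h.eq ▸ ht
  exact Knotoids.crossForm_eq hψ.contMDiff (eventually_chart_chartCurve hψ D.smooth.continuous ht)
    (eventually_chart_chartCurve hψ D.smooth.continuous hs)
    ((contDiffAt_chartCurve hψ D.smooth ht).differentiableAt (by simp))
    ((contDiffAt_chartCurve hψ D.smooth hs).differentiableAt (by simp))
    (by simp only [chartCurve, h.eq])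

theorem IsAxisStrand.crossForm_eq (hA : IsAxisStrand ψ D.γ i j a b) (hψ : IsDiskChart ψ)
    (hr : r ∈ Ioo a b) (h : D.IsDouble s r) : crossForm D.γ s r =
      -(axisSign i * deriv (chartCurve ψ D.γ) s j * deriv (chartCurve ψ D.γ) r i *
        orientation ψ (chartCurve ψ D.γ s)) := by
  have hs : D.γ s ∈ range ψ := h.eq ▸ hA.mem_range r (Ioo_subset_Icc_self hr)
  rw [h.crossForm_eq hψ hs, det2_eq hA.ne, hA.deriv_eq_zero r hr]
  ring

theorem IsAxisStrand.deriv_ne_zero (hA : IsAxisStrand ψ D.γ i j a b) (hψ : IsDiskChart ψ)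
    (hr : r ∈ Ioo a b) (h : D.IsDouble s r) : deriv (chartCurve ψ D.γ) s j ≠ 0 := by
  intro k
  apply crossForm_ne_zero D h.left_mem h.right_mem h.ne h.eq
  rw [hA.crossForm_eq hψ hr h, k]
  ring

/-- A strand that starts at `c` on one side of an axis first meets the axis in the direction away
from this side. -/
theorem IsAxisStrand.mul_deriv_neg (hA : IsAxisStrand ψ D.γ i j a b) (hψ : IsDiskChart ψ)
    (hr : r ∈ Ioo a b) (h : D.IsDouble s r) (hcs : c < s)
    (hran : ∀ t ∈ Icc c s, D.γ t ∈ range ψ) (hne : ∀ t ∈ Ico c s, chartCurve ψ D.γ t j ≠ 0) :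
    chartCurve ψ D.γ c j * deriv (chartCurve ψ D.γ) s j < 0 := by
  have hs : D.γ s ∈ range ψ := hran s ⟨hcs.le, le_rfl⟩
  refine mul_deriv_neg_of_first_zero (h := fun t => chartCurve ψ D.γ t j) hcs
    (continuousOn_chartCurve_apply hψ (fun t ht => hran t (Ico_subset_Icc_self ht)) j) hne ?_
    (hasDerivAt_chartCurve_apply hψ D.smooth hs j) (hA.deriv_ne_zero hψ hr h)
  have := hA.apply_eq_zero r (Ioo_subset_Icc_self hr)
  rwa [chartCurve, ← h.eq] at this

theorem IsAxisStrand.mul_deriv_pos {d : ℝ} (hA : IsAxisStrand ψ D.γ i j a b) (hψ : IsDiskChart ψ)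
    (hr : r ∈ Ioo a b) (h : D.IsDouble s r) (hsd : s < d)
    (hran : ∀ t ∈ Icc s d, D.γ t ∈ range ψ) (hne : ∀ t ∈ Ioc s d, chartCurve ψ D.γ t j ≠ 0) :
    0 < chartCurve ψ D.γ d j * deriv (chartCurve ψ D.γ) s j := by
  have hs : D.γ s ∈ range ψ := hran s ⟨le_rfl, hsd.le⟩
  refine mul_deriv_pos_of_last_zero (h := fun t => chartCurve ψ D.γ t j) hsd
    (continuousOn_chartCurve_apply hψ (fun t ht => hran t (Ioc_subset_Icc_self ht)) j) hne ?_
    (hasDerivAt_chartCurve_apply hψ D.smooth hs j) (hA.deriv_ne_zero hψ hr h)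
  have := hA.apply_eq_zero r (Ioo_subset_Icc_self hr)
  rwa [chartCurve, ← h.eq] at this

theorem decide_eq_beq_of_mul_pos {w x t : ℝ} (h : 0 < w * x * t) :
    decide (0 < w) = (decide (0 < x) == decide (0 < t)) := by
  have hw : w ≠ 0 := by rintro rfl; simp at h
  have hx : x ≠ 0 := by rintro rfl; simp at h
  have ht : t ≠ 0 := by rintro rfl; simp at h
  rcases lt_or_gt_of_ne hw with kw | kw <;> rcases lt_or_gt_of_ne hx with kx | kx <;>
    rcases lt_or_gt_of_ne ht with kt | kt <;>
    simp only [kw, kx, kt, kw.not_gt, kx.not_gt, kt.not_gt, decide_true, decide_false] <;>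
    first
    | rfl
    | (exfalso
       have := mul_pos_of_neg_of_neg kw kx
       nlinarith)
    | (exfalso
       have := mul_pos kw kx
       nlinarith)
    | (exfalso
       have := mul_neg_of_neg_of_pos kw kx
       nlinarith)
    | (exfalso
       have := mul_neg_of_pos_of_neg kw kx
       nlinarith)

/-- The product is (ε²)(-A₀A)(BB₀)(KL)C², a product of positive factors. -/
theorem mul_mul_pos_of_pos {A A₀ B B₀ C K L ε : ℝ} (hε : ε * ε = 1) (hA : A₀ * A < 0)
    (hB : 0 < B * B₀) (hC : C ≠ 0) (hK : 0 < K * L) :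
    0 < -(ε * A * B * K) * (ε * (B₀ * C) * L) * (A₀ * C) := by
  have : -(ε * A * B * K) * (ε * (B₀ * C) * L) * (A₀ * C) =
      (ε * ε) * -(A₀ * A) * (B * B₀) * (K * L) * (C * C) := by ring
  rw [this, hε, one_mul]
  have := mul_self_pos.2 hC
  have : 0 < -(A₀ * A) := by linarith
  positivity

/-- A strand starting at `c` meets the axis moving away from its initial side. Its sign therefore
differs from that of the other crossing `o` on the same axis only through that side and the
direction in which the strand through `o'` crosses. The axis keeps its direction, and the chart its
orientation. -/
theorem IsAxisStrand.sgn_eq (hA : IsAxisStrand ψ D.γ i j a b)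
    (hψ : IsDiskChart ψ) (ho : o ∈ Ioo a b) (hoo : D.IsDouble o o')
    (hr : r ∈ Ioo a b) (h : D.IsDouble s r) (hcs : c < s)
    (hran : ∀ t ∈ Icc c s, D.γ t ∈ range ψ) (hne : ∀ t ∈ Ico c s, chartCurve ψ D.γ t j ≠ 0) :
    D.sgn s r = (D.sgn o o' ==
      decide (0 < chartCurve ψ D.γ c j * deriv (chartCurve ψ D.γ) o' j)) := by
  have h1 := hA.mul_deriv_neg hψ hr h hcs hran hne
  have h2 := hA.mono.deriv_mul_pos r hr o ho
  have hd : ∀ t ∈ Ioo a b, deriv (fun t => chartCurve ψ D.γ t i) t =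
      deriv (chartCurve ψ D.γ) t i := fun t ht =>
    (hasDerivAt_chartCurve_apply hψ D.smooth (hA.mem_range t (Ioo_subset_Icc_self ht)) i).deriv
  rw [hd r hr, hd o ho] at h2
  have h3 : deriv (chartCurve ψ D.γ) o' j ≠ 0 := by
    have := hA.deriv_ne_zero hψ ho hoo.symm
    exact this
  have h4 := orientation_mul_pos hψ.contMDiff hψ.mfderiv_injective (chartCurve ψ D.γ s)
    (chartCurve ψ D.γ o)
  refine decide_eq_beq_of_mul_pos ?_
  rw [hA.crossForm_eq hψ hr h, hoo.crossForm_eq hψ (hA.mem_range o (Ioo_subset_Icc_self ho)),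
    det2_eq hA.ne, hA.deriv_eq_zero o ho, zero_mul, sub_zero]
  exact mul_mul_pos_of_pos (axisSign_mul_self i) h1 h2 h3 h4

end Signs

end

section

open Filter Topology OrientedSurface

/-! ### The second Reidemeister move, and the geometry of the third. -/

section Moves

variable {M : Type*} [TopologicalSpace M] [ChartedSpace Plane M] [OrientedSurface M]
  {D D' : Diagram M} {Q : Type*} [Quandle Q]

theorem decide_eq_not_of_mul_neg {x y : ℝ} (h : x * y < 0) :
    decide (0 < y) = !decide (0 < x) := by
  rcases mul_neg_iff.1 h with ⟨k, k'⟩ | ⟨k, k'⟩ <;> simp [k, k', k.not_gt, k'.not_gt]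

theorem Reidemeister2.hasColoring_iff (h : Reidemeister2 D D') {x y : Q} :
    HasColoring D.Crossing x y ↔ HasColoring D'.Crossing x y := by
  obtain ⟨ψ, a, b, c, d, hψ, ha, hab, hb, hc, hcd, hd, hdisj, hm, hm', hoff, hx, hinj, hinj',
    hnot, s₁, hs₁, s₂, hs₂, hne, hiff, hup⟩ := h
  wlog h12 : s₁ < s₂ generalizing s₁ s₂
  · exact this s₂ hs₂ s₁ hs₁ hne.symm (fun t ht => (hiff t ht).trans or_comm) hup.symm
      (lt_of_le_of_ne (not_lt.1 h12) hne.symm)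
  have mX : ∀ {t}, t ∈ Icc a b → t ∈ Icc a b ∪ Icc c d := Or.inl
  have mZ : ∀ {t}, t ∈ Icc c d → t ∈ Icc a b ∪ Icc c d := Or.inr
  have hXZ : ∀ {t}, t ∈ Icc a b → t ∉ Icc c d := fun h h' => hdisj.le_bot ⟨h, h'⟩
  have hac : a ∈ Icc a b := ⟨le_rfl, hab.le⟩
  have hbc : b ∈ Icc a b := ⟨hab.le, le_rfl⟩
  have hcc : c ∈ Icc c d := ⟨le_rfl, hcd.le⟩
  have hdc : d ∈ Icc c d := ⟨hcd.le, le_rfl⟩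
  have nU : ∀ {t}, t ∈ Icc a b → t ∉ Ioo a b → t ∉ Ioo a b ∪ Ioo c d := fun k k' =>
    not_or.2 ⟨k', fun l => hXZ k (Ioo_subset_Icc_self l)⟩
  have offX : ∀ t ∈ Icc a b, D.γ t = D'.γ t := fun t ht =>
    hoff.1 t ⟨hm.mem_I (mX ht), fun k => hXZ ht (Ioo_subset_Icc_self k)⟩
  have hA : IsAxisStrand ψ D'.γ 0 1 a b := by
    refine isAxisStrand D' hψ (by decide) ha hab hb (fun t ht => hm'.mem_range (mX ht))
      (fun t ht => ?_) (hm'.norm_eq hψ (mX hac) (nU hac left_notMem_Ioo))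
      (hm'.norm_eq hψ (mX hbc) (nU hbc right_notMem_Ioo))
    rw [← mem_xAxis_iff hψ (hm'.mem_range (mX ht)), ← offX t ht]
    exact hx t ht
  have hzero : ∀ t ∈ Icc c d, chartCurve ψ D'.γ t 1 = 0 ↔ t = s₁ ∨ t = s₂ := fun t ht => by
    rw [← mem_xAxis_iff hψ (hm'.mem_range (mZ ht)), hiff t ht]
  have hs₁' := Ioo_subset_Icc_self hs₁
  have hs₂' := Ioo_subset_Icc_self hs₂
  obtain ⟨r₁, hr₁, e₁⟩ := hA.exists_meet (hm'.mem_range (mZ hs₁')) (hm'.norm_lt hψ (Or.inr hs₁))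
    ((hzero s₁ hs₁').2 (Or.inl rfl))
  obtain ⟨r₂, hr₂, e₂⟩ := hA.exists_meet (hm'.mem_range (mZ hs₂')) (hm'.norm_lt hψ (Or.inr hs₂))
    ((hzero s₂ hs₂').2 (Or.inr rfl))
  have hr₁' := Ioo_subset_Icc_self hr₁
  have hr₂' := Ioo_subset_Icc_self hr₂
  have d₁ : D'.IsDouble s₁ r₁ := ⟨hm'.mem_I (mZ hs₁'), hm'.mem_I (mX hr₁'),
    fun k => hXZ hr₁' (k ▸ hs₁'), e₁.symm⟩
  have d₂ : D'.IsDouble s₂ r₂ := ⟨hm'.mem_I (mZ hs₂'), hm'.mem_I (mX hr₂'),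
    fun k => hXZ hr₂' (k ▸ hs₂'), e₂.symm⟩
  have hrr : r₁ ≠ r₂ := by
    rintro rfl
    exact hne (hinj' hs₁' hs₂' (e₁.symm.trans e₂))
  -- The moving strand crosses the axis at `s₁` and comes back at `s₂`, so the signs are opposite.
  -- That it begins and ends on the same side is seen in `D`, where it has the same ends and misses
  -- the axis.
  have hsgn : D'.sgn s₂ r₂ = !D'.sgn s₁ r₁ := by
    have k1 := hA.mul_deriv_neg hψ hr₁ d₁ hs₁.1
      (fun t ht => hm'.mem_range (mZ ⟨ht.1, ht.2.trans hs₁.2.le⟩)) fun t ht k => by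
        rcases (hzero t ⟨ht.1, ht.2.le.trans hs₁.2.le⟩).1 k with k | k <;> linarith [ht.2]
    have k2 := hA.mul_deriv_pos hψ hr₂ d₂ hs₂.2
      (fun t ht => hm'.mem_range (mZ ⟨hs₂.1.le.trans ht.1, ht.2⟩)) fun t ht k => by
        rcases (hzero t ⟨hs₂.1.le.trans ht.1.le, ht.2⟩).1 k with k | k <;> linarith [ht.1]
    have k3 := mul_pos_of_forall_ne_zero (h := fun t => chartCurve ψ D.γ t 1) isPreconnected_Icc
      (continuousOn_chartCurve_apply hψ (fun t ht => hm.mem_range (mZ ht)) 1)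
      (fun t ht k => hnot t ht ((mem_xAxis_iff hψ (hm.mem_range (mZ ht))).2 k)) hcc hdc
    have kc : chartCurve ψ D.γ c = chartCurve ψ D'.γ c := by
      rw [chartCurve, hoff.1 c ⟨hm.mem_I (mZ hcc), left_notMem_Ioo⟩, chartCurve]
    have kd : chartCurve ψ D.γ d = chartCurve ψ D'.γ d := by
      rw [chartCurve, hoff.1 d ⟨hm.mem_I (mZ hdc), right_notMem_Ioo⟩, chartCurve]
    rw [kc, kd] at k3
    have k4 := hA.mono.deriv_mul_pos r₁ hr₁ r₂ hr₂
    have hd : ∀ t ∈ Ioo a b, deriv (fun t => chartCurve ψ D'.γ t 0) t =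
        deriv (chartCurve ψ D'.γ) t 0 := fun t ht =>
      (hasDerivAt_chartCurve_apply hψ D'.smooth (hA.mem_range t (Ioo_subset_Icc_self ht)) 0).deriv
    rw [hd r₁ hr₁, hd r₂ hr₂] at k4
    have k5 := orientation_mul_pos hψ.contMDiff hψ.mfderiv_injective (chartCurve ψ D'.γ s₁)
      (chartCurve ψ D'.γ s₂)
    refine decide_eq_not_of_mul_neg ?_
    rw [hA.crossForm_eq hψ hr₁ d₁, hA.crossForm_eq hψ hr₂ d₂]
    generalize deriv (chartCurve ψ D'.γ) s₁ 1 = A₁ at *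
    generalize deriv (chartCurve ψ D'.γ) s₂ 1 = A₂ at *
    generalize deriv (chartCurve ψ D'.γ) r₁ 0 = B₁ at *
    generalize deriv (chartCurve ψ D'.γ) r₂ 0 = B₂ at *
    have e : -(axisSign 0 * A₁ * B₁ * orientation ψ (chartCurve ψ D'.γ s₁)) *
        -(axisSign 0 * A₂ * B₂ * orientation ψ (chartCurve ψ D'.γ s₂)) =
        (axisSign 0 * axisSign 0) * (A₁ * A₂) * (B₁ * B₂) *
          (orientation ψ (chartCurve ψ D'.γ s₁) * orientation ψ (chartCurve ψ D'.γ s₂)) := by ring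
    rw [e, axisSign_mul_self, one_mul]
    have k6 : A₁ * A₂ < 0 := by
      by_contra! k
      have := mul_neg_of_neg_of_pos k1 k2
      nlinarith [mul_nonneg k3.le k]
    exact mul_neg_of_neg_of_pos (mul_neg_of_neg_of_pos k6 k4) k5
  have hX : ∀ t ∈ Icc a b, Free D.Crossing t := by
    intro t ht
    by_contra k
    obtain ⟨u, hu⟩ := D.exists_isDouble k
    rcases hm.partner hu (mX ht) with hu' | hu'
    · exact hu.ne (hA.injOn hab ht hu' (by rw [← offX t ht, ← offX u hu', hu.eq]))
    · exact hnot u hu' (hu.eq ▸ hx t ht)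
  have hZ : ∀ t ∈ Icc c d, Free D.Crossing t := by
    intro t ht
    by_contra k
    obtain ⟨u, hu⟩ := D.exists_isDouble k
    rcases hm.partner hu (mZ ht) with hu' | hu'
    · exact hnot t ht (hu.eq ▸ hx u hu')
    · exact hu.ne (hinj ht hu' hu.eq)
  have meet : ∀ t ∈ Icc a b, ∀ u ∈ Icc c d, D'.γ t = D'.γ u →
      (t = r₁ ∧ u = s₁) ∨ (t = r₂ ∧ u = s₂) := by
    intro t ht u hu htu
    have : D'.γ u ∈ xAxis ψ := by
      rw [← htu, ← offX t ht]
      exact hx t ht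
    rcases (hiff u hu).1 this with rfl | rfl
    · exact Or.inl ⟨hA.injOn hab ht hr₁' (htu.trans e₁.symm), rfl⟩
    · exact Or.inr ⟨hA.injOn hab ht hr₂' (htu.trans e₂.symm), rfl⟩
  have hX' : ∀ t ∈ Icc a b, ¬ Free D'.Crossing t → t = r₁ ∨ t = r₂ := by
    intro t ht k
    obtain ⟨u, hu⟩ := D'.exists_isDouble k
    rcases hm'.partner hu (mX ht) with hu' | hu'
    · exact (hu.ne (hA.injOn hab ht hu' hu.eq)).elim
    · exact (meet t ht u hu' hu.eq).imp And.left And.left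
  have hZ' : ∀ t ∈ Icc c d, ¬ Free D'.Crossing t → t = s₁ ∨ t = s₂ := by
    intro t ht k
    obtain ⟨u, hu⟩ := D'.exists_isDouble k
    rcases hm'.partner hu (mZ ht) with hu' | hu'
    · exact (meet u hu' t ht hu.eq.symm).imp And.right And.right
    · exact (hu.ne (hinj' ht hu' hu.eq)).elim
  let SZ : Strand := ⟨c, s₁, s₂, d, hc, hs₁.1, h12, hs₂.2, hd⟩
  -- The diameter may run in either direction relative to the moving strand, so the order of `r₁`
  -- and `r₂` is not determined.
  obtain ⟨SX, hSX, hr⟩ : ∃ SX : Strand, (SX.c = a ∧ SX.d = b) ∧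
      ((SX.p = r₁ ∧ SX.q = r₂) ∨ (SX.p = r₂ ∧ SX.q = r₁)) := by
    rcases lt_or_gt_of_ne hrr with k | k
    · exact ⟨⟨a, r₁, r₂, b, ha, hr₁.1, k, hr₂.2, hb⟩, ⟨rfl, rfl⟩, Or.inl ⟨rfl, rfl⟩⟩
    · exact ⟨⟨a, r₂, r₁, b, ha, hr₂.1, k, hr₁.2, hb⟩, ⟨rfl, rfl⟩, Or.inr ⟨rfl, rfl⟩⟩
  have hset : SX.set = Icc a b := by rw [Strand.set, hSX.1, hSX.2]
  have hMX : SX.Marks D'.Crossing := by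
    intro t ht k
    rw [hset] at ht
    rcases hr with ⟨k1, k2⟩ | ⟨k1, k2⟩
    · rw [k1, k2]
      exact hX' t ht k
    · rw [k1, k2]
      exact (hX' t ht k).symm
  have hMZ : SZ.Marks D'.Crossing := hZ'
  have hag : AgreeOutside D D' (fun i => (![SX, SZ] i).set) (ψ '' Metric.closedBall 0 1) := by
    refine hm.agreeOutside hm' hoff (fun _ => isClosed_Icc) (fun t => ?_) (i := 1)
      Ioo_subset_Icc_self
    rw [Fin.exists_fin_two]
    change _ ↔ t ∈ SX.set ∨ t ∈ SZ.set
    rw [hset]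
    rfl
  exact hag.hasColoring_bigon (hset ▸ hdisj) (hset ▸ hX) hZ hMX hMZ
    (hMX.free SX.d_mem (by linarith [SX.hpq, SX.hqd]) SX.hqd.ne')
    (hMZ.free SZ.d_mem (h12.trans hs₂.2).ne' hs₂.2.ne') hr d₁ d₂ hsgn hup

/-- All combinatorial data of the triangle are determined by the start `c` of the moving strand and
the directions of the two diameters at the center. Since these are common to both diagrams of the
third move, so are the signs. The axes are `i` and `j` in either order, so that the diagram meeting
the vertical diameter first is covered too. -/
theorem exists_isTriangle {ψ : Plane → M} {i j : Fin 2} {a b a' b' c d o o' s₁ s₂ : ℝ}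
    (hψ : IsDiskChart ψ) (ha : 0 < a) (hb : b < 1) (ha' : 0 < a') (hb' : b' < 1)
    (hc : 0 < c) (hd : d < 1)
    (hXY : Disjoint (Icc a b) (Icc a' b')) (hXZ : Disjoint (Icc a b) (Icc c d))
    (hYZ : Disjoint (Icc a' b') (Icc c d))
    (hA : IsAxisStrand ψ D.γ i j a b) (hB : IsAxisStrand ψ D.γ j i a' b')
    (hran : ∀ t ∈ Icc c d, D.γ t ∈ range ψ) (hnorm : ∀ t ∈ Ioo c d, ‖chartCurve ψ D.γ t‖ < 1)
    (hpartner : ∀ t s, D.IsDouble t s → t ∈ Icc a b ∪ Icc a' b' ∪ Icc c d →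
      s ∈ Icc a b ∪ Icc a' b' ∪ Icc c d)
    (hinj : InjOn D.γ (Icc c d)) (ho : o ∈ Ioo a b) (ho0 : chartCurve ψ D.γ o i = 0)
    (ho' : o' ∈ Ioo a' b') (ho0' : chartCurve ψ D.γ o' j = 0)
    (hs₁ : s₁ ∈ Ioo c d) (hs₂ : s₂ ∈ Ioo c d) (h12 : s₁ < s₂)
    (hz₁ : ∀ t ∈ Icc c d, chartCurve ψ D.γ t j = 0 ↔ t = s₁)
    (hz₂ : ∀ t ∈ Icc c d, chartCurve ψ D.γ t i = 0 ↔ t = s₂)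
    {u v U V : Bool}
    (hu : u = decide (0 < chartCurve ψ D.γ c j * deriv (chartCurve ψ D.γ) o' j))
    (hv : v = decide (0 < chartCurve ψ D.γ c i * deriv (chartCurve ψ D.γ) o i))
    (hU₁ : U = true ↔ s₁ ∈ D.upper) (hU₂ : U = true ↔ s₂ ∈ D.upper) (hV : V = true ↔ o ∈ D.upper) :
    ∃ (SX SY SZ : Strand) (r₁ r₂ : ℝ), (SX.c = a ∧ SX.d = b) ∧ (SY.c = a' ∧ SY.d = b') ∧
      (SZ.c = c ∧ SZ.d = d) ∧ IsTriangle D SX SY SZ o o' r₁ r₂ s₁ s₂ (D.sgn o o')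
        (D.sgn o o' != u) (D.sgn o o' == v) u v true U V := by
  have hab := ho.1.trans ho.2
  have hab' := ho'.1.trans ho'.2
  have I1 : ∀ {t}, t ∈ Icc a b → t ∈ I := fun h => ⟨ha.le.trans h.1, h.2.trans hb.le⟩
  have I2 : ∀ {t}, t ∈ Icc a' b' → t ∈ I := fun h => ⟨ha'.le.trans h.1, h.2.trans hb'.le⟩
  have I3 : ∀ {t}, t ∈ Icc c d → t ∈ I := fun h => ⟨hc.le.trans h.1, h.2.trans hd.le⟩
  have ne1 : ∀ {t s}, t ∈ Icc a b → s ∈ Icc a' b' → t ≠ s := fun h h' e =>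
    hXY.le_bot ⟨h, e ▸ h'⟩
  have ne2 : ∀ {t s}, t ∈ Icc a b → s ∈ Icc c d → t ≠ s := fun h h' e => hXZ.le_bot ⟨h, e ▸ h'⟩
  have ne3 : ∀ {t s}, t ∈ Icc a' b' → s ∈ Icc c d → t ≠ s := fun h h' e => hYZ.le_bot ⟨h, e ▸ h'⟩
  have hs₁' := Ioo_subset_Icc_self hs₁
  have hs₂' := Ioo_subset_Icc_self hs₂
  have hoI := Ioo_subset_Icc_self ho
  have hoI' := Ioo_subset_Icc_self ho'
  obtain ⟨r₁, hr₁, e₁⟩ := hA.exists_meet (hran s₁ hs₁') (hnorm s₁ hs₁) ((hz₁ s₁ hs₁').2 rfl)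
  obtain ⟨r₂, hr₂, e₂⟩ := hB.exists_meet (hran s₂ hs₂') (hnorm s₂ hs₂) ((hz₂ s₂ hs₂').2 rfl)
  have hr₁' := Ioo_subset_Icc_self hr₁
  have hr₂' := Ioo_subset_Icc_self hr₂
  have d₁ : D.IsDouble s₁ r₁ := ⟨I3 hs₁', I1 hr₁', (ne2 hr₁' hs₁').symm, e₁.symm⟩
  have d₂ : D.IsDouble s₂ r₂ := ⟨I3 hs₂', I2 hr₂', (ne3 hr₂' hs₂').symm, e₂.symm⟩
  have eo : D.γ o = D.γ o' := by
    rw [← chart_chartCurve (hA.mem_range o hoI), ← chart_chartCurve (hB.mem_range o' hoI'),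
      plane_ext hA.ne (ho0.trans (hB.apply_eq_zero o' hoI').symm)
        ((hA.apply_eq_zero o hoI).trans ho0'.symm)]
  have do_ : D.IsDouble o o' := ⟨I1 hoI, I2 hoI', ne1 hoI hoI', eo⟩
  have ran₁ : ∀ {s}, s ∈ Ioo c d → ∀ t ∈ Icc c s, D.γ t ∈ range ψ := fun hs t ht =>
    hran t ⟨ht.1, ht.2.trans hs.2.le⟩
  have nz₁ : ∀ t ∈ Ico c s₁, chartCurve ψ D.γ t j ≠ 0 := fun t ht k =>
    ht.2.ne ((hz₁ t ⟨ht.1, ht.2.le.trans hs₁.2.le⟩).1 k)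
  have nz₂ : ∀ t ∈ Ico c s₂, chartCurve ψ D.γ t i ≠ 0 := fun t ht k =>
    ht.2.ne ((hz₂ t ⟨ht.1, ht.2.le.trans hs₂.2.le⟩).1 k)
  have g₁ := hA.sgn_eq hψ ho do_ hr₁ d₁ hs₁.1 (ran₁ hs₁) nz₁
  have g₂ := hB.sgn_eq hψ ho' do_.symm hr₂ d₂ hs₂.1 (ran₁ hs₂) nz₂
  rw [← hu] at g₁
  rw [← hv, do_.sgn_swap] at g₂
  have hdA : deriv (fun t => chartCurve ψ D.γ t i) o = deriv (chartCurve ψ D.γ) o i :=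
    (hasDerivAt_chartCurve_apply hψ D.smooth (hA.mem_range o hoI) i).deriv
  have hdB : deriv (fun t => chartCurve ψ D.γ t j) o' = deriv (chartCurve ψ D.γ) o' j :=
    (hasDerivAt_chartCurve_apply hψ D.smooth (hB.mem_range o' hoI') j).deriv
  have pX := hA.mono.mul_deriv_pos_iff hr₁' ho ho0
  have pY := hB.mono.mul_deriv_pos_iff hr₂' ho' ho0'
  rw [hdA] at pX
  rw [hdB] at pY
  have c₁ : chartCurve ψ D.γ r₁ = chartCurve ψ D.γ s₁ := by rw [chartCurve, e₁, chartCurve]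
  have c₂ : chartCurve ψ D.γ r₂ = chartCurve ψ D.γ s₂ := by rw [chartCurve, e₂, chartCurve]
  rw [c₁] at pX
  rw [c₂] at pY
  -- Before `s₂` the moving strand has not met the second diameter. So it meets the first one on the
  -- side of the center on which it started, which decides the order of `o` and `r₁`.
  have hvX : (v = true ↔ o < r₁) ∧ o ≠ r₁ := by
    have k := mul_pos_of_forall_ne_zero (h := fun t => chartCurve ψ D.γ t i) isPreconnected_Ico
      (continuousOn_chartCurve_apply hψ (fun t ht => ran₁ hs₂ t (Ico_subset_Icc_self ht)) i) nz₂
      (x := c) (y := s₁) ⟨le_rfl, hs₂.1⟩ ⟨hs₁.1.le, h12⟩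
    refine ⟨?_, ?_⟩
    · have k' : 0 < chartCurve ψ D.γ s₁ i * chartCurve ψ D.γ s₁ i :=
        mul_self_pos.2 (nz₂ s₁ ⟨hs₁.1.le, h12⟩)
      rw [hv, decide_eq_true_iff, ← pX,
        ← mul_pos_iff_of_pos_left k' (b := chartCurve ψ D.γ c i * deriv (chartCurve ψ D.γ) o i),
        ← mul_pos_iff_of_pos_left k (b := chartCurve ψ D.γ s₁ i * deriv (chartCurve ψ D.γ) o i)]
      exact iff_of_eq (congrArg _ (by ring))
    · rintro rfl
      rw [c₁] at ho0
      simp [ho0] at k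
  -- At `s₁` the moving strand changes sides of the first diameter. So it meets the second one on
  -- the side opposite to its start, which decides the order of `r₂` and `o'`.
  have huY : (u = true ↔ r₂ < o') ∧ r₂ ≠ o' := by
    have k1 := hA.mul_deriv_neg hψ hr₁ d₁ hs₁.1 (ran₁ hs₁) nz₁
    have k2 := hA.mul_deriv_pos hψ hr₁ d₁ h12
      (fun t ht => hran t ⟨hs₁.1.le.trans ht.1, ht.2.trans hs₂.2.le⟩) fun t ht k =>
        ht.1.ne' ((hz₁ t ⟨hs₁.1.le.trans ht.1.le, ht.2.trans hs₂.2.le⟩).1 k)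
    have k : chartCurve ψ D.γ c j * chartCurve ψ D.γ s₂ j < 0 := by
      by_contra! k
      nlinarith [mul_neg_of_neg_of_pos k1 k2, mul_self_nonneg (deriv (chartCurve ψ D.γ) s₁ j),
        mul_nonneg k (mul_self_nonneg (deriv (chartCurve ψ D.γ) s₁ j))]
    have hne : r₂ ≠ o' := by
      rintro rfl
      rw [c₂] at ho0'
      simp [ho0'] at k
    refine ⟨?_, hne⟩
    have k3 : deriv (chartCurve ψ D.γ) o' j ≠ 0 := hA.deriv_ne_zero hψ ho do_.symm
    have k4 : (chartCurve ψ D.γ c j * deriv (chartCurve ψ D.γ) o' j) *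
        (chartCurve ψ D.γ s₂ j * deriv (chartCurve ψ D.γ) o' j) < 0 := by
      have := mul_neg_of_neg_of_pos k (mul_self_pos.2 k3)
      linarith
    rw [hu, decide_eq_true_iff]
    constructor
    · intro l
      refine lt_of_le_of_ne (not_lt.1 fun l' => ?_) hne
      exact (mul_pos l (pY.2 l')).not_gt k4
    · intro l
      by_contra l'
      have : ¬ 0 < chartCurve ψ D.γ s₂ j * deriv (chartCurve ψ D.γ) o' j := fun k =>
        l.not_gt (pY.1 k)
      nlinarith [mul_nonneg_of_nonpos_of_nonpos (not_lt.1 l') (not_lt.1 this)]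
  obtain ⟨SX, hSX, px, qx⟩ : ∃ SX : Strand, (SX.c = a ∧ SX.d = b) ∧ SX.p = cond v o r₁ ∧
      SX.q = cond v r₁ o := by
    cases v
    · exact ⟨⟨a, r₁, o, b, ha, hr₁.1,
        lt_of_le_of_ne (not_lt.1 fun k => by simpa using hvX.1.2 k) hvX.2.symm, ho.2, hb⟩,
        ⟨rfl, rfl⟩, rfl, rfl⟩
    · exact ⟨⟨a, o, r₁, b, ha, ho.1, hvX.1.1 rfl, hr₁.2, hb⟩, ⟨rfl, rfl⟩, rfl, rfl⟩
  obtain ⟨SY, hSY, py, qy⟩ : ∃ SY : Strand, (SY.c = a' ∧ SY.d = b') ∧ SY.p = cond u r₂ o' ∧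
      SY.q = cond u o' r₂ := by
    cases u
    · exact ⟨⟨a', o', r₂, b', ha', ho'.1,
        lt_of_le_of_ne (not_lt.1 fun k => by simpa using huY.1.2 k) huY.2.symm, hr₂.2, hb'⟩,
        ⟨rfl, rfl⟩, rfl, rfl⟩
    · exact ⟨⟨a', r₂, o', b', ha', hr₂.1, huY.1.1 rfl, ho'.2, hb'⟩, ⟨rfl, rfl⟩, rfl, rfl⟩
  have meetXY : ∀ t ∈ Icc a b, ∀ s ∈ Icc a' b', D.γ t = D.γ s → t = o ∧ s = o' := by
    intro t ht s hs hts
    have e : chartCurve ψ D.γ t = chartCurve ψ D.γ s := by rw [chartCurve, hts, chartCurve]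
    have l1 : chartCurve ψ D.γ t i = chartCurve ψ D.γ o i := by
      rw [e, hB.apply_eq_zero s hs, ho0]
    have l2 : chartCurve ψ D.γ s j = chartCurve ψ D.γ o' j := by
      rw [← e, hA.apply_eq_zero t ht, ho0']
    exact ⟨hA.mono.injOn hab ht hoI l1, hB.mono.injOn hab' hs hoI' l2⟩
  have meetXZ : ∀ t ∈ Icc a b, ∀ s ∈ Icc c d, D.γ t = D.γ s → t = r₁ ∧ s = s₁ := by
    intro t ht s hs hts
    have e : chartCurve ψ D.γ t = chartCurve ψ D.γ s := by rw [chartCurve, hts, chartCurve]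
    have l : s = s₁ := (hz₁ s hs).1 (by rw [← e, hA.apply_eq_zero t ht])
    exact ⟨hA.injOn hab ht hr₁' (by rw [hts, l, e₁]), l⟩
  have meetYZ : ∀ t ∈ Icc a' b', ∀ s ∈ Icc c d, D.γ t = D.γ s → t = r₂ ∧ s = s₂ := by
    intro t ht s hs hts
    have e : chartCurve ψ D.γ t = chartCurve ψ D.γ s := by rw [chartCurve, hts, chartCurve]
    have l : s = s₂ := (hz₂ s hs).1 (by rw [← e, hB.apply_eq_zero t ht])
    exact ⟨hB.injOn hab' ht hr₂' (by rw [hts, l, e₂]), l⟩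
  refine ⟨SX, SY, ⟨c, s₁, s₂, d, hc, hs₁.1, h12, hs₂.2, hd⟩, r₁, r₂, hSX, hSY, ⟨rfl, rfl⟩,
    ⟨px, qx, py, qy, rfl, rfl, do_, d₁.symm, d₂.symm, rfl, ?_, ?_, hV, d₁.upper_iff hU₁,
      d₂.upper_iff hU₂, ?_, ?_, ?_⟩⟩
  · rw [d₁.sgn_swap, g₁]
    cases D.sgn o o' <;> cases u <;> rfl
  · rw [d₂.sgn_swap, g₂]
    cases D.sgn o o' <;> cases v <;> rfl
  · intro t ht k
    rw [Strand.set, hSX.1, hSX.2] at ht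
    have : t = o ∨ t = r₁ := by
      obtain ⟨s, hs⟩ := D.exists_isDouble k
      rcases hpartner t s hs (Or.inl (Or.inl ht)) with (h | h) | h
      · exact (hs.ne (hA.injOn hab ht h hs.eq)).elim
      · exact Or.inl (meetXY t ht s h hs.eq).1
      · exact Or.inr (meetXZ t ht s h hs.eq).1
    rw [px, qx]
    cases v
    · exact this.symm
    · exact this
  · intro t ht k
    rw [Strand.set, hSY.1, hSY.2] at ht
    have : t = r₂ ∨ t = o' := by
      obtain ⟨s, hs⟩ := D.exists_isDouble k
      rcases hpartner t s hs (Or.inl (Or.inr ht)) with (h | h) | h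
      · exact Or.inr (meetXY s h t ht hs.eq.symm).2
      · exact (hs.ne (hB.injOn hab' ht h hs.eq)).elim
      · exact Or.inl (meetYZ t ht s h hs.eq).1
    rw [py, qy]
    cases u
    · exact this.symm
    · exact this
  · intro t ht k
    obtain ⟨s, hs⟩ := D.exists_isDouble k
    rcases hpartner t s hs (Or.inr ht) with (h | h) | h
    · exact Or.inl (meetXZ s h t ht hs.eq.symm).2
    · exact Or.inr (meetYZ s h t ht hs.eq.symm).2
    · exact (hs.ne (hinj ht h hs.eq)).elim

end Moves

end

section

open Filter Topology OrientedSurface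

/-! ### The third Reidemeister move and the invariance of end colors. -/

section Invariance

theorem Strand.set_eq {S : Strand} {p q : ℝ} (h : S.c = p ∧ S.d = q) : S.set = Icc p q := by
  rw [Strand.set, h.1, h.2]

theorem exists_mem_strands {S T R : Strand} {t : ℝ} :
    (∃ i, t ∈ (![S, T, R] i).set) ↔ (t ∈ S.set ∨ t ∈ T.set) ∨ t ∈ R.set := by
  simp [Fin.exists_fin_succ, or_assoc]

variable {M : Type*} [TopologicalSpace M] [ChartedSpace Plane M] [OrientedSurface M]
  {D D' : Diagram M} {Q : Type*} [Quandle Q]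

theorem IsTriangle.swap {SX SY SZ : Strand} {o o' r₁ r₂ s₁ s₂ : ℝ} {e b₁ b₂ u v w U V : Bool}
    (h : IsTriangle D SX SY SZ o o' r₁ r₂ s₁ s₂ e b₁ b₂ u v w U V) :
    IsTriangle D SY SX SZ o' o r₂ r₁ s₂ s₁ (!e) b₂ b₁ (!v) (!u) (!w) U (!V) where
  px := by rw [h.py]; cases u <;> rfl
  qx := by rw [h.qy]; cases u <;> rfl
  py := by rw [h.px]; cases v <;> rfl
  qy := by rw [h.qx]; cases v <;> rfl
  pz := by rw [h.pz]; cases w <;> rfl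
  qz := by rw [h.qz]; cases w <;> rfl
  dbl := h.dbl.symm
  dbl₁ := h.dbl₂
  dbl₂ := h.dbl₁
  sgn := by rw [h.dbl.sgn_swap, h.sgn]
  sgn₁ := h.sgn₂
  sgn₂ := h.sgn₁
  upper := h.dbl.upper_iff h.upper
  upper₁ := h.upper₂
  upper₂ := h.upper₁
  marksX := h.marksY
  marksY := h.marksX
  marksZ := h.marksZ

theorem Reidemeister3.hasColoring_iff (h : Reidemeister3 D D') {x y : Q} :
    HasColoring D.Crossing x y ↔ HasColoring D'.Crossing x y := by
  obtain ⟨ψ, a, b, a', b', c, d, hψ, ha, hab, hb, ha', hab', hb', hc, hcd, hd, hXY, hXZ, hYZ,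
    hm, hm', hoff, hx, hy, hinj, hinj', s₁, hs₁, s₂, hs₂, s₁', hs₁', s₂', hs₂', h12, h12',
    hz, hz', hup, hup₁, hup₂⟩ := h
  have mX : ∀ {t}, t ∈ Icc a b → t ∈ Icc a b ∪ Icc a' b' ∪ Icc c d := fun h => Or.inl (Or.inl h)
  have mY : ∀ {t}, t ∈ Icc a' b' → t ∈ Icc a b ∪ Icc a' b' ∪ Icc c d := fun h => Or.inl (Or.inr h)
  have mZ : ∀ {t}, t ∈ Icc c d → t ∈ Icc a b ∪ Icc a' b' ∪ Icc c d := Or.inr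
  have nXY : ∀ {t}, t ∈ Icc a b → t ∉ Icc a' b' := fun h h' => hXY.le_bot ⟨h, h'⟩
  have nXZ : ∀ {t}, t ∈ Icc a b → t ∉ Icc c d := fun h h' => hXZ.le_bot ⟨h, h'⟩
  have nYZ : ∀ {t}, t ∈ Icc a' b' → t ∉ Icc c d := fun h h' => hYZ.le_bot ⟨h, h'⟩
  have sub : ∀ {p q t : ℝ}, t ∈ Ioo p q → t ∈ Icc p q := fun h => Ioo_subset_Icc_self h
  have nUX : ∀ {t}, t ∈ Icc a b → t ∉ Ioo a b → t ∉ Ioo a b ∪ Ioo a' b' ∪ Ioo c d := by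
    rintro t k k' ((l | l) | l)
    exacts [k' l, nXY k (sub l), nXZ k (sub l)]
  have nUY : ∀ {t}, t ∈ Icc a' b' → t ∉ Ioo a' b' → t ∉ Ioo a b ∪ Ioo a' b' ∪ Ioo c d := by
    rintro t k k' ((l | l) | l)
    exacts [nXY (sub l) k, k' l, nYZ k (sub l)]
  have axis : ∀ E : Diagram M, E.MeetsDisk ψ (Icc a b ∪ Icc a' b' ∪ Icc c d)
      (Ioo a b ∪ Ioo a' b' ∪ Ioo c d) → (∀ t ∈ Icc a b, E.γ t ∈ xAxis ψ) →
      (∀ t ∈ Icc a' b', E.γ t ∈ yAxis ψ) →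
      IsAxisStrand ψ E.γ 0 1 a b ∧ IsAxisStrand ψ E.γ 1 0 a' b' := by
    intro E hE hEx hEy
    refine ⟨isAxisStrand E hψ (by decide) ha hab hb (fun t ht => hE.mem_range (mX ht))
      (fun t ht => (mem_xAxis_iff hψ (hE.mem_range (mX ht))).1 (hEx t ht))
      (hE.norm_eq hψ (mX (left_mem_Icc.2 hab.le)) (nUX (left_mem_Icc.2 hab.le) left_notMem_Ioo))
      (hE.norm_eq hψ (mX (right_mem_Icc.2 hab.le)) (nUX (right_mem_Icc.2 hab.le) right_notMem_Ioo)),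
      isAxisStrand E hψ (by decide) ha' hab' hb' (fun t ht => hE.mem_range (mY ht))
      (fun t ht => (mem_yAxis_iff hψ (hE.mem_range (mY ht))).1 (hEy t ht))
      (hE.norm_eq hψ (mY (left_mem_Icc.2 hab'.le)) (nUY (left_mem_Icc.2 hab'.le) left_notMem_Ioo))
      (hE.norm_eq hψ (mY (right_mem_Icc.2 hab'.le))
        (nUY (right_mem_Icc.2 hab'.le) right_notMem_Ioo))⟩
  have eqOff : ∀ t ∈ I, t ∉ Ioo c d → D.γ t = D'.γ t := fun t ht ht' => hoff.1 t ⟨ht, ht'⟩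
  have eqX : ∀ t ∈ Icc a b, D.γ t = D'.γ t := fun t ht =>
    eqOff t (hm.mem_I (mX ht)) fun k => nXZ ht (sub k)
  have eqY : ∀ t ∈ Icc a' b', D.γ t = D'.γ t := fun t ht =>
    eqOff t (hm.mem_I (mY ht)) fun k => nYZ ht (sub k)
  obtain ⟨hA, hB⟩ := axis D hm hx hy
  obtain ⟨hA', hB'⟩ := axis D' hm' (fun t ht => eqX t ht ▸ hx t ht) (fun t ht => eqY t ht ▸ hy t ht)
  obtain ⟨o, ho, ho0⟩ := hA.exists_eq 0 (by simp)
  obtain ⟨o', ho', ho0'⟩ := hB.exists_eq 0 (by simp)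
  have chartEq : ∀ {t}, D.γ t = D'.γ t → chartCurve ψ D.γ t = chartCurve ψ D'.γ t := fun h => by
    rw [chartCurve, h, chartCurve]
  have derivX : deriv (chartCurve ψ D.γ) o = deriv (chartCurve ψ D'.γ) o := by
    refine EventuallyEq.deriv_eq ?_
    filter_upwards [Icc_mem_nhds ho.1 ho.2] with t ht using chartEq (eqX t ht)
  have derivY : deriv (chartCurve ψ D.γ) o' = deriv (chartCurve ψ D'.γ) o' := by
    refine EventuallyEq.deriv_eq ?_
    filter_upwards [Icc_mem_nhds ho'.1 ho'.2] with t ht using chartEq (eqY t ht)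
  have hcm : c ∈ Icc c d := left_mem_Icc.2 hcd.le
  have chartC := chartEq (eqOff c (hm.mem_I (mZ hcm)) left_notMem_Ioo)
  have hoo : D.IsDouble o o' := by
    refine ⟨hm.mem_I (mX (sub ho)), hm.mem_I (mY (sub ho')), fun k => nXY (sub ho) (k ▸ sub ho'), ?_⟩
    rw [← chart_chartCurve (hA.mem_range o (sub ho)), ← chart_chartCurve (hB.mem_range o' (sub ho')),
      plane_ext hA.ne (ho0.trans (hB.apply_eq_zero o' (sub ho')).symm)
        ((hA.apply_eq_zero o (sub ho)).trans ho0'.symm)]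
  have hoo' : D'.IsDouble o o' := ⟨hoo.left_mem, hoo.right_mem, hoo.ne, by
    rw [← eqX o (sub ho), ← eqY o' (sub ho'), hoo.eq]⟩
  have upo : o ∈ D.upper ↔ o ∈ D'.upper :=
    hoff.2 o ⟨hoo.left_mem, fun k => nXZ (sub ho) (sub k)⟩ o'
      ⟨hoo.right_mem, fun k => nYZ (sub ho') (sub k)⟩ hoo.ne hoo.eq
  have sgno : D.sgn o o' = D'.sgn o o' := by
    have e1 : D.γ =ᶠ[𝓝 o] D'.γ := by
      filter_upwards [Icc_mem_nhds ho.1 ho.2] with t ht using eqX t ht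
    have e2 : D.γ =ᶠ[𝓝 o'] D'.γ := by
      filter_upwards [Icc_mem_nhds ho'.1 ho'.2] with t ht using eqY t ht
    rw [Diagram.sgn, Diagram.sgn, crossForm_congr e1 e2]
  classical
  obtain ⟨U, hU⟩ : ∃ U : Bool, U = true ↔ s₁ ∈ D.upper := ⟨_, decide_eq_true_iff⟩
  obtain ⟨V, hV⟩ : ∃ V : Bool, V = true ↔ o ∈ D.upper := ⟨_, decide_eq_true_iff⟩
  obtain ⟨u, hu⟩ : ∃ u, u = decide (0 < chartCurve ψ D.γ c 1 * deriv (chartCurve ψ D.γ) o' 1) :=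
    ⟨_, rfl⟩
  obtain ⟨v, hv⟩ : ∃ v, v = decide (0 < chartCurve ψ D.γ c 0 * deriv (chartCurve ψ D.γ) o 0) :=
    ⟨_, rfl⟩
  have hV' := hoo'.upper_iff (hV.trans upo)
  obtain ⟨SX, SY, SZ, r₁, r₂, hSX, hSY, hSZ, T⟩ := exists_isTriangle hψ ha hb ha' hb' hc hd hXY hXZ
    hYZ hA hB (fun t ht => hm.mem_range (mZ ht)) (fun t ht => hm.norm_lt hψ (Or.inr ht))
    (fun t s hts ht => hm.partner hts ht) hinj ho ho0 ho' ho0' hs₁ hs₂ h12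
    (fun t ht => by rw [← mem_xAxis_iff hψ (hm.mem_range (mZ ht)), (hz t ht).1])
    (fun t ht => by rw [← mem_yAxis_iff hψ (hm.mem_range (mZ ht)), (hz t ht).2])
    hu hv hU (hU.trans hup) hV
  -- In `D'` the moving strand meets the vertical diameter first, so the axes and the flags `u`, `v`
  -- exchange their roles. Swapping back negates both flags, which is the reversal of order demanded
  -- by `TriangleEqs.move`.
  obtain ⟨SY', SX', SZ', r₂', r₁', hSY', hSX', hSZ', T'⟩ := exists_isTriangle (D := D')
    (u := v) (v := u) hψ ha' hb'
    ha hb hc hd hXY.symm hYZ hXZ hB' hA' (fun t ht => hm'.mem_range (mZ ht))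
    (fun t ht => hm'.norm_lt hψ (Or.inr ht))
    (fun t s hts ht => by
      have := hm'.partner hts (by rwa [union_comm (Icc a b)])
      rwa [union_comm (Icc a' b')])
    hinj' ho' (chartEq (eqY o' (sub ho')) ▸ ho0')
    ho (chartEq (eqX o (sub ho)) ▸ ho0) hs₂' hs₁' h12'
    (fun t ht => by rw [← mem_yAxis_iff hψ (hm'.mem_range (mZ ht)), (hz' t ht).2])
    (fun t ht => by rw [← mem_xAxis_iff hψ (hm'.mem_range (mZ ht)), (hz' t ht).1])
    (by rw [hv, chartC, derivX]) (by rw [hu, chartC, derivY]) (hU.trans hup₂) (hU.trans hup₁) hV'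
  rw [hoo'.sgn_swap, ← sgno] at T'
  have e1 : ((!D.sgn o o') != v) = (D.sgn o o' == v) := by cases D.sgn o o' <;> cases v <;> rfl
  have e2 : ((!D.sgn o o') == u) = (D.sgn o o' != u) := by cases D.sgn o o' <;> cases u <;> rfl
  have T'' := T'.swap
  rw [e1, e2, Bool.not_not, Bool.not_not] at T''
  have T₂ := T.swap
  rw [← e1, ← e2] at T₂
  have disj : ∀ {S T : Strand} {p q p' q' : ℝ}, S.c = p ∧ S.d = q → T.c = p' ∧ T.d = q' →
      Disjoint (Icc p q) (Icc p' q') → Disjoint S.set T.set := fun h h' k => by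
    rwa [Strand.set_eq h, Strand.set_eq h']
  have ends : ∀ {S T : Strand} {p q : ℝ}, S.c = p ∧ S.d = q → T.c = p ∧ T.d = q →
      S.c = T.c ∧ S.d = T.d := fun h h' => ⟨h.1.trans h'.1.symm, h.2.trans h'.2.symm⟩
  constructor
  · have hag : AgreeOutside D D' (fun i => (![SX', SY', SZ'] i).set)
        (ψ '' Metric.closedBall 0 1) := by
      refine hm.agreeOutside hm' hoff (fun _ => isClosed_Icc) (fun t => ?_) (i := 2) ?_
      · rw [exists_mem_strands, Strand.set_eq hSX', Strand.set_eq hSY', Strand.set_eq hSZ']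
        rfl
      · exact Ioo_subset_Icc_self.trans (Strand.set_eq hSZ').ge
    exact hag.hasColoring_triangle (disj hSX' hSY' hXY) (disj hSX' hSZ' hXZ) (disj hSY' hSZ' hYZ)
      (ends hSX hSX') (ends hSY hSY') (ends hSZ hSZ') T T''
  · have hag : AgreeOutside D' D (fun i => (![SY, SX, SZ] i).set)
        (ψ '' Metric.closedBall 0 1) := by
      refine hm'.agreeOutside hm hoff.symm (fun _ => isClosed_Icc) (fun t => ?_) (i := 2) ?_
      · rw [exists_mem_strands, Strand.set_eq hSX, Strand.set_eq hSY, Strand.set_eq hSZ,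
            or_comm (a := t ∈ Icc a' b')]
        rfl
      · exact Ioo_subset_Icc_self.trans (Strand.set_eq hSZ).ge
    exact hag.hasColoring_triangle (disj hSY hSX hXY.symm) (disj hSY hSZ hYZ) (disj hSX hSZ hXZ)
      (ends hSY' hSY) (ends hSX' hSX) (ends hSZ' hSZ) T' T₂

theorem Move.hasColoring_iff (h : Move D D') {x y : Q} :
    HasColoring D.Crossing x y ↔ HasColoring D'.Crossing x y := by
  rcases h with h | h | h | h
  · exact h.hasColoring_iff
  · exact h.hasColoring_iff
  · exact h.hasColoring_iff
  · exact h.hasColoring_iff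

/-- The pairs of end colors of quandle colorings are a knotoid invariant. -/
theorem hasColoring_iff_of_knotoid_eq (h : D.knotoid = D'.knotoid) {x y : Q} :
    HasColoring D.Crossing x y ↔ HasColoring D'.Crossing x y := by
  have h' : Relation.EqvGen Move D D' := Quotient.exact h
  clear h
  induction h' with
  | rel _ _ h => exact h.hasColoring_iff
  | refl _ => exact Iff.rfl
  | symm _ _ _ ih => exact ih.symm
  | trans _ _ _ _ _ ih ih' => exact ih.trans ih'

end Invariance

end

section

open Filter Topology OrientedSurface

/-! ### The plane and the sphere as oriented surfaces. -/

section Surfaces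

theorem det2_ne_zero {v w : Plane} (h : LinearIndependent ℝ ![v, w]) : det2 v w ≠ 0 := by
  rw [LinearIndependent.pair_iff] at h
  intro hdet
  unfold det2 at hdet
  have key : ∀ i, v i = 0 := by
    intro i
    have := h (w i) (-v i) (by
      ext k
      fin_cases i <;> fin_cases k <;> simp <;> linarith)
    linarith [this.2]
  have hv : v = 0 := by
    ext i
    exact key i
  simpa using (h 1 0 (by simp [hv])).1

/-- Let n be the cross product of `v` and `w`. Orthogonality of `p` to `v` and `w` gives p × n = 0,
and a vanishing triple product gives p · n = 0; as `p` is nonzero, n = 0, against independence. -/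
theorem det3_ne_zero {p v w : Space3} (hp : p ≠ 0) (hv : inner ℝ p v = 0) (hw : inner ℝ p w = 0)
    (h : LinearIndependent ℝ ![v, w]) : det3 p v w ≠ 0 := by
  rw [LinearIndependent.pair_iff] at h
  intro hdet
  have hp' : 0 < p 0 ^ 2 + p 1 ^ 2 + p 2 ^ 2 := by
    have := sq_pos_of_pos (norm_pos_iff.2 hp)
    rwa [EuclideanSpace.real_norm_sq_eq, Fin.sum_univ_three] at this
  simp only [PiLp.inner_apply, Fin.sum_univ_three, RCLike.inner_apply, conj_trivial] at hv hw
  unfold det3 at hdet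
  obtain ⟨n0, hn0⟩ : ∃ x, x = v 1 * w 2 - v 2 * w 1 := ⟨_, rfl⟩
  obtain ⟨n1, hn1⟩ : ∃ x, x = v 2 * w 0 - v 0 * w 2 := ⟨_, rfl⟩
  obtain ⟨n2, hn2⟩ : ∃ x, x = v 0 * w 1 - v 1 * w 0 := ⟨_, rfl⟩
  have e : p 0 * n0 + p 1 * n1 + p 2 * n2 = 0 := by rw [hn0, hn1, hn2]; linear_combination hdet
  have e0 : p 1 * n2 - p 2 * n1 = 0 := by
    rw [hn1, hn2]; linear_combination v 0 * hw - w 0 * hv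
  have e1 : p 2 * n0 - p 0 * n2 = 0 := by
    rw [hn0, hn2]; linear_combination v 1 * hw - w 1 * hv
  have e2 : p 0 * n1 - p 1 * n0 = 0 := by
    rw [hn0, hn1]; linear_combination v 2 * hw - w 2 * hv
  have z0 : n0 = 0 := by
    refine (mul_eq_zero.1 (?_ : (p 0 ^ 2 + p 1 ^ 2 + p 2 ^ 2) * n0 = 0)).resolve_left hp'.ne'
    linear_combination p 0 * e - p 1 * e2 + p 2 * e1
  have z1 : n1 = 0 := by
    refine (mul_eq_zero.1 (?_ : (p 0 ^ 2 + p 1 ^ 2 + p 2 ^ 2) * n1 = 0)).resolve_left hp'.ne'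
    linear_combination p 1 * e + p 0 * e2 - p 2 * e0
  have z2 : n2 = 0 := by
    refine (mul_eq_zero.1 (?_ : (p 0 ^ 2 + p 1 ^ 2 + p 2 ^ 2) * n2 = 0)).resolve_left hp'.ne'
    linear_combination p 2 * e - p 0 * e1 + p 1 * e0
  rw [z0] at hn0
  rw [z1] at hn1
  rw [z2] at hn2
  have key : ∀ i, v i = 0 := by
    intro i
    have := h (w i) (-v i) (by
      ext k
      fin_cases i <;> fin_cases k <;> simp <;> linarith)
    linarith [this.2]
  have hv : v = 0 := by
    ext i
    exact key i
  simpa using (h 1 0 (by simp [hv])).1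

/-- The inclusion of the plane in 3-space. -/
def planeInclusion : Plane →L[ℝ] Space3 :=
  LinearMap.toContinuousLinearMap
    { toFun := fun p => !₂[p 0, p 1, 0]
      map_add' := fun p q => by ext i; fin_cases i <;> simp
      map_smul' := fun a p => by ext i; fin_cases i <;> simp }

instance : OrientedSurface Plane where
  emb := planeInclusion
  normal _ := EuclideanSpace.single 2 1
  contMDiff_emb := planeInclusion.contDiff.contMDiff
  continuous_normal := continuous_const
  det_ne_zero p v w h := by
    rw [mfderiv_eq_fderiv, planeInclusion.fderiv]
    have : det3 (EuclideanSpace.single 2 1) (planeInclusion v) (planeInclusion w) = det2 v w := by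
      simp [det3, det2, planeInclusion]
    exact this ▸ det2_ne_zero h

theorem inner_mvfderiv_sphere (p : Sphere2) (v : Plane) :
    inner ℝ (p : Space3) (mvfderiv (𝓡 2) (Subtype.val : Sphere2 → Space3) p v) = 0 := by
  have : Fact (Module.finrank ℝ Space3 = 2 + 1) := ⟨finrank_euclideanSpace_fin⟩
  refine (Submodule.mem_orthogonal_singleton_iff_inner_right).1 ?_
  rw [← range_mvfderiv_subtypeVal (n := 2) p]
  exact LinearMap.mem_range_self _ v

instance : OrientedSurface Sphere2 where
  emb := Subtype.val
  normal := Subtype.val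
  contMDiff_emb := by
    have : Fact (Module.finrank ℝ Space3 = 2 + 1) := ⟨finrank_euclideanSpace_fin⟩
    exact contMDiff_coe_sphere
  continuous_normal := continuous_subtype_val
  det_ne_zero p v w h := by
    have : Fact (Module.finrank ℝ Space3 = 2 + 1) := ⟨finrank_euclideanSpace_fin⟩
    exact det3_ne_zero (ne_zero_of_mem_unit_sphere p) (inner_mvfderiv_sphere p v)
      (inner_mvfderiv_sphere p w) (linearIndependent_map
        (L := (mvfderiv (𝓡 2) (Subtype.val : Sphere2 → Space3) p : Plane →L[ℝ] Space3))
        (injective_mvfderiv_subtypeVal_sphere (n := 2) p) h)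

end Surfaces

/-! ### The quandle that separates the trefoil from its mirror image. -/

section Heisenberg

/-- The generalized Alexander quandle of the integral Heisenberg group and its automorphism of
order six. -/
@[ext]
structure Heisenberg where
  a : ℤ
  b : ℤ
  r : ℤ

namespace Heisenberg

/-- The group law is (a, b, r)(a', b', r') = (a + a', b + b', r + r' + ab' - ba'), and φ(a, b, r) =
(-b, a + b, r) is an automorphism because its matrix has determinant 1. The quandle operation is `y
◃ x = φ(x y⁻¹) y`. The central coordinate of `y` cancels, so colors that differ by the center act
alike. -/
instance : Quandle Heisenberg where
  act y x := ⟨-(x.b - y.b) + y.a, (x.a - y.a) + (x.b - y.b) + y.b,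
    x.r - (x.a * y.b - x.b * y.a) +
      (-(x.b - y.b) * y.b - ((x.a - y.a) + (x.b - y.b)) * y.a)⟩
  invAct y x := ⟨(x.a - y.a) + (x.b - y.b) + y.a, -(x.a - y.a) + y.b,
    x.r - (x.a * y.b - x.b * y.a) +
      (((x.a - y.a) + (x.b - y.b)) * y.b + (x.a - y.a) * y.a)⟩
  self_distrib {x y z} := by ext <;> simp only <;> ring
  left_inv y x := by ext <;> simp only <;> ring
  right_inv y x := by ext <;> simp only <;> ring
  fix {x} := by ext <;> simp only <;> ring

theorem act_true (x y : Heisenberg) : act true y x =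
    ⟨-(x.b - y.b) + y.a, (x.a - y.a) + (x.b - y.b) + y.b, x.r - (x.a * y.b - x.b * y.a) +
      (-(x.b - y.b) * y.b - ((x.a - y.a) + (x.b - y.b)) * y.a)⟩ := rfl

theorem act_false (x y : Heisenberg) : act false y x =
    ⟨(x.a - y.a) + (x.b - y.b) + y.a, -(x.a - y.a) + y.b, x.r - (x.a * y.b - x.b * y.a) +
      (((x.a - y.a) + (x.b - y.b)) * y.b + (x.a - y.a) * y.a)⟩ := rfl

/-- The end of a nontrivial coloring of the trefoil whose crossings have sign `e`. -/
def target (e : Bool) : Heisenberg := ⟨0, 0, cond e 2 (-2)⟩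

/-- The color `x₂` has (a, b) = (1, 0), where N = a² + ab + b² takes the value 1; its central
coordinate is N or -N, and the last crossing doubles it. -/
theorem exists_trefoil (e : Bool) : ∃ x₁ x₂ : Heisenberg, x₁ = act e x₂ ⟨0, 0, 0⟩ ∧
    x₂ = act e ⟨0, 0, 0⟩ x₁ ∧ target e = act e x₁ x₂ := by
  cases e
  · exact ⟨act false ⟨1, 0, -1⟩ ⟨0, 0, 0⟩, ⟨1, 0, -1⟩, rfl, rfl, rfl⟩
  · exact ⟨act true ⟨1, 0, 1⟩ ⟨0, 0, 0⟩, ⟨1, 0, 1⟩, rfl, rfl, rfl⟩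

/-- With (a, b) the first two coordinates of `y₂`, the equations force the final central coordinate
to be 2N for sign `true` and -2N for sign `false`, where N = a² + ab + b². As the sign here is `!e`,
this would have to equal -2, respectively 2, which is impossible since N ≥ 0. -/
theorem not_mirror_trefoil (e : Bool) {y₁ y₂ : Heisenberg} (h₁ : y₁ = act (!e) y₂ ⟨0, 0, 0⟩)
    (h₂ : y₂ = act (!e) (target e) y₁) (h₃ : target e = act (!e) y₁ y₂) : False := by
  obtain ⟨a, b, r⟩ := y₂
  cases e
  · simp only [Bool.not_false, act_true] at h₁
    subst h₁
    simp only [Bool.not_false, act_true, target, cond_false, Heisenberg.mk.injEq] at h₂ h₃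
    obtain ⟨a2, b2, r2⟩ := h₂
    obtain ⟨a3, b3, r3⟩ := h₃
    nlinarith [sq_nonneg (a + b), sq_nonneg a, sq_nonneg b]
  · simp only [Bool.not_true, act_false] at h₁
    subst h₁
    simp only [Bool.not_true, act_false, target, cond_true, Heisenberg.mk.injEq] at h₂ h₃
    obtain ⟨a2, b2, r2⟩ := h₂
    obtain ⟨a3, b3, r3⟩ := h₃
    nlinarith [sq_nonneg (a + b), sq_nonneg a, sq_nonneg b]

end Heisenberg

end Heisenberg

end

section

open Filter Topology OrientedSurface

/-! ### Colorings of a curve with three undercrossings. -/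

section ThreeCrossings

/-- A step function with three jumps. -/
def stepFun₃ {Q : Type*} (p q r : ℝ) (x₀ x₁ x₂ x₃ : Q) (t : ℝ) : Q :=
  if t ≤ p then x₀ else if t ≤ q then x₁ else if t ≤ r then x₂ else x₃

variable {Q : Type*} [Quandle Q]

theorem isColoring_stepFun₃ {X : ℝ → ℝ → Bool → Prop} {p q r : ℝ} (hpq : p < q) (hqr : q < r)
    (free : ∀ t, t ≠ p → t ≠ q → t ≠ r → Free X t) {x₀ x₁ x₂ x₃ : Q}
    (h₁ : Step X (stepFun₃ p q r x₀ x₁ x₂ x₃) p x₁)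
    (h₂ : Step X (stepFun₃ p q r x₀ x₁ x₂ x₃) q x₂)
    (h₃ : Step X (stepFun₃ p q r x₀ x₁ x₂ x₃) r x₃) :
    IsColoring X (stepFun₃ p q r x₀ x₁ x₂ x₃) := by
  have v0 : ∀ t, t ≤ p → stepFun₃ p q r x₀ x₁ x₂ x₃ t = x₀ := fun t h => if_pos h
  have v1 : ∀ t, p < t → t ≤ q → stepFun₃ p q r x₀ x₁ x₂ x₃ t = x₁ := fun t h h' => by
    rw [stepFun₃, if_neg h.not_ge, if_pos h']
  have v2 : ∀ t, q < t → t ≤ r → stepFun₃ p q r x₀ x₁ x₂ x₃ t = x₂ := fun t h h' => by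
    rw [stepFun₃, if_neg (hpq.trans h).not_ge, if_neg h.not_ge, if_pos h']
  have v3 : ∀ t, r < t → stepFun₃ p q r x₀ x₁ x₂ x₃ t = x₃ := fun t h => by
    rw [stepFun₃, if_neg (hpq.trans (hqr.trans h)).not_ge, if_neg (hqr.trans h).not_ge,
      if_neg h.not_ge]
  constructor
  · intro t _
    rcases le_or_gt t p with k | k
    · filter_upwards [self_mem_nhdsWithin] with x hx
      rw [v0 t k, v0 x (le_of_lt (lt_of_lt_of_le hx k))]
    rcases le_or_gt t q with k' | k'
    · filter_upwards [Ioo_mem_nhdsLT k] with x hx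
      rw [v1 t k k', v1 x hx.1 (hx.2.le.trans k')]
    rcases le_or_gt t r with k'' | k''
    · filter_upwards [Ioo_mem_nhdsLT k'] with x hx
      rw [v2 t k' k'', v2 x hx.1 (hx.2.le.trans k'')]
    · filter_upwards [Ioo_mem_nhdsLT k''] with x hx
      rw [v3 t k'', v3 x hx.1]
  · intro t _
    rcases lt_trichotomy t p with k | rfl | k
    · filter_upwards [Ioo_mem_nhdsGT k] with x hx
      rw [step_iff_of_free (free t k.ne (k.trans hpq).ne (k.trans (hpq.trans hqr)).ne), v0 t k.le,
        v0 x hx.2.le]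
    · filter_upwards [Ioo_mem_nhdsGT hpq] with x hx
      rwa [v1 x hx.1 hx.2.le]
    rcases lt_trichotomy t q with k' | rfl | k'
    · filter_upwards [Ioo_mem_nhdsGT k'] with x hx
      rw [step_iff_of_free (free t k.ne' k'.ne (k'.trans hqr).ne), v1 t k k'.le,
        v1 x (k.trans hx.1) hx.2.le]
    · filter_upwards [Ioo_mem_nhdsGT hqr] with x hx
      rwa [v2 x hx.1 hx.2.le]
    rcases lt_trichotomy t r with k'' | rfl | k''
    · filter_upwards [Ioo_mem_nhdsGT k''] with x hx
      rw [step_iff_of_free (free t k.ne' k'.ne' k''.ne), v2 t k' k''.le,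
        v2 x (k'.trans hx.1) hx.2.le]
    · filter_upwards [self_mem_nhdsWithin] with x hx
      rwa [v3 x hx]
    · filter_upwards [self_mem_nhdsWithin] with x hx
      rw [step_iff_of_free (free t k.ne' k'.ne' k''.ne'), v3 t k'', v3 x (k''.trans hx)]

theorem IsColoring.eq_stepFun₃ {X : ℝ → ℝ → Bool → Prop} {p q r : ℝ} (hp : 0 < p) (hpq : p < q)
    (hqr : q < r) (hr : r < 1) (free : ∀ t, t ≠ p → t ≠ q → t ≠ r → Free X t) {f : ℝ → Q}
    (hf : IsColoring X f) {t : ℝ} (ht : t ∈ I) :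
    f t = stepFun₃ p q r (f 0) (f q) (f r) (f 1) t := by
  have fr0 : ∀ t ∈ Ioo 0 p, Free X t := fun t ht =>
    free t ht.2.ne (ht.2.trans hpq).ne (ht.2.trans (hpq.trans hqr)).ne
  unfold stepFun₃
  split_ifs with h1 h2 h3
  · have e : f p = f 0 := (step_iff_of_free (free 0 hp.ne (hp.trans hpq).ne
      (hp.trans (hpq.trans hqr)).ne)).1 (hf.step le_rfl hp (by linarith) fr0)
    rcases ht.1.eq_or_lt with rfl | h
    · rfl
    · rw [← e, hf.eq_of_free le_rfl (by linarith) fr0 ⟨h, h1⟩]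
  · exact hf.eq_of_free hp.le (by linarith) (fun t ht => free t ht.1.ne' ht.2.ne
      (ht.2.trans hqr).ne) ⟨not_le.1 h1, h2⟩
  · exact hf.eq_of_free (hp.trans hpq).le (by linarith) (fun t ht =>
      free t (hpq.trans ht.1).ne' ht.1.ne' ht.2.ne) ⟨not_le.1 h2, h3⟩
  · exact hf.eq_of_free (hp.trans (hpq.trans hqr)).le le_rfl (fun t ht =>
      free t (hpq.trans (hqr.trans ht.1)).ne' (hqr.trans ht.1).ne' ht.1.ne') ⟨not_le.1 h3, ht.2⟩

/-- Colorings in the presence of three crossings of the same sign. -/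
theorem hasColoring_iff_three {X : ℝ → ℝ → Bool → Prop} {p q r i j k : ℝ} {e : Bool}
    (hp : 0 < p) (hpq : p < q) (hqr : q < r) (hr : r < 1) (hi : i ∈ I) (hj : j ∈ I) (hk : k ∈ I)
    (hX : ∀ t s b, X t s b ↔ (t = p ∧ s = i ∨ t = q ∧ s = j ∨ t = r ∧ s = k) ∧ b = e) {x y : Q} :
    HasColoring X x y ↔ ∃ x₁ x₂, x₁ = act e (stepFun₃ p q r x x₁ x₂ y i) x ∧
      x₂ = act e (stepFun₃ p q r x x₁ x₂ y j) x₁ ∧ y = act e (stepFun₃ p q r x x₁ x₂ y k) x₂ := by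
  have free : ∀ t, t ≠ p → t ≠ q → t ≠ r → Free X t := fun t h1 h2 h3 s b h => by
    rcases (hX t s b).1 h with ⟨h | h | h, -⟩
    exacts [h1 h.1, h2 h.1, h3 h.1]
  have hpr := hpq.trans hqr
  have sp : ∀ (f : ℝ → Q) (z : Q), Step X f p z ↔ z = act e (f i) (f p) := fun f z =>
    step_iff_of_unique ((hX p i e).2 ⟨Or.inl ⟨rfl, rfl⟩, rfl⟩) fun s' b' h => by
      rcases (hX p s' b').1 h with ⟨h | h | h, h'⟩
      exacts [⟨h.2, h'⟩, (hpq.ne h.1).elim, (hpr.ne h.1).elim]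
  have sq : ∀ (f : ℝ → Q) (z : Q), Step X f q z ↔ z = act e (f j) (f q) := fun f z =>
    step_iff_of_unique ((hX q j e).2 ⟨Or.inr (Or.inl ⟨rfl, rfl⟩), rfl⟩) fun s' b' h => by
      rcases (hX q s' b').1 h with ⟨h | h | h, h'⟩
      exacts [(hpq.ne' h.1).elim, ⟨h.2, h'⟩, (hqr.ne h.1).elim]
  have sr : ∀ (f : ℝ → Q) (z : Q), Step X f r z ↔ z = act e (f k) (f r) := fun f z =>
    step_iff_of_unique ((hX r k e).2 ⟨Or.inr (Or.inr ⟨rfl, rfl⟩), rfl⟩) fun s' b' h => by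
      rcases (hX r s' b').1 h with ⟨h | h | h, h'⟩
      exacts [(hpr.ne' h.1).elim, (hqr.ne' h.1).elim, ⟨h.2, h'⟩]
  constructor
  · rintro ⟨f, hf, rfl, rfl⟩
    have ev : ∀ {t}, t ∈ I → f t = stepFun₃ p q r (f 0) (f q) (f r) (f 1) t := fun ht =>
      hf.eq_stepFun₃ hp hpq hqr hr free ht
    refine ⟨f q, f r, ?_, ?_, ?_⟩
    · have e : f p = f 0 := (ev ⟨hp.le, by linarith⟩).trans (if_pos le_rfl)
      rw [← ev hi, ← e]
      exact (sp f _).1 (hf.step hp.le hpq (by linarith) fun t ht =>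
        free t ht.1.ne' ht.2.ne (ht.2.trans hqr).ne)
    · rw [← ev hj]
      exact (sq f _).1 (hf.step (hp.trans hpq).le hqr hr.le fun t ht =>
        free t (hpq.trans ht.1).ne' ht.1.ne' ht.2.ne)
    · rw [← ev hk]
      exact (sr f _).1 (hf.step (hp.trans hpr).le hr le_rfl fun t ht =>
        free t (hpr.trans ht.1).ne' (hqr.trans ht.1).ne' ht.1.ne')
  · rintro ⟨x₁, x₂, h1, h2, h3⟩
    refine ⟨stepFun₃ p q r x x₁ x₂ y, isColoring_stepFun₃ hpq hqr free ((sp _ _).2 ?_)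
      ((sq _ _).2 ?_) ((sr _ _).2 ?_), if_pos hp.le, ?_⟩
    · rwa [stepFun₃.eq_def p q r x x₁ x₂ y p, if_pos le_rfl]
    · rwa [stepFun₃.eq_def p q r x x₁ x₂ y q, if_neg hpq.not_ge, if_pos le_rfl]
    · rwa [stepFun₃.eq_def p q r x x₁ x₂ y r, if_neg hpr.not_ge, if_neg hqr.not_ge, if_pos le_rfl]
    · rw [stepFun₃, if_neg (by linarith), if_neg (by linarith), if_neg hr.not_ge]

end ThreeCrossings

/-! ### End colors of the trefoil and of its mirror image. -/

section TrefoilColorings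

variable {M : Type*} [TopologicalSpace M] [ChartedSpace Plane M] [OrientedSurface M]

theorem Diagram.mirror_crossing (D : Diagram M) {t s : ℝ} {b : Bool} :
    D.mirror.Crossing t s b ↔ D.Crossing s t (!b) := by
  constructor
  · rintro ⟨ht, hs, hts, h, hu, hb⟩
    refine ⟨hs, ht, hts.symm, h.symm, ?_, ?_⟩
    · exact (D.crossing t ht s hs hts h).1 (not_not.1 hu)
    · rw [D.sgn_swap ht hs hts h, hb]
      rfl
  · rintro ⟨hs, ht, hts, h, hu, hb⟩
    refine ⟨ht, hs, hts.symm, h.symm, not_not.2 ((D.crossing t ht s hs hts.symm h.symm).2 hu), ?_⟩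
    rw [D.sgn_swap ht hs hts.symm h.symm, Bool.not_inj_iff] at hb
    exact hb

/-- The inverse of `param`. -/
def unparam (u : ℝ) : ℝ := (u + 2) / 4

theorem param_eq_iff {t u : ℝ} : param t = u ↔ t = unparam u := by
  unfold param unparam
  constructor <;> intro h <;> linarith

theorem unparam_lt {u v : ℝ} : unparam u < unparam v ↔ u < v := by
  unfold unparam
  constructor <;> intro h <;> linarith

theorem unparam_le {u v : ℝ} : unparam u ≤ unparam v ↔ u ≤ v := by
  unfold unparam
  constructor <;> intro h <;> linarith

theorem unparam_mem {u : ℝ} (h : -2 < u) (h' : u < 2) : unparam u ∈ Ioo 0 1 := by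
  unfold unparam
  constructor <;> linarith

/-- The pairs of parameters of an under-passing and an over-passing strand. -/
def IsUnderOver (u v : ℝ) : Prop :=
  (u = -√3 ∧ v = √3) ∨ (u = crossB ∧ v = -crossA) ∨ (u = crossA ∧ v = -crossB)

theorem trefoil_crossing_iff {t s : ℝ} :
    (t ∈ I ∧ s ∈ I ∧ t ≠ s ∧ trefoilCurve t = trefoilCurve s ∧ t ∉ trefoilUpper) ↔
      IsUnderOver (param t) (param s) := by
  obtain ⟨hab, hab1, h1, h2, h3, h4⟩ := cross_facts
  have e3 := sqrt_three_sq
  have e2 : crossA ^ 2 + crossB ^ 2 = 4 := by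
    have := sqrt_two_sq
    rw [← hab] at this
    linear_combination this + 2 * hab1
  constructor
  · rintro ⟨-, -, hts, h, hu⟩
    simp only [trefoilUpper, mem_ofPred_eq, not_or] at hu
    unfold IsUnderOver
    rcases trefoilCurve_double hts h with k | k | k | k | k | k
    · exact (hu.2.2 k.1).elim
    · exact Or.inl k
    · exact Or.inr (Or.inr k)
    · exact (hu.2.1 k.1).elim
    · exact (hu.1 k.1).elim
    · exact Or.inr (Or.inl k)
  · intro h
    have hx : param t ^ 3 - 3 * param t = param s ^ 3 - 3 * param s := by
      rcases h with h | h | h <;> rw [h.1, h.2]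
      · linear_combination -2 * √3 * e3
      · linear_combination (crossA + crossB) * e2 - (crossA + crossB) * hab1
      · linear_combination (crossA + crossB) * e2 - (crossA + crossB) * hab1
    have hy : param t ^ 4 - 4 * param t ^ 2 = param s ^ 4 - 4 * param s ^ 2 := by
      rcases h with h | h | h <;> rw [h.1, h.2]
      · ring
      · linear_combination (crossB ^ 2 - crossA ^ 2) * e2
      · linear_combination (crossA ^ 2 - crossB ^ 2) * e2
    have b : -2 < param t ∧ param t < 2 ∧ -2 < param s ∧ param s < 2 ∧ param t ≠ param s := by
      rcases h with h | h | h <;> rw [h.1, h.2] <;>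
        refine ⟨by linarith, by linarith, by linarith, by linarith, fun k => by linarith⟩
    refine ⟨?_, ?_, fun k => b.2.2.2.2 (congrArg param k), ?_, ?_⟩
    · have := b.1; have := b.2.1
      unfold param at *
      constructor <;> linarith
    · have := b.2.2.1; have := b.2.2.2.1
      unfold param at *
      constructor <;> linarith
    · unfold trefoilCurve
      rw [hx, hy]
    · simp only [trefoilUpper, mem_ofPred_eq, not_or]
      rcases h with h | h | h <;> rw [h.1] <;>
        refine ⟨fun k => ?_, fun k => ?_, fun k => ?_⟩ <;> linarith

/-- The determinant takes the under-strand first. The crossings are negative in the usual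
convention, which takes the over-strand first, so it is positive. Its value is 768√3 at the crossing
on the axis of symmetry and 384(a + b) at the two others, with a = `crossA` and b = `crossB`. -/
theorem trefoil_det2_pos {t s : ℝ} (h : IsUnderOver (param t) (param s)) :
    0 < det2 (deriv trefoilCurve t) (deriv trefoilCurve s) := by
  obtain ⟨hab, hab1, h1, h2, h3, h4⟩ := cross_facts
  have e3 := sqrt_three_sq
  have e2 : crossA ^ 2 + crossB ^ 2 = 4 := by
    have := sqrt_two_sq
    rw [← hab] at this
    linear_combination this + 2 * hab1
  rw [(hasDerivAt_trefoilCurve t).deriv, (hasDerivAt_trefoilCurve s).deriv]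
  simp only [det2, Matrix.cons_val_zero, Matrix.cons_val_one]
  rcases h with h | h | h <;> rw [h.1, h.2]
  · have : 0 < 768 * √(3 : ℝ) := by linarith
    refine this.trans_eq ?_
    linear_combination (-384 * √3 ^ 3) * e3
  · have : 0 < 384 * (crossA + crossB) := by linarith
    refine this.trans_eq ?_
    linear_combination (-192 * (crossA + crossB)) * e2 +
      192 * crossA * crossB * (crossA + crossB) * hab1
  · have : 0 < 384 * (crossA + crossB) := by linarith
    refine this.trans_eq ?_
    linear_combination (-192 * (crossA + crossB)) * e2 +
      192 * crossA * crossB * (crossA + crossB) * hab1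

variable {σ : Plane → M} (hσ : ContMDiff (𝓡 2) (𝓡 2) ∞ σ) (inj : Function.Injective σ)
  (imm : ∀ p, Function.Injective (mfderiv (𝓡 2) (𝓡 2) σ p))

theorem trefoil_map_crossing {t s : ℝ} {b : Bool} :
    (trefoilPlane.map σ hσ inj imm).Crossing t s b ↔
      IsUnderOver (param t) (param s) ∧ b = decide (0 < orientation σ 0) := by
  have key : IsUnderOver (param t) (param s) →
      (trefoilPlane.map σ hσ inj imm).sgn t s = decide (0 < orientation σ 0) := by
    intro h
    have h' := trefoil_crossing_iff.2 h
    have e : crossForm (trefoilPlane.map σ hσ inj imm).γ t s =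
        det2 (deriv trefoilCurve t) (deriv trefoilCurve s) * orientation σ (trefoilCurve t) :=
      crossForm_eq hσ EventuallyEq.rfl EventuallyEq.rfl
        (hasDerivAt_trefoilCurve t).differentiableAt (hasDerivAt_trefoilCurve s).differentiableAt
        h'.2.2.2.1
    rw [Diagram.sgn, decide_eq_decide, e, mul_pos_iff_of_pos_left (trefoil_det2_pos h)]
    have ho := orientation_mul_pos hσ imm (trefoilCurve t) 0
    exact ⟨fun k => (pos_iff_pos_of_mul_pos ho).1 k, fun k => (pos_iff_pos_of_mul_pos ho).2 k⟩
  constructor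
  · rintro ⟨ht, hs, hts, h, hu, hb⟩
    have h' := trefoil_crossing_iff.1 ⟨ht, hs, hts, inj h, hu⟩
    exact ⟨h', hb.trans (key h')⟩
  · rintro ⟨h, hb⟩
    obtain ⟨ht, hs, hts, h', hu⟩ := trefoil_crossing_iff.2 h
    exact ⟨ht, hs, hts, congrArg σ h', hu, hb.trans (key h).symm⟩

variable {Q : Type*} [Quandle Q]

/-- In the order -a < -√3 < -b < b < √3 < a the undercrossings are at -√3, b, a, below the strands
at √3, -a, -b. So the second one passes under the initial arc. -/
theorem trefoil_hasColoring_iff {x y : Q} :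
    HasColoring (trefoilPlane.map σ hσ inj imm).Crossing x y ↔ ∃ x₁ x₂,
      x₁ = act (decide (0 < orientation σ 0)) x₂ x ∧
      x₂ = act (decide (0 < orientation σ 0)) x x₁ ∧
      y = act (decide (0 < orientation σ 0)) x₁ x₂ := by
  obtain ⟨-, -, h1, h2, h3, h4⟩ := cross_facts
  rw [hasColoring_iff_three (p := unparam (-√3)) (q := unparam crossB) (r := unparam crossA)
    (i := unparam √3) (j := unparam (-crossA)) (k := unparam (-crossB))
    (e := decide (0 < orientation σ 0))
    (unparam_mem (by linarith) (by linarith)).1 (unparam_lt.2 (by linarith))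
    (unparam_lt.2 (by linarith)) (unparam_mem (by linarith) (by linarith)).2
    (Ioo_subset_Icc_self (unparam_mem (by linarith) (by linarith)))
    (Ioo_subset_Icc_self (unparam_mem (by linarith) (by linarith)))
    (Ioo_subset_Icc_self (unparam_mem (by linarith) (by linarith)))
    (fun t s b => by simp only [trefoil_map_crossing, IsUnderOver, param_eq_iff])]
  have k1 : ∀ x₁ x₂ : Q, stepFun₃ (unparam (-√3)) (unparam crossB) (unparam crossA) x x₁ x₂ y
      (unparam √3) = x₂ := fun x₁ x₂ => by
    rw [stepFun₃, if_neg (by rw [unparam_le]; linarith), if_neg (by rw [unparam_le]; linarith),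
      if_pos (by rw [unparam_le]; linarith)]
  have k2 : ∀ x₁ x₂ : Q, stepFun₃ (unparam (-√3)) (unparam crossB) (unparam crossA) x x₁ x₂ y
      (unparam (-crossA)) = x := fun x₁ x₂ => by
    rw [stepFun₃, if_pos (by rw [unparam_le]; linarith)]
  have k3 : ∀ x₁ x₂ : Q, stepFun₃ (unparam (-√3)) (unparam crossB) (unparam crossA) x x₁ x₂ y
      (unparam (-crossB)) = x₁ := fun x₁ x₂ => by
    rw [stepFun₃, if_neg (by rw [unparam_le]; linarith), if_pos (by rw [unparam_le]; linarith)]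
  simp only [k1, k2, k3]

/-- The undercrossings are now at -a, -b, √3, below the strands at b, a, -√3. So the second one
passes under the final arc, whence `y` in place of `x`, and all signs are reversed. -/
theorem trefoil_mirror_hasColoring_iff {x y : Q} :
    HasColoring (trefoilPlane.map σ hσ inj imm).mirror.Crossing x y ↔ ∃ x₁ x₂,
      x₁ = act (!decide (0 < orientation σ 0)) x₂ x ∧
      x₂ = act (!decide (0 < orientation σ 0)) y x₁ ∧
      y = act (!decide (0 < orientation σ 0)) x₁ x₂ := by
  obtain ⟨-, -, h1, h2, h3, h4⟩ := cross_facts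
  rw [hasColoring_iff_three (p := unparam (-crossA)) (q := unparam (-crossB)) (r := unparam √3)
    (i := unparam crossB) (j := unparam crossA) (k := unparam (-√3))
    (e := !decide (0 < orientation σ 0))
    (unparam_mem (by linarith) (by linarith)).1 (unparam_lt.2 (by linarith))
    (unparam_lt.2 (by linarith)) (unparam_mem (by linarith) (by linarith)).2
    (Ioo_subset_Icc_self (unparam_mem (by linarith) (by linarith)))
    (Ioo_subset_Icc_self (unparam_mem (by linarith) (by linarith)))
    (Ioo_subset_Icc_self (unparam_mem (by linarith) (by linarith)))
    (fun t s b => by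
      simp only [Diagram.mirror_crossing, trefoil_map_crossing, IsUnderOver, param_eq_iff,
        Bool.not_eq_eq_eq_not]
      tauto)]
  have k1 : ∀ x₁ x₂ : Q, stepFun₃ (unparam (-crossA)) (unparam (-crossB)) (unparam √3) x x₁ x₂ y
      (unparam crossB) = x₂ := fun x₁ x₂ => by
    rw [stepFun₃, if_neg (by rw [unparam_le]; linarith), if_neg (by rw [unparam_le]; linarith),
      if_pos (by rw [unparam_le]; linarith)]
  have k2 : ∀ x₁ x₂ : Q, stepFun₃ (unparam (-crossA)) (unparam (-crossB)) (unparam √3) x x₁ x₂ y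
      (unparam crossA) = y := fun x₁ x₂ => by
    rw [stepFun₃, if_neg (by rw [unparam_le]; linarith), if_neg (by rw [unparam_le]; linarith),
      if_neg (by rw [unparam_le]; linarith)]
  have k3 : ∀ x₁ x₂ : Q, stepFun₃ (unparam (-crossA)) (unparam (-crossB)) (unparam √3) x x₁ x₂ y
      (unparam (-√3)) = x₁ := fun x₁ x₂ => by
    rw [stepFun₃, if_neg (by rw [unparam_le]; linarith), if_pos (by rw [unparam_le]; linarith)]
  simp only [k1, k2, k3]

/-- The trefoil is chiral in every oriented surface. -/
theorem trefoil_isChiral : (trefoilPlane.map σ hσ inj imm).knotoid.IsChiral := by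
  intro h
  change _ = (trefoilPlane.map σ hσ inj imm).mirror.knotoid at h
  have key := hasColoring_iff_of_knotoid_eq h (x := (⟨0, 0, 0⟩ : Heisenberg))
    (y := Heisenberg.target (decide (0 < orientation σ 0)))
  rw [trefoil_hasColoring_iff, trefoil_mirror_hasColoring_iff] at key
  obtain ⟨y₁, y₂, h₁, h₂, h₃⟩ := key.1 (Heisenberg.exists_trefoil _)
  exact Heisenberg.not_mirror_trefoil _ h₁ h₂ h₃

end TrefoilColorings

end

end Knotoids

end

theorem theorem5p1 :
    Knotoids.trefoilPlane.knotoid.IsChiral ∧ Knotoids.trefoilSphere.knotoid.IsChiral :=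
  -- The image of `trefoilPlane` under the identity is `trefoilPlane` by definition.
  ⟨Knotoids.trefoil_isChiral (σ := id) contMDiff_id Function.injective_id fun p => by
    rw [mfderiv_id]; exact Function.injective_id,
    Knotoids.trefoil_isChiral Knotoids.contMDiff_stereo Knotoids.stereo_injective
      Knotoids.mfderiv_stereo_injective⟩
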